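/- Let $M$ be a smooth (Hausdorff, second countable) oriented manifold of dimension $n\ge 1$ and let $F\colon TM\to[0,\infty)$ be a smooth Finsler metric on $M$: $F$ is continuous, $C^\infty$ off the zero section, satisfies $F(x,\lambda v)=\lambda F(x,v)$ for $\lambda>0$, vanishes exactly on the zero section, and is strongly convex, i.e. the Hessian of $F^2$ restricted to $T_xM$ is positive definite at every nonzero $v\in T_xM$. Let $HM=(TM\smallsetminus\{0\})/\mathbb R_{>0}$ be the homogenized bundle, with projections $r\colon TM\smallsetminus\{0\}\to HM$ and $\pi\colon HM\to M$, fibres $H_xM=\pi^{-1}(x)$ and vertical bundle $VHM=\ker d\pi$. Let $A$ be the Hilbert form of $F$, the $1$-form on $HM$ determined by $r^*A=d_vF$, where in local coordinates $(x^i,v^i)$ one has $d_vF=\frac{\partial F}{\partial v^i}\,dx^i$. Give each fibre $H_xM$, the sphere of rays of the oriented vector space $T_xM$, the induced orientation as the boundary of a ball of $T_xM$ (for $n=1$: the positive ray counts with sign $+$ and the negative ray with sign $-$). Then there is a unique volume form (smooth nowhere vanishing $n$-form, not required to be positive for the given orientation) $\Omega^F$ on $M$ for which there exists a smooth $(n-1)$-form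 $\alpha^F$ on $HM$ whose restriction to $VHM$ is nowhere zero (for $n=1$, where $VHM=0$: a nowhere zero function) and such that $$\alpha^F\wedge\pi^*\Omega^F=A\wedge (dA)^{n-1},$$ and, for all $x\in M$, $$\int_{H_xM}\alpha^F=\operatorname{vol}(\mathbb S^{n-1}),$$ where $\operatorname{vol}(\mathbb S^{n-1})$ is the Euclidean volume of the unit sphere of $\mathbb R^n$ (equal to $2$ for $n=1$). -/

import Mathlib

open Set Filter Topology MeasureTheory Module
open scoped Manifold ContDiff

noncomputable section

/-! ### Exterior algebra on one vector space -/

section Wedge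

variable {V : Type*} [AddCommGroup V] [Module ℝ V]

/-- The wedge product of real alternating forms (a sum over shuffles, so that
`(a ∧ b) (v, w) = a v * b w - a w * b v` for two linear forms). -/
def wedge {p q : ℕ} (a : V [⋀^Fin p]→ₗ[ℝ] ℝ) (b : V [⋀^Fin q]→ₗ[ℝ] ℝ) :
    V [⋀^Fin (p + q)]→ₗ[ℝ] ℝ :=
  ((LinearMap.mul' ℝ ℝ).compAlternatingMap (a.domCoprod b)).domDomCongr finSumFinEquiv

/-- The `k`-fold wedge power of an alternating form. -/
def wedgePow {p : ℕ} (b : V [⋀^Fin p]→ₗ[ℝ] ℝ) : (k : ℕ) → V [⋀^Fin (p * k)]→ₗ[ℝ] ℝ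
  | 0 => AlternatingMap.constOfIsEmpty ℝ V (Fin 0) 1
  | k + 1 => wedge (wedgePow b k) b

end Wedge

/-! ### Differential forms on manifolds without boundary -/

section Forms

variable {V : Type*} [NormedAddCommGroup V] [NormedSpace ℝ V]
  {W : Type*} [NormedAddCommGroup W] [NormedSpace ℝ W]

/-- A (not necessarily smooth) differential `k`-form on a manifold `N` modelled on `V`. -/
abbrev DiffForm (V : Type*) [NormedAddCommGroup V] [NormedSpace ℝ V] (k : ℕ)
    (N : Type*) [TopologicalSpace N] [ChartedSpace V N] :=
  (p : N) → TangentSpace 𝓘(ℝ, V) p [⋀^Fin k]→L[ℝ] ℝ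

variable {N : Type*} [TopologicalSpace N] [ChartedSpace V N]
  {N' : Type*} [TopologicalSpace N'] [ChartedSpace W N']

/-- Pullback of a differential form by a map. -/
def DiffForm.pullback {k : ℕ} (f : N' → N) (θ : DiffForm V k N) : DiffForm W k N' :=
  fun p => (θ (f p)).compContinuousLinearMap (mfderiv 𝓘(ℝ, W) 𝓘(ℝ, V) f p)

/-- The expression of a form in the preferred chart around `p`: its pullback to the model space by
the inverse of that chart. -/
def DiffForm.inChart {k : ℕ} (θ : DiffForm V k N) (p : N) : V → V [⋀^Fin k]→L[ℝ] ℝ :=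
  θ.pullback (chartAt V p).symm

/-- A form is smooth if it is smooth in all preferred charts. -/
def DiffForm.IsSmooth {k : ℕ} (θ : DiffForm V k N) : Prop :=
  ∀ p : N, ContDiffOn ℝ ∞ (θ.inChart p) (chartAt V p).target

/-- The exterior derivative, computed at `p` in the preferred chart around `p`. -/
def DiffForm.d {k : ℕ} (θ : DiffForm V k N) : DiffForm V (k + 1) N :=
  fun p => (extDeriv (θ.inChart p) (chartAt V p p)).compContinuousLinearMap
    (mfderiv 𝓘(ℝ, V) 𝓘(ℝ, V) (chartAt V p) p)

end Forms

/-- `ℝᵏ` with its Euclidean structure. -/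
abbrev Eu (k : ℕ) := EuclideanSpace ℝ (Fin k)

/-! ### The homogenized bundle -/

section HomBundle

variable {m : ℕ} {M : Type*} [TopologicalSpace M] [ChartedSpace (Eu (m + 1)) M]

/-- The homogenized bundle `HM = (TM ∖ 0) / ℝ₊` of a manifold of dimension `n = m + 1`: its points
are the pairs of a point `x` of `M` and a ray (a class of nonzero vectors up to positive factors) of
`T_x M`. The field `proj` is the projection `π : HM → M`. -/
@[ext]
structure HomBundle (m : ℕ) (M : Type*) [TopologicalSpace M] [ChartedSpace (Eu (m + 1)) M] where
  proj : M
  ray : Module.Ray ℝ (TangentSpace 𝓘(ℝ, Eu (m + 1)) proj)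

namespace HomBundle

theorem nonempty_ray (x : M) : Nonempty (Module.Ray ℝ (TangentSpace 𝓘(ℝ, Eu (m + 1)) x)) :=
  ⟨rayOfNeZero ℝ (M := Eu (m + 1)) (EuclideanSpace.single 0 1) (by simp)⟩

open Classical in
/-- The class `[x, v]` of a nonzero tangent vector `v` at `x`
(for `v = 0`, the value is an irrelevant ray). -/
def cls (x : M) (v : TangentSpace 𝓘(ℝ, Eu (m + 1)) x) : HomBundle m M where
  proj := x
  ray := if h : v ≠ 0 then rayOfNeZero ℝ v h else Classical.choice (nonempty_ray x)

/-- A nonzero tangent vector representing a point of `HM`. -/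
def rep (p : HomBundle m M) : TangentSpace 𝓘(ℝ, Eu (m + 1)) p.proj := p.ray.someVector

theorem rep_ne_zero (p : HomBundle m M) : p.rep ≠ 0 := p.ray.someVector_ne_zero

theorem cls_rep (p : HomBundle m M) : cls p.proj p.rep = p := by
  have h := rep_ne_zero p
  unfold cls
  rw [dif_pos h]
  exact congrArg (HomBundle.mk p.proj) p.ray.someVector_ray

theorem cls_smul (x : M) (v : TangentSpace 𝓘(ℝ, Eu (m + 1)) x) {l : ℝ} (hl : 0 < l) :
    cls x (l • v) = cls x v := by
  by_cases h : v = 0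
  · simp [h]
  · unfold cls
    rw [dif_pos h, dif_pos (smul_ne_zero hl.ne' h)]
    exact congrArg (HomBundle.mk x) (ray_pos_smul h hl _)

theorem rep_cls (x : M) (v : TangentSpace 𝓘(ℝ, Eu (m + 1)) x) (hv : v ≠ 0) :
    ∃ l : ℝ, 0 < l ∧ rep (cls x v) = l • v := by
  have h1 : rayOfNeZero ℝ _ (rep_ne_zero (cls x v)) = rayOfNeZero ℝ v hv := by
    refine (Module.Ray.someVector_ray (cls x v).ray).trans ?_
    unfold cls
    exact dif_pos hv
  have h2 := (ray_eq_iff (rep_ne_zero (cls x v)) hv).1 h1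
  obtain ⟨l, hl, h⟩ := h2.symm.exists_pos_left hv (rep_ne_zero _)
  exact ⟨l, hl, h.symm⟩

end HomBundle

/-- The vector whose `i`-th coordinate is the sign `s` and whose other coordinates are `y`. -/
def affVec (i : Fin (m + 1)) (s : ℤˣ) (y : Eu m) : Eu (m + 1) :=
  WithLp.toLp 2 (i.insertNth (α := fun _ => ℝ) ((s : ℤ) : ℝ) y)

/-- The affine coordinates of (the ray of) a vector in the open half space `s * v i > 0`. -/
def affCoord (i : Fin (m + 1)) (s : ℤˣ) (v : Eu (m + 1)) : Eu m :=
  WithLp.toLp 2 fun j => v (i.succAbove j) / (((s : ℤ) : ℝ) * v i)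

theorem unitSign_mul_self (s : ℤˣ) : ((s : ℤ) : ℝ) * ((s : ℤ) : ℝ) = 1 := by
  rcases Int.units_eq_one_or s with h | h <;> simp [h]

theorem affVec_same (i : Fin (m + 1)) (s : ℤˣ) (y : Eu m) :
    affVec i s y i = ((s : ℤ) : ℝ) := by
  simp [affVec]

theorem affVec_ne_zero (i : Fin (m + 1)) (s : ℤˣ) (y : Eu m) : affVec i s y ≠ 0 := by
  intro h
  have h1 := affVec_same i s y
  have h2 := unitSign_mul_self s
  rw [← h1, h] at h2
  simp at h2

theorem affCoord_affVec (i : Fin (m + 1)) (s : ℤˣ) (y : Eu m) :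
    affCoord i s (affVec i s y) = y := by
  ext j
  simp [affCoord, affVec, unitSign_mul_self]

theorem affCoord_smul (i : Fin (m + 1)) (s : ℤˣ) (v : Eu (m + 1)) {l : ℝ} (hl : 0 < l) :
    affCoord i s (l • v) = affCoord i s v := by
  ext j
  simp only [affCoord, PiLp.smul_apply, smul_eq_mul]
  rw [mul_left_comm, mul_div_mul_left _ _ hl.ne']

theorem affVec_affCoord (i : Fin (m + 1)) (s : ℤˣ) (v : Eu (m + 1))
    (hv : 0 < ((s : ℤ) : ℝ) * v i) :
    affVec i s (affCoord i s v) = (((s : ℤ) : ℝ) * v i)⁻¹ • v := by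
  ext k
  refine Fin.succAboveCases i ?_ (fun j => ?_) k
  · rw [affVec_same, PiLp.smul_apply, smul_eq_mul, inv_mul_eq_div, eq_div_iff hv.ne', ← mul_assoc,
      unitSign_mul_self, one_mul]
  · simp [affVec, affCoord, div_eq_inv_mul]

theorem exists_half_space {v : Eu (m + 1)} (hv : v ≠ 0) :
    ∃ a : Fin (m + 1) × ℤˣ, 0 < ((a.2 : ℤ) : ℝ) * v a.1 := by
  have : ∃ i, v i ≠ 0 := by
    by_contra! h
    exact hv (by ext i; simpa using h i)
  obtain ⟨i, hi⟩ := this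
  rcases lt_or_gt_of_ne hi with h | h
  · exact ⟨(i, -1), by simpa using h⟩
  · exact ⟨(i, 1), by simpa using h⟩

theorem contDiff_affVec (i : Fin (m + 1)) (s : ℤˣ) : ContDiff ℝ ∞ (affVec i s) := by
  rw [contDiff_euclidean]
  intro k
  refine Fin.succAboveCases i ?_ (fun j => ?_) k
  · simp only [affVec_same]; exact contDiff_const
  · have : (fun y : Eu m => affVec i s y (i.succAbove j)) = fun y => y j := by
      ext y; simp [affVec]
    rw [this]; fun_prop

theorem contDiffOn_affCoord (i : Fin (m + 1)) (s : ℤˣ) :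
    ContDiffOn ℝ ∞ (affCoord i s) {v | 0 < ((s : ℤ) : ℝ) * v i} := by
  rw [contDiffOn_euclidean]
  intro j
  refine ContDiffOn.div (by fun_prop) (by fun_prop) fun v hv => ?_
  exact ne_of_gt hv

namespace HomBundle

variable [IsManifold 𝓘(ℝ, Eu (m + 1)) ∞ M]

/-- The coordinates, in a chart `c` of `M`, of a tangent vector at `x`: the derivative at `x` of
`c`. -/
def toChart (c : atlas (Eu (m + 1)) M) (x : M) (v : TangentSpace 𝓘(ℝ, Eu (m + 1)) x) : Eu (m + 1) :=
  (tangentBundleCore 𝓘(ℝ, Eu (m + 1)) M).coordChange (achart _ x) c x v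

/-- The tangent vector at `x` with given coordinates in a chart `c` of `M`. -/
def ofChart (c : atlas (Eu (m + 1)) M) (x : M) (w : Eu (m + 1)) : TangentSpace 𝓘(ℝ, Eu (m + 1)) x :=
  (tangentBundleCore 𝓘(ℝ, Eu (m + 1)) M).coordChange c (achart _ x) x w

theorem toChart_ofChart (c c' : atlas (Eu (m + 1)) M) (x : M) (hx : x ∈ c.1.source)
    (hx' : x ∈ c'.1.source) (w : Eu (m + 1)) :
    toChart c' x (ofChart c x w) =
      (tangentBundleCore 𝓘(ℝ, Eu (m + 1)) M).coordChange c c' x w :=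
  (tangentBundleCore 𝓘(ℝ, Eu (m + 1)) M).coordChange_comp _ _ _ x
    ⟨⟨hx, mem_chart_source _ x⟩, hx'⟩ w

theorem toChart_ofChart_self (c : atlas (Eu (m + 1)) M) (x : M) (hx : x ∈ c.1.source)
    (w : Eu (m + 1)) : toChart c x (ofChart c x w) = w := by
  rw [toChart_ofChart c c x hx hx]
  exact (tangentBundleCore 𝓘(ℝ, Eu (m + 1)) M).coordChange_self c x hx w

theorem ofChart_toChart (c : atlas (Eu (m + 1)) M) (x : M) (hx : x ∈ c.1.source)
    (v : TangentSpace 𝓘(ℝ, Eu (m + 1)) x) : ofChart c x (toChart c x v) = v :=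
  ((tangentBundleCore 𝓘(ℝ, Eu (m + 1)) M).coordChange_comp _ _ _ x
    ⟨⟨mem_chart_source _ x, hx⟩, mem_chart_source _ x⟩ v).trans
    ((tangentBundleCore 𝓘(ℝ, Eu (m + 1)) M).coordChange_self _ x (mem_chart_source _ x) v)

theorem toChart_smul (c : atlas (Eu (m + 1)) M) (x : M) (l : ℝ)
    (v : TangentSpace 𝓘(ℝ, Eu (m + 1)) x) : toChart c x (l • v) = l • toChart c x v :=
  map_smul _ l v

theorem ofChart_smul (c : atlas (Eu (m + 1)) M) (x : M) (l : ℝ)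
    (v : Eu (m + 1)) : ofChart c x (l • v) = l • ofChart c x v :=
  map_smul _ l v

theorem ofChart_ne_zero (c : atlas (Eu (m + 1)) M) (x : M) (hx : x ∈ c.1.source)
    {w : Eu (m + 1)} (hw : w ≠ 0) : ofChart c x w ≠ 0 := by
  intro h
  apply hw
  rw [← toChart_ofChart_self c x hx w, h]
  exact map_zero _

theorem toChart_ne_zero (c : atlas (Eu (m + 1)) M) (x : M) (hx : x ∈ c.1.source)
    {v : TangentSpace 𝓘(ℝ, Eu (m + 1)) x} (hv : v ≠ 0) : toChart c x v ≠ 0 := by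
  intro h
  apply hv
  rw [← ofChart_toChart c x hx v, h]
  exact map_zero _

theorem affCoord_toChart_rep_cls (i : Fin (m + 1)) (s : ℤˣ) (c : atlas (Eu (m + 1)) M) (x : M)
    {v : TangentSpace 𝓘(ℝ, Eu (m + 1)) x} (hv : v ≠ 0) :
    affCoord i s (toChart c x (rep (cls x v))) = affCoord i s (toChart c x v) := by
  obtain ⟨l, hl, h⟩ := rep_cls x v hv
  have : toChart c x (rep (cls x v)) = l • toChart c x v := by
    rw [← toChart_smul]; exact congrArg _ h
  rw [this, affCoord_smul i s _ hl]

theorem pos_toChart_rep_cls (i : Fin (m + 1)) (s : ℤˣ) (c : atlas (Eu (m + 1)) M) (x : M)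
    {v : TangentSpace 𝓘(ℝ, Eu (m + 1)) x} (hv : v ≠ 0) :
    0 < ((s : ℤ) : ℝ) * toChart c x (rep (cls x v)) i ↔ 0 < ((s : ℤ) : ℝ) * toChart c x v i := by
  obtain ⟨l, hl, h⟩ := rep_cls x v hv
  have : toChart c x (rep (cls x v)) = l • toChart c x v := by
    rw [← toChart_smul]; exact congrArg _ h
  rw [this, PiLp.smul_apply, smul_eq_mul, mul_left_comm, mul_pos_iff_of_pos_left hl]

/-- The chart of `HM` given by a chart `c` of `M` and an open half space `s * v i > 0`: the
coordinates of `[x, v]` are those of `x` in `c` and the affine coordinates of the ray of `v`. -/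
def chart (c : atlas (Eu (m + 1)) M) (i : Fin (m + 1)) (s : ℤˣ) :
    PartialEquiv (HomBundle m M) (Eu (m + 1) × Eu m) where
  toFun p := (c.1 p.proj, affCoord i s (toChart c p.proj p.rep))
  invFun q := cls (c.1.symm q.1) (ofChart c (c.1.symm q.1) (affVec i s q.2))
  source := {p | p.proj ∈ c.1.source ∧ 0 < ((s : ℤ) : ℝ) * toChart c p.proj p.rep i}
  target := c.1.target ×ˢ univ
  map_source' p hp := ⟨c.1.map_source hp.1, mem_univ _⟩
  map_target' q hq := by
    have hx : c.1.symm q.1 ∈ c.1.source := c.1.map_target hq.1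
    refine ⟨hx, ?_⟩
    have := pos_toChart_rep_cls i s c _ (ofChart_ne_zero c _ hx (affVec_ne_zero i s q.2))
    refine this.2 ?_
    rw [toChart_ofChart_self c _ hx, affVec_same, unitSign_mul_self]
    exact one_pos
  left_inv' p hp := by
    have hx := hp.1
    dsimp only
    rw [c.1.left_inv hx, affVec_affCoord i s _ hp.2, ofChart_smul, ofChart_toChart c _ hx,
      cls_smul _ _ (inv_pos.2 hp.2), cls_rep]
  right_inv' q hq := by
    have hx : c.1.symm q.1 ∈ c.1.source := c.1.map_target hq.1
    have h1 := affCoord_toChart_rep_cls i s c _ (ofChart_ne_zero c _ hx (affVec_ne_zero i s q.2))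
    rw [toChart_ofChart_self c _ hx, affCoord_affVec] at h1
    exact Prod.ext (c.1.right_inv hq.1) h1

/-- The derivative of a change of charts of `M`, at a point of the model space. -/
def transD (c c' : atlas (Eu (m + 1)) M) (a : Eu (m + 1)) : Eu (m + 1) →L[ℝ] Eu (m + 1) :=
  fderiv ℝ (c'.1 ∘ c.1.symm) a

theorem coordChange_eq (c c' : atlas (Eu (m + 1)) M) (x : M) :
    (tangentBundleCore 𝓘(ℝ, Eu (m + 1)) M).coordChange c c' x = transD c c' (c.1 x) := by
  simp [tangentBundleCore_coordChange, transD]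

theorem contDiffOn_trans (c c' : atlas (Eu (m + 1)) M) :
    ContDiffOn ℝ ∞ (c'.1 ∘ c.1.symm) (c.1.symm.trans c'.1).source := by
  have h := 𝓘(ℝ, Eu (m + 1)).contDiffOn_extendCoordChange (n := ∞)
    (IsManifold.subset_maximalAtlas c.2) (IsManifold.subset_maximalAtlas c'.2)
  simpa using h

theorem contDiffOn_transD (c c' : atlas (Eu (m + 1)) M) :
    ContDiffOn ℝ ∞ (transD c c') (c.1.symm.trans c'.1).source :=
  (contDiffOn_trans c c').fderiv_of_isOpen (c.1.symm.trans c'.1).open_source le_rfl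

theorem toChart_ofChart_symm (c c' : atlas (Eu (m + 1)) M) (a : Eu (m + 1))
    (ha : a ∈ (c.1.symm.trans c'.1).source) (w : Eu (m + 1)) :
    toChart c' (c.1.symm a) (ofChart c (c.1.symm a) w) = transD c c' a w := by
  have h : a ∈ c.1.target ∧ c.1.symm a ∈ c'.1.source := by simpa using ha
  rw [toChart_ofChart c c' _ (c.1.map_target h.1) h.2, coordChange_eq, c.1.right_inv h.1]

theorem chart_trans_source (c c' : atlas (Eu (m + 1)) M) (i i' : Fin (m + 1)) (s s' : ℤˣ) :
    ((chart c i s).symm.trans (chart c' i' s')).source =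
      {q | q.1 ∈ (c.1.symm.trans c'.1).source ∧
        0 < ((s' : ℤ) : ℝ) * transD c c' q.1 (affVec i s q.2) i'} := by
  ext q
  have key : ∀ h : q.1 ∈ c.1.target, ∀ h' : c.1.symm q.1 ∈ c'.1.source,
      (0 < ((s' : ℤ) : ℝ) * toChart c' _ (rep (cls (c.1.symm q.1)
        (ofChart c (c.1.symm q.1) (affVec i s q.2)))) i' ↔
      0 < ((s' : ℤ) : ℝ) * transD c c' q.1 (affVec i s q.2) i') := fun h h' => by
    rw [← toChart_ofChart_symm c c' q.1 (by simpa using ⟨h, h'⟩)]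
    exact pos_toChart_rep_cls i' s' c' _
      (ofChart_ne_zero c _ (c.1.map_target h) (affVec_ne_zero i s q.2))
  have h0 : q.1 ∈ (c.1.symm.trans c'.1).source ↔
      q.1 ∈ c.1.target ∧ c.1.symm q.1 ∈ c'.1.source := by simp
  constructor
  · rintro ⟨⟨h, -⟩, h', hp⟩
    exact ⟨h0.2 ⟨h, h'⟩, (key h h').1 hp⟩
  · rintro ⟨hq, hp⟩
    obtain ⟨h, h'⟩ := h0.1 hq
    exact ⟨⟨h, mem_univ _⟩, h', (key h h').2 hp⟩

theorem contDiffOn_chart_trans (c c' : atlas (Eu (m + 1)) M) (i i' : Fin (m + 1)) (s s' : ℤˣ) :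
    ContDiffOn ℝ ∞ ((chart c i s).symm.trans (chart c' i' s'))
      ((chart c i s).symm.trans (chart c' i' s')).source := by
  rw [chart_trans_source]
  have h1 : ContDiffOn ℝ ∞ (fun q : Eu (m + 1) × Eu m => transD c c' q.1 (affVec i s q.2))
      {q | q.1 ∈ (c.1.symm.trans c'.1).source ∧
        0 < ((s' : ℤ) : ℝ) * transD c c' q.1 (affVec i s q.2) i'} :=
    ((contDiffOn_transD c c').comp contDiff_fst.contDiffOn fun q hq => hq.1).clm_apply
      ((contDiff_affVec i s).comp contDiff_snd).contDiffOn
  have h2 := ((contDiffOn_trans c c').comp (contDiff_fst (𝕜 := ℝ) (F := Eu m)).contDiffOn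
    fun q (hq : q ∈ {q : Eu (m + 1) × Eu m | q.1 ∈ (c.1.symm.trans c'.1).source ∧
        0 < ((s' : ℤ) : ℝ) * transD c c' q.1 (affVec i s q.2) i'}) => hq.1)
  refine (h2.prodMk ((contDiffOn_affCoord i' s').comp h1 fun q hq => hq.2)).congr fun q hq => ?_
  have h : q.1 ∈ c.1.target ∧ c.1.symm q.1 ∈ c'.1.source := by simpa using hq.1
  refine Prod.ext rfl ?_
  refine (affCoord_toChart_rep_cls i' s' c' _
    (ofChart_ne_zero c _ (c.1.map_target h.1) (affVec_ne_zero i s q.2))).trans ?_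
  rw [toChart_ofChart_symm c c' q.1 hq.1]
  rfl

theorem isOpen_chart_trans (c c' : atlas (Eu (m + 1)) M) (i i' : Fin (m + 1)) (s s' : ℤˣ) :
    IsOpen ((chart c i s).symm.trans (chart c' i' s')).source := by
  rw [chart_trans_source]
  have ho : IsOpen {q : Eu (m + 1) × Eu m | q.1 ∈ (c.1.symm.trans c'.1).source} :=
    (c.1.symm.trans c'.1).open_source.preimage continuous_fst
  have h1 : ContinuousOn (fun q : Eu (m + 1) × Eu m =>
      ((s' : ℤ) : ℝ) * transD c c' q.1 (affVec i s q.2) i')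
      {q | q.1 ∈ (c.1.symm.trans c'.1).source} := by
    have h2 : ContinuousOn (fun q : Eu (m + 1) × Eu m => transD c c' q.1 (affVec i s q.2))
        {q | q.1 ∈ (c.1.symm.trans c'.1).source} :=
      ((contDiffOn_transD c c').continuousOn.comp continuous_fst.continuousOn
        fun q hq => hq).clm_apply
        ((contDiff_affVec i s).continuous.comp continuous_snd).continuousOn
    have h3 : Continuous fun w : Eu (m + 1) => ((s' : ℤ) : ℝ) * w i' := by fun_prop
    exact h3.comp_continuousOn h2
  exact h1.isOpen_inter_preimage ho isOpen_Ioi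

theorem exists_half_space_rep (p : HomBundle m M) :
    ∃ a : Fin (m + 1) × ℤˣ,
      0 < ((a.2 : ℤ) : ℝ) * toChart (achart _ p.proj) p.proj p.rep a.1 :=
  exists_half_space (toChart_ne_zero _ _ (mem_chart_source _ _) p.rep_ne_zero)

variable (m M) in
/-- The smooth atlas of `HM`. -/
def chartedSpaceCore : ChartedSpaceCore (Eu (m + 1) × Eu m) (HomBundle m M) where
  atlas := {e | ∃ c i s, e = chart c i s}
  chartAt p := chart (achart _ p.proj) p.exists_half_space_rep.choose.1
    p.exists_half_space_rep.choose.2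
  mem_chart_source p := ⟨mem_chart_source _ _, p.exists_half_space_rep.choose_spec⟩
  chart_mem_atlas p := ⟨_, _, _, rfl⟩
  open_source := by
    rintro _ _ ⟨c, i, s, rfl⟩ ⟨c', i', s', rfl⟩
    exact isOpen_chart_trans c c' i i' s s'
  continuousOn_toFun := by
    rintro _ _ ⟨c, i, s, rfl⟩ ⟨c', i', s', rfl⟩
    exact (contDiffOn_chart_trans c c' i i' s s').continuousOn

instance : TopologicalSpace (HomBundle m M) := (chartedSpaceCore m M).toTopologicalSpace

instance : ChartedSpace (Eu (m + 1) × Eu m) (HomBundle m M) := (chartedSpaceCore m M).toChartedSpace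

instance : IsManifold 𝓘(ℝ, Eu (m + 1) × Eu m) ∞ (HomBundle m M) := by
  refine isManifold_of_contDiffOn _ _ _ fun e e' he he' => ?_
  obtain ⟨_, ⟨_, rfl⟩, h⟩ := he
  obtain ⟨⟨c, i, s, rfl⟩, h⟩ := mem_iUnion.1 h
  obtain rfl := mem_singleton_iff.1 h
  obtain ⟨_, ⟨_, rfl⟩, h'⟩ := he'
  obtain ⟨⟨c', i', s', rfl⟩, h'⟩ := mem_iUnion.1 h'
  obtain rfl := mem_singleton_iff.1 h'
  have h := contDiffOn_chart_trans c c' i i' s s'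
  simp only [modelWithCornersSelf_coe, modelWithCornersSelf_coe_symm, Function.id_comp,
    Function.comp_id, preimage_id, range_id, inter_univ]
  exact h

end HomBundle

/-- A form of degree `m` on `HM` is nowhere zero on the vertical bundle `VHM = ker dπ` if at each
point it does not vanish on some `m` vertical vectors. -/
def NowhereZeroOnVertical [IsManifold 𝓘(ℝ, Eu (m + 1)) ∞ M]
    (α : DiffForm (Eu (m + 1) × Eu m) m (HomBundle m M)) : Prop :=
  ∀ p : HomBundle m M, ∃ Y : Fin m → TangentSpace 𝓘(ℝ, Eu (m + 1) × Eu m) p,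
    (∀ j, mfderiv 𝓘(ℝ, Eu (m + 1) × Eu m) 𝓘(ℝ, Eu (m + 1)) HomBundle.proj p (Y j) = 0) ∧
      α p Y ≠ 0

/-- A volume form on a manifold of dimension `m + 1`: a smooth nowhere vanishing form of top
degree. -/
def IsVolumeForm (Ω : DiffForm (Eu (m + 1)) (m + 1) M) : Prop :=
  Ω.IsSmooth ∧ ∀ x, Ω x ≠ 0

end HomBundle

/-! ### Finsler metrics, the Hilbert form, integration over the fibres -/

section Finsler

variable {m : ℕ} {M : Type*} [TopologicalSpace M] [ChartedSpace (Eu (m + 1)) M]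
  [IsManifold 𝓘(ℝ, Eu (m + 1)) ∞ M]

/-- A smooth Finsler metric on a manifold of dimension `m + 1`. Strong convexity is positive
definiteness, at each nonzero `v`, of the Hessian of the square of `F` restricted to the tangent space. -/
structure FinslerMetric (m : ℕ) (M : Type*) [TopologicalSpace M] [ChartedSpace (Eu (m + 1)) M]
    [IsManifold 𝓘(ℝ, Eu (m + 1)) ∞ M] where
  toFun : TangentBundle 𝓘(ℝ, Eu (m + 1)) M → ℝ
  continuous : Continuous toFun
  smooth : ContMDiffOn 𝓘(ℝ, Eu (m + 1)).tangent 𝓘(ℝ, ℝ) ∞ toFun {z | z.2 ≠ 0}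
  homogeneous : ∀ (x : M) (v : TangentSpace 𝓘(ℝ, Eu (m + 1)) x) (l : ℝ), 0 < l →
    toFun ⟨x, l • v⟩ = l * toFun ⟨x, v⟩
  nonneg : ∀ z, 0 ≤ toFun z
  eq_zero_iff : ∀ z, toFun z = 0 ↔ z.2 = 0
  strongly_convex : ∀ (x : M) (v w : Eu (m + 1)), v ≠ 0 → w ≠ 0 →
    0 < iteratedFDeriv ℝ 2 (fun u : Eu (m + 1) => toFun ⟨x, u⟩ ^ 2) v ![w, w]

/-- The Hilbert form `A` on `HM`. It is determined by `r* A = d_v F` for the projection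
`r : TM ∖ 0 → HM`, where `d_v F` sends a vector `ξ` at `(x, v)` to the derivative of `F` at `v` along
`T_x M` in the direction of the image of `ξ` in `T_x M`; hence `A`, at `[x, v]`, sends `η` to that
derivative in the direction `dπ η`. It does not depend on the representative `v`, since the
derivative of `F` along `T_x M` is homogeneous of degree `0`. -/
def FinslerMetric.hilbertForm (F : FinslerMetric m M) :
    DiffForm (Eu (m + 1) × Eu m) 1 (HomBundle m M) := fun p =>
  ContinuousAlternatingMap.ofSubsingleton ℝ (TangentSpace 𝓘(ℝ, Eu (m + 1) × Eu m) p) ℝ (0 : Fin 1)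
    ((fderiv ℝ (fun v : Eu (m + 1) => F.toFun ⟨p.proj, v⟩) p.rep).comp
      (mfderiv 𝓘(ℝ, Eu (m + 1) × Eu m) 𝓘(ℝ, Eu (m + 1)) HomBundle.proj p))

/-- The value at `p` of the `(2 n - 1)`-form `A ∧ (dA) ^ (n - 1)` on `HM`, where `n = m + 1`. -/
def FinslerMetric.contactVolume (F : FinslerMetric m M) (p : HomBundle m M) :
    TangentSpace 𝓘(ℝ, Eu (m + 1) × Eu m) p [⋀^Fin (m + (m + 1))]→ₗ[ℝ] ℝ :=
  (wedge (F.hilbertForm p).toAlternatingMap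
    (wedgePow (F.hilbertForm.d p).toAlternatingMap m)).domDomCongr (finCongr (by ring))

/-- An orientation of a manifold: an orientation of each tangent space, locally constant in the
local trivializations of the tangent bundle. -/
structure ManifoldOrientation (m : ℕ) (M : Type*) [TopologicalSpace M]
    [ChartedSpace (Eu (m + 1)) M] [IsManifold 𝓘(ℝ, Eu (m + 1)) ∞ M] where
  orient : (x : M) → Orientation ℝ (TangentSpace 𝓘(ℝ, Eu (m + 1)) x) (Fin (m + 1))
  locally_constant : ∀ x₀ : M, ∃ o₀ : Orientation ℝ (Eu (m + 1)) (Fin (m + 1)), ∀ᶠ x in 𝓝 x₀,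
    ∀ hx : x ∈ (trivializationAt (Eu (m + 1)) (TangentSpace 𝓘(ℝ, Eu (m + 1)) (M := M)) x₀).baseSet,
      Orientation.map (Fin (m + 1)) ((trivializationAt (Eu (m + 1))
        (TangentSpace 𝓘(ℝ, Eu (m + 1)) (M := M)) x₀).linearEquivAt ℝ x hx) (orient x) = o₀

/-- The surface measure of the Euclidean unit sphere `S ^ m` of `ℝ ^ (m + 1)`. -/
def surfaceMeasure (m : ℕ) : Measure (Metric.sphere (0 : Eu (m + 1)) 1) :=
  (volume : Measure (Eu (m + 1))).toSphere

/-- The Euclidean volume of the unit sphere `S ^ m` of `ℝ ^ (m + 1)`. -/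
def sphereVolume (m : ℕ) : ℝ := (surfaceMeasure m).real univ

/-- The integral over the unit sphere `S ^ m`, oriented as the boundary of the unit ball of
`ℝ ^ (m + 1)` with orientation `o`, of (the restriction to the sphere of) an `m`-form `β`.
For a positive orthonormal basis of the form `(u, e₁, …, eₘ)`, the integrand at `u` is
`β u (e₁, …, eₘ)`, which is the value of `⟪u, ·⟫ ∧ β u` on that basis, hence on any positive
orthonormal basis. For `m = 0`, the two points of the sphere are counted with opposite signs. -/
def sphereIntegral (o : Orientation ℝ (Eu (m + 1)) (Fin (m + 1)))
    (β : Eu (m + 1) → Eu (m + 1) [⋀^Fin m]→L[ℝ] ℝ) : ℝ :=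
  ∫ u : Metric.sphere (0 : Eu (m + 1)) 1,
    wedge (AlternatingMap.ofSubsingleton ℝ (Eu (m + 1)) ℝ (0 : Fin 1)
        (innerSL ℝ (u : Eu (m + 1))).toLinearMap) (β u).toAlternatingMap
      (fun i => o.finOrthonormalBasis (Nat.succ_pos m) (by simp) (Fin.cast (Nat.add_comm 1 m) i))
    ∂(surfaceMeasure m)

/-- The integral over the fibre `H_x M` of an `m`-form on `HM`. The fibre, the sphere of rays of
`T_x M`, is parametrized by the unit sphere of `T_x M = ℝ ^ (m + 1)` through `u ↦ [x, u]`, and has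
the orientation induced by that of `T_x M`. -/
def fibreIntegral (o : ManifoldOrientation m M)
    (α : DiffForm (Eu (m + 1) × Eu m) m (HomBundle m M)) (x : M) : ℝ :=
  sphereIntegral (o.orient x)
    (DiffForm.pullback (W := Eu (m + 1)) (N' := Eu (m + 1)) (fun v => HomBundle.cls x v) α)

end Finsler

end

/-! Put `m = n - 1` and let `f` be the restriction of `F` to `T_x M`. In coordinates `A` has only
components along the base, given by `f'(v)`; hence contracting `dA` with a vertical vector `Y` gives
`f''(v)(Y, ·)`. The form `A ∧ (dA)^m` has top degree, so it is known from its value on one basis.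
Take vertical vectors `Y₁, …, Yₘ` and vectors `X₀, …, Xₘ` along the base dual to the covectors
`f'(v)`, `f''(v)(Yᵢ, ·)`. On such a Darboux family the value is a universal constant `C ≠ 0`
(`exists_wedge_wedgePow_darboux`), whatever the numbers `dA(Xᵢ, Xⱼ)` are, so derivatives of `F`
along the base never enter. The dual vectors exist: by Euler's relations the determinant of these
covectors on a family `X` is `2^{-(m+1)} det Hess(f²) / f^{m+1}` times `det(v, Y) det X`
(`IsMinkowskiNorm.det_contact`), and strong convexity makes the density `det Hess(f²) / f^{m+1}`
positive.

Uniqueness. Since `π^*Ω` kills vertical vectors, the equation only sees the vertical part of `α`. If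
`Ω = g det` at `x`, it forces that part to be `C / (2^{m+1} g)` times the density times the angular
form `w ↦ det(v, w)` (`FinslerMetric.vertical_eq_of_wedge_eq`). The product of density and angular
form does not depend on the length of `v`, and its integral over the fibre is, up to the orientation
sign, the integral `fibreVolume f` of the density over the unit sphere. The normalization then
determines `g`.

Existence. Define `Ω` by the value of `g` just found. A linear change of coordinates `L` multiplies
the fibre volume by `|det L|` (`det L ^ 2` from the Hessian, `|det L|⁻¹` from the sphere integral),
so together with the orientation sign it is the coefficient of an `n`-form. A radial cutoff rewrites
sphere integrals as Lebesgue integrals; this gives both the transformation rule and smoothness in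
`x`. The vertical part of `α` is then prescribed. Each chart of `M` extends it to a form on `HM`, by
pulling back the angular form along the map from rays to unit vectors. A partition of unity glues
these extensions; they agree on vertical vectors, so nothing that matters is changed. -/

noncomputable section

/-! ### Wedge products as full sums over permutations -/

section WedgeLemmas

variable {V : Type*} [AddCommGroup V] [Module ℝ V]

/-- If `b` vanishes as soon as one argument is in the family `Y`, only the identity shuffle
contributes to `(a ∧ b) (Y, X)`. -/
theorem wedge_append {p q : ℕ} (a : V [⋀^Fin p]→ₗ[ℝ] ℝ) (b : V [⋀^Fin q]→ₗ[ℝ] ℝ)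
    (Y : Fin p → V) (X : Fin q → V)
    (h : ∀ (z : Fin q → V) (i : Fin q) (j : Fin p), z i = Y j → b z = 0) :
    wedge a b (Fin.append Y X) = a Y * b X := by
  classical
  simp only [wedge, AlternatingMap.domDomCongr_apply, LinearMap.compAlternatingMap_apply,
    AlternatingMap.domCoprod_apply, sum_apply, map_sum]
  have happ : ∀ x : Fin p ⊕ Fin q, Fin.append Y X (finSumFinEquiv x) = Sum.elim Y X x := by
    rintro (i | j) <;> simp
  refine (Finset.sum_eq_single
    (Quotient.mk'' 1 : Equiv.Perm.ModSumCongr (Fin p) (Fin q)) ?_ ?_).trans ?_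
  rotate_left 2
  · rw [AlternatingMap.domCoprod.summand_mk'']
    simp [MultilinearMap.domCoprod_apply]
  · intro σ _ hσ
    induction σ using Quotient.inductionOn' with
    | h σ =>
    rw [AlternatingMap.domCoprod.summand_mk'']
    -- Either `σ` feeds some `Y j` to `b` and the summand vanishes, or `σ` preserves both blocks and
    -- lies in the trivial coset.
    by_cases hmem : ∃ i j, σ (Sum.inr i) = Sum.inl j
    · obtain ⟨i, j, hij⟩ := hmem
      have hb : b (fun k => Fin.append Y X (finSumFinEquiv (σ (Sum.inr k)))) = 0 :=
        h _ i j (by rw [hij, happ]; rfl)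
      simp only [smul_apply, MultilinearMap.domDomCongr_apply,
        MultilinearMap.domCoprod_apply, AlternatingMap.coe_multilinearMap, Function.comp_def, hb,
        TensorProduct.tmul_zero, smul_zero, map_zero]
    · exfalso
      apply hσ
      push Not at hmem
      have h1 : Set.MapsTo σ (Set.range Sum.inr) (Set.range Sum.inr) := by
        rintro _ ⟨i, rfl⟩
        rcases hx : σ (Sum.inr i) with j | j
        · exact absurd hx (hmem i j)
        · exact ⟨j, rfl⟩
      have h2 : Set.MapsTo σ (Set.range Sum.inl) (Set.range Sum.inl) := by
        have h3 := Equiv.Perm.perm_mapsTo_inl_iff_mapsTo_inr σ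
        exact h3.2 h1
      have h3 : σ ∈ (Equiv.Perm.sumCongrHom (Fin p) (Fin q)).range :=
        Equiv.Perm.mem_sumCongrHom_range_of_perm_mapsTo_inl h2
      refine Quotient.sound' ?_
      rw [QuotientGroup.leftRel_apply, mul_one]
      exact inv_mem h3
  · simp

/-- The tensor product of two real multilinear forms on finite families. -/
def tensorMul {p q : ℕ} (a : MultilinearMap ℝ (fun _ : Fin p => V) ℝ)
    (b : MultilinearMap ℝ (fun _ : Fin q => V) ℝ) :
    MultilinearMap ℝ (fun _ : Fin (p + q) => V) ℝ :=
  ((LinearMap.mul' ℝ ℝ).compMultilinearMap (a.domCoprod b)).domDomCongr finSumFinEquiv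

theorem tensorMul_apply {p q : ℕ} (a : MultilinearMap ℝ (fun _ : Fin p => V) ℝ)
    (b : MultilinearMap ℝ (fun _ : Fin q => V) ℝ) (v : Fin (p + q) → V) :
    tensorMul a b v = a (fun i => v (Fin.castAdd q i)) * b (fun j => v (Fin.natAdd p j)) := by
  simp [tensorMul]

theorem alternatization_domDomCongr {ι ι' : Type*} [Fintype ι] [DecidableEq ι] [Fintype ι']
    [DecidableEq ι'] (e : ι ≃ ι') (f : MultilinearMap ℝ (fun _ : ι => V) ℝ) :
    MultilinearMap.alternatization (f.domDomCongr e) =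
      (MultilinearMap.alternatization f).domDomCongr e := by
  ext v
  simp only [MultilinearMap.alternatization_apply, AlternatingMap.domDomCongr_apply]
  refine Fintype.sum_equiv e.symm.permCongr _ _ fun σ => ?_
  simp only [Equiv.Perm.sign_permCongr, MultilinearMap.domDomCongr_apply]
  congr 2
  ext i
  simp [Equiv.permCongr_apply]

/-- A sum over shuffles of sums over the permutations of each block is a sum over all permutations,
so no factorial appears. This trades shuffles for full permutations, which can be reindexed freely.
-/
theorem wedge_alternatization {p q : ℕ} (a : MultilinearMap ℝ (fun _ : Fin p => V) ℝ)
    (b : MultilinearMap ℝ (fun _ : Fin q => V) ℝ) :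
    wedge (MultilinearMap.alternatization a) (MultilinearMap.alternatization b) =
      MultilinearMap.alternatization (tensorMul a b) := by
  rw [tensorMul, alternatization_domDomCongr, LinearMap.compMultilinearMap_alternatization,
    MultilinearMap.domCoprod_alternization, wedge]

theorem wedge_smul_left {p q : ℕ} (c : ℝ) (a : V [⋀^Fin p]→ₗ[ℝ] ℝ) (b : V [⋀^Fin q]→ₗ[ℝ] ℝ) :
    wedge (c • a) b = c • wedge a b := by
  rw [wedge, ← AlternatingMap.domCoprod'_apply, ← TensorProduct.smul_tmul', map_smul]
  ext v; simp [wedge]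

theorem wedge_smul_right {p q : ℕ} (c : ℝ) (a : V [⋀^Fin p]→ₗ[ℝ] ℝ) (b : V [⋀^Fin q]→ₗ[ℝ] ℝ) :
    wedge a (c • b) = c • wedge a b := by
  rw [wedge, ← AlternatingMap.domCoprod'_apply, TensorProduct.tmul_smul, map_smul]
  ext v; simp [wedge]

/-- The tensor powers of a real multilinear form. -/
def tensorPow {p : ℕ} (b : MultilinearMap ℝ (fun _ : Fin p => V) ℝ) :
    (k : ℕ) → MultilinearMap ℝ (fun _ : Fin (p * k) => V) ℝ
  | 0 => MultilinearMap.constOfIsEmpty (ι := Fin 0) ℝ (fun _ => V) 1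
  | k + 1 => tensorMul (tensorPow b k) b

/-- Alternatizing a form that is already alternating multiplies it by `p!`, once for each factor. -/
theorem alternatization_tensorPow {p : ℕ} (b : V [⋀^Fin p]→ₗ[ℝ] ℝ) (k : ℕ) :
    MultilinearMap.alternatization (tensorPow (b : MultilinearMap ℝ (fun _ : Fin p => V) ℝ) k) =
      ((p.factorial : ℝ) ^ k) • wedgePow b k := by
  induction k with
  | zero =>
    ext v
    simp [tensorPow, wedgePow, MultilinearMap.alternatization_apply]
  | succ k ih =>
    have h : MultilinearMap.alternatization (b : MultilinearMap ℝ (fun _ : Fin p => V) ℝ) =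
        (p.factorial : ℝ) • b := by
      rw [AlternatingMap.coe_alternatization, Fintype.card_fin, Nat.cast_smul_eq_nsmul]
    rw [tensorPow]
    erw [← wedge_alternatization]
    rw [ih, h, wedge_smul_left, wedge_smul_right, smul_smul, pow_succ, wedgePow]

theorem tensorPow_two_apply (b : MultilinearMap ℝ (fun _ : Fin 2 => V) ℝ) (k : ℕ)
    (v : Fin (2 * k) → V) :
    tensorPow b k v = ∏ i : Fin k, b ![v ⟨2 * i, by omega⟩, v ⟨2 * i + 1, by omega⟩] := by
  induction k with
  | zero => simp [tensorPow]
  | succ k ih =>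
    rw [Fin.prod_univ_castSucc, tensorPow]
    erw [tensorMul_apply]
    rw [ih]
    congr 2
    ext j
    fin_cases j <;> rfl

end WedgeLemmas

/-! ### The top power of a contact form on a Darboux basis -/

section Darboux

variable {V : Type*} [AddCommGroup V] [Module ℝ V]

/-- The permutations of the labels of a Darboux basis that fix the distinguished label and map the
conjugate pairs to conjugate pairs. -/
def IsDarbouxPerm {m : ℕ} (τ : Equiv.Perm (Option (Fin m × Bool))) : Prop :=
  τ none = none ∧ ∀ i, ∃ j k, τ (some (i, false)) = some (j, k) ∧ τ (some (i, true)) = some (j, !k)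

/-- Such a permutation is made of flips inside the pairs followed by one permutation of the pairs.
The latter acts on both copies of `Fin m`, so its sign occurs squared, and only the flips
contribute. -/
theorem IsDarbouxPerm.exists_sign {m : ℕ} {τ : Equiv.Perm (Option (Fin m × Bool))}
    (hτ : IsDarbouxPerm τ) : ∃ (j : Fin m → Fin m) (k : Fin m → Bool),
      (∀ i, τ (some (i, false)) = some (j i, k i)) ∧ (∀ i, τ (some (i, true)) = some (j i, !k i)) ∧
      ((Equiv.Perm.sign τ : ℤ) : ℝ) = ∏ i, if k i then -1 else 1 := by
  obtain ⟨h0, h⟩ := hτ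
  choose j k h1 h2 using h
  refine ⟨j, k, h1, h2, ?_⟩
  have hj : Function.Injective j := by
    intro i i' hii
    by_cases hk : k i = k i'
    · have : τ (some (i, false)) = τ (some (i', false)) := by rw [h1, h1, hii, hk]
      simpa using τ.injective this
    · have : τ (some (i, false)) = τ (some (i', true)) := by
        rw [h1, h2, hii]
        cases hki : k i <;> cases hki' : k i' <;> simp_all
      simpa using τ.injective this
  let π : Equiv.Perm (Fin m) := Equiv.ofBijective j (Finite.injective_iff_bijective.1 hj)
  let f : Fin m → Equiv.Perm Bool := fun i => if k i then Equiv.swap false true else 1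
  have hτ : τ = Equiv.optionCongr
      ((Equiv.prodCongrRight f).trans (Equiv.prodCongrLeft fun _ : Bool => π)) := by
    ext1 x
    rcases x with _ | ⟨i, b⟩
    · simp [h0]
    · cases b
      · rw [h1]
        cases hk : k i <;> simp [f, hk, π]
      · rw [h2]
        cases hk : k i <;> simp [f, hk, π]
  rw [hτ, Equiv.optionCongr_sign, Equiv.Perm.sign_trans, Equiv.Perm.sign_prodCongrLeft,
    Equiv.Perm.sign_prodCongrRight]
  have hs : ∀ i, ((Equiv.Perm.sign (f i) : ℤ) : ℝ) = if k i then -1 else 1 := by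
    intro i
    cases hk : k i <;> simp [f, hk]
  simp only [Fintype.prod_bool, Int.units_mul_self, one_mul]
  push_cast
  exact Finset.prod_congr rfl fun i _ => hs i

/-- In a term that does not vanish, every pair consists of conjugate labels: a pair without a label
of the first kind would force another one with two of them. -/
theorem isDarbouxPerm_of_ne_zero {W : Type*} {m : ℕ} (τ : Equiv.Perm (Option (Fin m × Bool)))
    (A : W → ℝ) (B : W → W → ℝ) (u : Option (Fin m × Bool) → W)
    (hA : ∀ x, A (u (some x)) = 0) (hYY : ∀ i j, B (u (some (i, false))) (u (some (j, false))) = 0)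
    (hYX : ∀ i j, i ≠ j → B (u (some (i, false))) (u (some (j, true))) = 0)
    (hXY : ∀ i j, i ≠ j → B (u (some (i, true))) (u (some (j, false))) = 0)
    (h0 : A (u (τ none)) ≠ 0)
    (h : ∀ i, B (u (τ (some (i, false)))) (u (τ (some (i, true)))) ≠ 0) : IsDarbouxPerm τ := by
  have hn : τ none = none := by
    rcases hx : τ none with _ | x
    · rfl
    · rw [hx] at h0
      exact absurd (hA x) h0
  have hs : ∀ x, ∃ y, τ (some x) = some y := by
    intro x
    rcases hx : τ (some x) with _ | y
    · have := τ.injective (hx.trans hn.symm)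
      simp at this
    · exact ⟨y, rfl⟩
  have hs' : ∀ x, ∃ y, τ.symm (some x) = some y := by
    intro x
    rcases hx : τ.symm (some x) with _ | y
    · rw [Equiv.symm_apply_eq, hn] at hx
      simp at hx
    · exact ⟨y, rfl⟩
  -- The slot in which `τ` puts the label `(j, false)`.
  choose pos hpos using fun j : Fin m => hs' (j, false)
  have hpos' : ∀ j, τ (some (pos j)) = some (j, false) := fun j => by rw [← hpos]; simp
  -- Two labels of the first kind in one pair would give a vanishing factor `B (Y, Y)`. Hence the
  -- `m` labels of the first kind lie in distinct pairs and every pair has exactly one of them; this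
  -- also excludes pairs of two labels of the second kind, about which nothing is assumed.
  have hinj : Function.Injective fun j => (pos j).1 := by
    intro j j' hjj
    by_contra hne
    dsimp only at hjj
    have hp := hpos' j
    have hp' := hpos' j'
    have hcase : (pos j).2 = (pos j').2 → False := by
      intro h2
      have : pos j = pos j' := Prod.ext hjj h2
      rw [this, hp'] at hp
      simp at hp
      exact hne hp.symm
    have hv := h (pos j).1
    rcases hb : (pos j).2 with _ | _ <;> rcases hb' : (pos j').2 with _ | _
    · exact hcase (hb.trans hb'.symm)
    · rw [show pos j = ((pos j).1, false) from Prod.ext rfl hb] at hp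
      rw [show pos j' = ((pos j).1, true) from Prod.ext hjj.symm hb'] at hp'
      rw [hp, hp'] at hv
      exact hv (hYY _ _)
    · rw [show pos j = ((pos j).1, true) from Prod.ext rfl hb] at hp
      rw [show pos j' = ((pos j).1, false) from Prod.ext hjj.symm hb'] at hp'
      rw [hp, hp'] at hv
      exact hv (hYY _ _)
    · exact hcase (hb.trans hb'.symm)
  have hsurj := Finite.injective_iff_surjective.1 hinj
  refine ⟨hn, fun i => ?_⟩
  obtain ⟨j, hj⟩ := hsurj i
  dsimp only at hj
  have hp := hpos' j
  have hv := h i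
  rcases hb : (pos j).2 with _ | _
  · rw [show pos j = (i, false) from Prod.ext hj hb] at hp
    obtain ⟨⟨j', k⟩, hy⟩ := hs (i, true)
    rw [hp, hy] at hv
    cases k with
    | false => exact absurd (hYY _ _) hv
    | true =>
      have : j = j' := by_contra fun hne => hv (hYX _ _ hne)
      exact ⟨j, false, hp, by rw [hy, this]; rfl⟩
  · rw [show pos j = (i, true) from Prod.ext hj hb] at hp
    obtain ⟨⟨j', k⟩, hy⟩ := hs (i, false)
    rw [hp, hy] at hv
    cases k with
    | false => exact absurd (hYY _ _) hv
    | true =>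
      have : j' = j := by_contra fun hne => hv (hXY _ _ hne)
      exact ⟨j, true, by rw [hy, this], by rw [hp]; rfl⟩

/-- The argument positions in `A ∧ B ∧ ⋯ ∧ B`. -/
def contactPosition (m : ℕ) : Option (Fin m × Bool) → Fin (1 + 2 * m)
  | none => 0
  | some (i, false) => ⟨1 + 2 * i, by omega⟩
  | some (i, true) => ⟨1 + (2 * i + 1), by omega⟩

/-- The position, in the family `Y₁, …, Yₘ, X₀, …, Xₘ`, of a label of a Darboux basis. -/
def darbouxLabel (m : ℕ) : Option (Fin m × Bool) → Fin (1 + 2 * m)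
  | none => ⟨m, by omega⟩
  | some (i, false) => ⟨i, by omega⟩
  | some (i, true) => ⟨m + (i + 1), by omega⟩

theorem contactPosition_bijective (m : ℕ) : Function.Bijective (contactPosition m) := by
  rw [Fintype.bijective_iff_injective_and_card]
  refine ⟨?_, by simp; ring⟩
  rintro (_ | ⟨i, _ | _⟩) (_ | ⟨j, _ | _⟩) h <;>
    simp [contactPosition, Fin.ext_iff] at h ⊢ <;> omega

theorem darbouxLabel_bijective (m : ℕ) : Function.Bijective (darbouxLabel m) := by
  rw [Fintype.bijective_iff_injective_and_card]
  refine ⟨?_, by simp; ring⟩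
  rintro (_ | ⟨i, _ | _⟩) (_ | ⟨j, _ | _⟩) h <;>
    simp [darbouxLabel, Fin.ext_iff] at h ⊢ <;> omega

/-- The factor `2 ^ m` collects a `2!` from each `B`; the linear form `A` contributes `1! = 1`. -/
theorem wedge_wedgePow_apply {m : ℕ} (A : V [⋀^Fin 1]→ₗ[ℝ] ℝ) (B : V [⋀^Fin 2]→ₗ[ℝ] ℝ)
    (v : Fin (1 + 2 * m) → V) :
    (2 : ℝ) ^ m * wedge A (wedgePow B m) v =
      ∑ σ : Equiv.Perm (Fin (1 + 2 * m)), ((Equiv.Perm.sign σ : ℤ) : ℝ) *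
        (A ![v (σ (contactPosition m none))] *
          ∏ i, B ![v (σ (contactPosition m (some (i, false)))),
            v (σ (contactPosition m (some (i, true))))]) := by
  have h1 := alternatization_tensorPow B m
  have h2 : MultilinearMap.alternatization (A : MultilinearMap ℝ (fun _ : Fin 1 => V) ℝ) = A := by
    rw [AlternatingMap.coe_alternatization]; simp
  have h3 := wedge_alternatization (A : MultilinearMap ℝ (fun _ : Fin 1 => V) ℝ)
    (tensorPow (B : MultilinearMap ℝ (fun _ : Fin 2 => V) ℝ) m)
  rw [h1, h2, wedge_smul_right] at h3
  have h4 := DFunLike.congr_fun h3 v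
  simp only [AlternatingMap.smul_apply, smul_eq_mul, Nat.factorial_two, Nat.cast_ofNat] at h4
  rw [h4, MultilinearMap.alternatization_apply]
  refine Finset.sum_congr rfl fun σ _ => ?_
  rw [Units.smul_def, zsmul_eq_mul, MultilinearMap.domDomCongr_apply, tensorMul_apply,
    tensorPow_two_apply]
  congr 2
  simp only [AlternatingMap.coe_multilinearMap]
  congr 1
  ext i
  fin_cases i
  rfl

/-- The value of `A ∧ B ∧ ⋯ ∧ B` on a Darboux basis is a universal nonzero constant. -/
theorem exists_wedge_wedgePow_darboux (V : Type*) [AddCommGroup V] [Module ℝ V] (m : ℕ) :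
    ∃ C : ℝ, C ≠ 0 ∧ ∀ (A : V [⋀^Fin 1]→ₗ[ℝ] ℝ) (B : V [⋀^Fin 2]→ₗ[ℝ] ℝ)
      (Y : Fin m → V) (X : Fin (m + 1) → V),
      (∀ i, A ![Y i] = 0) → A ![X 0] = 1 → (∀ j : Fin m, A ![X j.succ] = 0) →
      (∀ i j, B ![Y i, Y j] = 0) →
      (∀ i j : Fin m, B ![Y i, X j.succ] = if i = j then 1 else 0) →
      (wedge A (wedgePow B m)) (fun i => Fin.append Y X (Fin.cast (by ring) i)) = C := by
  classical
  let P : Option (Fin m × Bool) ≃ Fin (1 + 2 * m) := Equiv.ofBijective _ (contactPosition_bijective m)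
  let L : Option (Fin m × Bool) ≃ Fin (1 + 2 * m) := Equiv.ofBijective _ (darbouxLabel_bijective m)
  -- The sign of the reordering from the slots of `A ∧ B ∧ ⋯ ∧ B` to the order `Y₁, …, Yₘ, X₀, …,
  -- Xₘ`.
  let ε : ℝ := ((Equiv.Perm.sign (P.symm.trans L) : ℤ) : ℝ)
  -- Each Darboux permutation contributes `1` up to the common sign `ε`. Their number is `2 ^ m *
  -- m!`, but only `N ≠ 0` is needed.
  let N : ℕ := (Finset.univ.filter fun τ : Equiv.Perm (Option (Fin m × Bool)) =>
    IsDarbouxPerm τ).card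
  have hN : N ≠ 0 := by
    refine Finset.card_ne_zero_of_mem (a := 1) ?_
    simp only [Finset.mem_filter, Finset.mem_univ, true_and]
    exact ⟨rfl, fun i => ⟨i, false, rfl, rfl⟩⟩
  have hε : ε ≠ 0 := by simp [ε]
  refine ⟨ε * N / 2 ^ m, by positivity, ?_⟩
  intro A B Y X hAY hA0 hAX hYY hYX
  rw [eq_div_iff (by positivity), mul_comm, wedge_wedgePow_apply]
  set v : Fin (1 + 2 * m) → V := fun i => Fin.append Y X (Fin.cast (by ring) i) with hv
  let u : Option (Fin m × Bool) → V := fun x => v (L x)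
  have hu0 : u none = X 0 := by
    have : (Fin.cast (by ring) (darbouxLabel m none) : Fin (m + (m + 1))) = Fin.natAdd m 0 := by
      ext; simp [darbouxLabel]
    change Fin.append Y X (Fin.cast _ (darbouxLabel m none)) = _
    rw [this, Fin.append_right]
  have huY : ∀ i, u (some (i, false)) = Y i := by
    intro i
    have : (Fin.cast (by ring) (darbouxLabel m (some (i, false))) : Fin (m + (m + 1))) =
        Fin.castAdd (m + 1) i := by
      ext; simp [darbouxLabel]
    change Fin.append Y X (Fin.cast _ (darbouxLabel m (some (i, false)))) = _
    rw [this, Fin.append_left]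
  have huX : ∀ i : Fin m, u (some (i, true)) = X i.succ := by
    intro i
    have : (Fin.cast (by ring) (darbouxLabel m (some (i, true))) : Fin (m + (m + 1))) =
        Fin.natAdd m i.succ := by
      ext; simp [darbouxLabel]
    change Fin.append Y X (Fin.cast _ (darbouxLabel m (some (i, true)))) = _
    rw [this, Fin.append_right]
  have hanti : ∀ a b, B ![a, b] = - B ![b, a] := by
    intro a b
    have := B.map_swap ![b, a] (i := 0) (j := 1) (by simp)
    rw [← this]
    congr 1
    ext i; fin_cases i <;> simp
  -- Each flipped pair gives a `-1` in the sign of `τ` and another one by the antisymmetry of `B`,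
  -- so a Darboux permutation contributes `+1`.
  have hsum : ∀ τ : Equiv.Perm (Option (Fin m × Bool)),
      ((Equiv.Perm.sign τ : ℤ) : ℝ) * (A ![u (τ none)] *
        ∏ i, B ![u (τ (some (i, false))), u (τ (some (i, true)))]) =
      if IsDarbouxPerm τ then 1 else 0 := by
    intro τ
    split_ifs with hτ
    · obtain ⟨j, k, h1, h2, h3⟩ := hτ.exists_sign
      rw [h3, hτ.1, hu0, hA0, one_mul, ← Finset.prod_mul_distrib]
      refine Finset.prod_eq_one fun i _ => ?_
      rw [h1, h2]
      cases k i
      · simp [huY, huX, hYX]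
      · simp only [Bool.not_true, huY, huX]
        rw [hanti]
        simp [hYX]
    · by_contra hne
      refine hτ (isDarbouxPerm_of_ne_zero τ (fun a => A ![a]) (fun a b => B ![a, b]) u
        ?_ ?_ ?_ ?_ ?_ ?_)
      · rintro ⟨i, _ | _⟩
        · simp only [huY, hAY]
        · simp only [huX, hAX]
      · intro i j; simp only [huY, hYY]
      · intro i j hij; simp only [huY, huX, hYX, if_neg hij]
      · intro i j hij
        simp only [huY, huX]
        rw [hanti, hYX, if_neg (Ne.symm hij), neg_zero]
      · exact left_ne_zero_of_mul (right_ne_zero_of_mul hne)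
      · intro i
        exact Finset.prod_ne_zero_iff.1 (right_ne_zero_of_mul (right_ne_zero_of_mul hne)) i
          (Finset.mem_univ i)
  have hcount : (∑ τ : Equiv.Perm (Option (Fin m × Bool)), if IsDarbouxPerm τ then (1 : ℝ) else 0) =
      N := by
    rw [Finset.sum_boole]
  rw [← hcount, Finset.mul_sum]
  -- Substitute `σ = (L ∘ P⁻¹) ∘ (P ∘ τ ∘ P⁻¹)`: the slot of a label `x` then receives the vector
  -- with label `τ x`, and the signs differ by `ε`.
  refine (Fintype.sum_equiv (P.permCongr.trans (Equiv.mulLeft (P.symm.trans L))) _ _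
    fun τ => ?_).symm
  rw [← hsum τ]
  have hσ : ∀ x, (P.permCongr.trans (Equiv.mulLeft (P.symm.trans L))) τ (contactPosition m x) =
      L (τ x) := by
    intro x
    have : contactPosition m x = P x := rfl
    rw [this]
    simp [Equiv.permCongr_apply]
  have hsgn : Equiv.Perm.sign ((P.permCongr.trans (Equiv.mulLeft (P.symm.trans L))) τ) =
      Equiv.Perm.sign (P.symm.trans L) * Equiv.Perm.sign τ := by
    simp [Equiv.Perm.sign_permCongr]
  rw [hsgn]
  simp only [hσ]
  push_cast
  rw [mul_assoc]

end Darboux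

/-! ### Minkowski norms: Euler relations and the fibre density -/

section Minkowski

/-- The determinant of `k` vectors of `ℝᵏ`. -/
def eDet (k : ℕ) : Eu k [⋀^Fin k]→ₗ[ℝ] ℝ := (EuclideanSpace.basisFun (Fin k) ℝ).toBasis.det

theorem eDet_apply {k : ℕ} (v : Fin k → Eu k) :
    eDet k v = Matrix.det (Matrix.of fun i j => v i j) := by
  rw [eDet, Basis.det_apply, ← Matrix.det_transpose]
  congr 1

theorem eDet_map {k : ℕ} (L : Eu k →L[ℝ] Eu k) (v : Fin k → Eu k) :
    eDet k (fun i => L (v i)) = L.det * eDet k v := by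
  have := Basis.det_comp (EuclideanSpace.basisFun (Fin k) ℝ).toBasis L.toLinearMap v
  exact this

theorem eDet_single {k : ℕ} : eDet k (fun i => EuclideanSpace.single i 1) = 1 := by
  have h2 : ⇑(EuclideanSpace.basisFun (Fin k) ℝ).toBasis = fun i => EuclideanSpace.single i 1 := by
    ext i; simp
  rw [← h2]
  exact Basis.det_self (EuclideanSpace.basisFun (Fin k) ℝ).toBasis

/-- Alternating forms of top degree on `ℝᵏ` are multiples of the determinant. -/
theorem eq_smul_eDet {k : ℕ} (f : Eu k [⋀^Fin k]→ₗ[ℝ] ℝ) :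
    f = f (fun i => EuclideanSpace.single i 1) • eDet k := by
  have h := f.eq_smul_basis_det (EuclideanSpace.basisFun (Fin k) ℝ).toBasis
  have h2 : ⇑(EuclideanSpace.basisFun (Fin k) ℝ).toBasis = fun i => EuclideanSpace.single i 1 := by
    ext i; simp
  rwa [h2] at h

/-- The determinant of the matrix of a bilinear form on two families of vectors. -/
theorem det_bilin {k : ℕ} (g : Eu k →L[ℝ] Eu k →L[ℝ] ℝ) (B X : Fin k → Eu k) :
    Matrix.det (Matrix.of fun i j => g (B i) (X j)) =
      eDet k B * Matrix.det (Matrix.of fun i j : Fin k =>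
        g (EuclideanSpace.single i 1) (EuclideanSpace.single j 1)) * eDet k X := by
  rw [eDet_apply B, eDet_apply X, ← Matrix.det_transpose (Matrix.of fun i j => X i j),
    ← Matrix.det_mul, ← Matrix.det_mul]
  congr 1
  ext i j
  have hB : ∀ v : Eu k, v = ∑ a, v a • EuclideanSpace.single a (1 : ℝ) := by
    intro v
    have := (EuclideanSpace.basisFun (Fin k) ℝ).sum_repr v
    simpa using this.symm
  simp only [Matrix.mul_apply, Matrix.of_apply, Matrix.transpose_apply]
  conv_lhs => rw [hB (B i), hB (X j)]
  simp only [map_sum, map_smul, sum_apply, smul_apply,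
    smul_eq_mul, Finset.mul_sum, Finset.sum_mul]
  refine Finset.sum_congr rfl fun a _ => Finset.sum_congr rfl fun b _ => ?_
  ring

variable {m : ℕ}

/-- The restriction of a Finsler metric to a tangent space. -/
structure IsMinkowskiNorm (f : Eu (m + 1) → ℝ) : Prop where
  smooth : ContDiffOn ℝ ∞ f {v | v ≠ 0}
  homogeneous : ∀ (v : Eu (m + 1)) (l : ℝ), 0 < l → f (l • v) = l * f v
  pos : ∀ v, v ≠ 0 → 0 < f v
  strongly_convex : ∀ v w : Eu (m + 1), v ≠ 0 → w ≠ 0 →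
    0 < fderiv ℝ (fderiv ℝ fun u => f u ^ 2) v w w

/-- The determinant of the Hessian of the square of a function. -/
def hessDet (f : Eu (m + 1) → ℝ) (v : Eu (m + 1)) : ℝ :=
  Matrix.det (Matrix.of fun i j : Fin (m + 1) => fderiv ℝ (fderiv ℝ fun u => f u ^ 2) v
    (EuclideanSpace.single i 1) (EuclideanSpace.single j 1))

/-- The density, homogeneous of degree `-(m + 1)`, of the fibre form of a Minkowski norm. -/
def fibreDensity (f : Eu (m + 1) → ℝ) (v : Eu (m + 1)) : ℝ := hessDet f v / f v ^ (m + 1)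

namespace IsMinkowskiNorm

variable {f : Eu (m + 1) → ℝ}

theorem contDiffAt (hf : IsMinkowskiNorm f) {v : Eu (m + 1)} (hv : v ≠ 0) : ContDiffAt ℝ ∞ f v :=
  hf.smooth.contDiffAt (isOpen_ne.mem_nhds hv)

theorem differentiableAt (hf : IsMinkowskiNorm f) {v : Eu (m + 1)} (hv : v ≠ 0) :
    DifferentiableAt ℝ f v := (hf.contDiffAt hv).differentiableAt (by simp)

theorem differentiableAt_fderiv (hf : IsMinkowskiNorm f) {v : Eu (m + 1)} (hv : v ≠ 0) :
    DifferentiableAt ℝ (fderiv ℝ f) v :=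
  ((hf.contDiffAt hv).fderiv_right (m := 1) (by norm_cast)).differentiableAt (by simp)

/-- Euler's relation: differentiate `f (t • v) = t * f v` at `t = 1`. -/
theorem fderiv_self (hf : IsMinkowskiNorm f) {v : Eu (m + 1)} (hv : v ≠ 0) :
    fderiv ℝ f v v = f v := by
  have h1 : HasDerivAt (fun t : ℝ => f (t • v)) (fderiv ℝ f v v) 1 := by
    have h : HasFDerivAt f (fderiv ℝ f v) ((1 : ℝ) • v) := by
      rw [one_smul]; exact (hf.differentiableAt hv).hasFDerivAt
    have h2 : HasDerivAt (fun t : ℝ => t • v) v 1 := by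
      simpa using (hasDerivAt_id (1 : ℝ)).smul_const v
    exact h.comp_hasDerivAt 1 h2
  have h2 : HasDerivAt (fun t : ℝ => t * f v) (f v) 1 := by
    simpa using (hasDerivAt_id (1 : ℝ)).mul_const (f v)
  have h3 : (fun t : ℝ => f (t • v)) =ᶠ[𝓝 1] fun t => t * f v := by
    filter_upwards [lt_mem_nhds (zero_lt_one (α := ℝ))] with t ht
    exact hf.homogeneous v t ht
  exact h1.unique (h2.congr_of_eventuallyEq h3)

theorem fderiv_smul (hf : IsMinkowskiNorm f) (v : Eu (m + 1)) {l : ℝ} (hl : 0 < l) :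
    fderiv ℝ f (l • v) = fderiv ℝ f v := by
  have h : (f <| l • ·) = l • f := funext fun u => hf.homogeneous u l hl
  have h1 := fderiv_comp_smul (f := f) (x := v) (𝕜 := ℝ) l
  rw [h, fderiv_const_smul_field] at h1
  exact (smul_right_injective _ hl.ne' h1).symm

/-- Euler's relation for the derivative, which is homogeneous of degree `0`. The Hessian of `f` is
therefore degenerate in the radial direction, and the covector `f'(v)` has to make up for the
missing rank. -/
theorem fderiv_fderiv_self (hf : IsMinkowskiNorm f) {v : Eu (m + 1)} (hv : v ≠ 0) :
    fderiv ℝ (fderiv ℝ f) v v = 0 := by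
  have h1 : HasDerivAt (fun t : ℝ => fderiv ℝ f (t • v)) (fderiv ℝ (fderiv ℝ f) v v) 1 := by
    have h : HasFDerivAt (fderiv ℝ f) (fderiv ℝ (fderiv ℝ f) v) ((1 : ℝ) • v) := by
      rw [one_smul]; exact (hf.differentiableAt_fderiv hv).hasFDerivAt
    have h2 : HasDerivAt (fun t : ℝ => t • v) v 1 := by
      simpa using (hasDerivAt_id (1 : ℝ)).smul_const v
    exact h.comp_hasDerivAt 1 h2
  have h3 : (fun t : ℝ => fderiv ℝ f (t • v)) =ᶠ[𝓝 1] fun _ => fderiv ℝ f v := by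
    filter_upwards [lt_mem_nhds (zero_lt_one (α := ℝ))] with t ht
    exact hf.fderiv_smul v ht
  exact h1.unique ((hasDerivAt_const _ _).congr_of_eventuallyEq h3)

/-- The product rule. It links strong convexity, a condition on `f ^ 2`, to the derivatives of `f`
that occur in `A` and `dA`. -/
theorem hessian_sq (hf : IsMinkowskiNorm f) {v : Eu (m + 1)} (hv : v ≠ 0) (w w' : Eu (m + 1)) :
    fderiv ℝ (fderiv ℝ fun u => f u ^ 2) v w w' =
      2 * f v * fderiv ℝ (fderiv ℝ f) v w w' + 2 * fderiv ℝ f v w * fderiv ℝ f v w' := by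
  have h1 : (fderiv ℝ fun u => f u ^ 2) =ᶠ[𝓝 v] fun u => (2 * f u) • fderiv ℝ f u := by
    filter_upwards [isOpen_ne.mem_nhds hv] with u hu
    have := ((hf.differentiableAt hu).hasFDerivAt.pow 2).fderiv
    simpa using this
  rw [h1.fderiv_eq]
  have h2 : HasFDerivAt (fun u => 2 * f u) ((2 : ℝ) • fderiv ℝ f v) v :=
    (hf.differentiableAt hv).hasFDerivAt.const_mul 2
  have h3 : HasFDerivAt (fun u => (2 * f u) • fderiv ℝ f u) _ v :=
    h2.smul (hf.differentiableAt_fderiv hv).hasFDerivAt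
  rw [h3.fderiv]
  simp

theorem hessDet_pos (hf : IsMinkowskiNorm f) {v : Eu (m + 1)} (hv : v ≠ 0) : 0 < hessDet f v := by
  refine Matrix.PosDef.det_pos (Matrix.PosDef.of_dotProduct_mulVec_pos ?_ ?_)
  · have hs : IsSymmSndFDerivAt ℝ (fun u => f u ^ 2) v :=
      ((hf.contDiffAt hv).pow 2).isSymmSndFDerivAt (by simp; norm_cast)
    ext i j
    simpa using hs _ _
  · intro x hx
    have hx' : WithLp.toLp 2 x ≠ (0 : Eu (m + 1)) := by
      intro h
      apply hx
      ext i
      simpa using congrArg (fun y : Eu (m + 1) => y i) h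
    have h := hf.strongly_convex v _ hv hx'
    have hB : (WithLp.toLp 2 x : Eu (m + 1)) = ∑ a, x a • EuclideanSpace.single a (1 : ℝ) := by
      have := (EuclideanSpace.basisFun (Fin (m + 1)) ℝ).sum_repr (WithLp.toLp 2 x)
      simpa using this.symm
    rw [hB] at h
    simp only [map_sum, map_smul, sum_apply, smul_apply, smul_eq_mul] at h
    simp only [dotProduct, Matrix.mulVec, Matrix.of_apply, star_trivial]
    refine h.trans_eq ?_
    simp only [Finset.mul_sum]
    rw [Finset.sum_comm]
    refine Finset.sum_congr rfl fun i _ => Finset.sum_congr rfl fun j _ => ?_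
    ring

theorem fibreDensity_pos (hf : IsMinkowskiNorm f) {v : Eu (m + 1)} (hv : v ≠ 0) :
    0 < fibreDensity f v := div_pos (hf.hessDet_pos hv) (pow_pos (hf.pos v hv) _)

/-- The Hessian of `f ^ 2` has degree `0` and the denominator has degree `m + 1`. This degree
compensates that of the angular form, so that their product lives on rays. -/
theorem fibreDensity_smul (hf : IsMinkowskiNorm f) (v : Eu (m + 1)) {l : ℝ}
    (hl : 0 < l) : fibreDensity f (l • v) = (l ^ (m + 1))⁻¹ * fibreDensity f v := by
  have h : (fun u => f (l • u) ^ 2) = (l ^ 2) • fun u => f u ^ 2 :=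
    funext fun u => by simp [hf.homogeneous u l hl, mul_pow]
  have h1 : ∀ u, fderiv ℝ (fun u => f u ^ 2) (l • u) = l • fderiv ℝ (fun u => f u ^ 2) u := by
    intro u
    have h1 := fderiv_comp_smul (f := fun u => f u ^ 2) (x := u) (𝕜 := ℝ) l
    rw [h, fderiv_const_smul_field, pow_two, mul_smul] at h1
    exact (smul_right_injective _ hl.ne' h1).symm
  have h2 : fderiv ℝ (fderiv ℝ fun u => f u ^ 2) (l • v) =
      fderiv ℝ (fderiv ℝ fun u => f u ^ 2) v := by
    have h2 := fderiv_comp_smul (f := fderiv ℝ fun u => f u ^ 2) (x := v) (𝕜 := ℝ) l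
    have h3 : (fderiv ℝ (fun u => f u ^ 2) <| l • ·) = l • fderiv ℝ (fun u => f u ^ 2) := funext h1
    rw [h3, congrFun (fderiv_const_smul_field (𝕜 := ℝ) (f := fderiv ℝ fun u => f u ^ 2) l) v] at h2
    exact (smul_right_injective _ hl.ne' h2).symm
  rw [fibreDensity, fibreDensity, hessDet, h2, hf.homogeneous v l hl, mul_pow, ← hessDet]
  field_simp

theorem hessian_sq_comp (hf : IsMinkowskiNorm f) (L : Eu (m + 1) →L[ℝ] Eu (m + 1))
    {v : Eu (m + 1)} (hv : L v ≠ 0) (w w' : Eu (m + 1)) :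
    fderiv ℝ (fderiv ℝ fun u => f (L u) ^ 2) v w w' =
      fderiv ℝ (fderiv ℝ fun u => f u ^ 2) (L v) (L w) (L w') := by
  have h1 : (fderiv ℝ fun u => f (L u) ^ 2) =ᶠ[𝓝 v]
      fun u => (fderiv ℝ (fun u => f u ^ 2) (L u)).comp L := by
    filter_upwards [(isOpen_ne.preimage L.continuous).mem_nhds hv] with u hu
    have h := ((hf.differentiableAt hu).pow 2).hasFDerivAt
    exact (h.comp u L.hasFDerivAt).fderiv
  have hd : DifferentiableAt ℝ (fderiv ℝ fun u => f u ^ 2) (L v) :=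
    (((hf.contDiffAt hv).pow 2).fderiv_right (m := 1) (by norm_cast)).differentiableAt (by simp)
  have h2 : HasFDerivAt (fun u => (fderiv ℝ (fun u => f u ^ 2) (L u)).comp L) _ v :=
    (hd.hasFDerivAt.comp v L.hasFDerivAt).clm_comp (hasFDerivAt_const L v)
  rw [h1.fderiv_eq, h2.fderiv]
  simp

theorem comp (hf : IsMinkowskiNorm f) (L : Eu (m + 1) →L[ℝ] Eu (m + 1))
    (hL : Function.Injective L) : IsMinkowskiNorm fun v => f (L v) := by
  have hL0 : ∀ v, v ≠ 0 → L v ≠ 0 := fun v hv => (map_ne_zero_iff L hL).2 hv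
  refine ⟨hf.smooth.comp L.contDiff.contDiffOn fun v hv => hL0 v hv, fun v l hl => ?_,
    fun v hv => hf.pos _ (hL0 v hv), fun v w hv hw => ?_⟩
  · rw [map_smul, hf.homogeneous _ _ hl]
  · rw [hf.hessian_sq_comp L (hL0 v hv)]
    exact hf.strongly_convex _ _ (hL0 v hv) (hL0 w hw)

/-- The matrix of the Hessian becomes `Lᵀ H L`, whose determinant acquires the square of that of
`L`. -/
theorem fibreDensity_comp (hf : IsMinkowskiNorm f) (L : Eu (m + 1) →L[ℝ] Eu (m + 1))
    {v : Eu (m + 1)} (hv : L v ≠ 0) :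
    fibreDensity (fun v => f (L v)) v = L.det ^ 2 * fibreDensity f (L v) := by
  have h3 := det_bilin (fderiv ℝ (fderiv ℝ fun u => f u ^ 2) (L v))
    (fun i => L (EuclideanSpace.single i 1)) (fun i => L (EuclideanSpace.single i 1))
  rw [eDet_map, eDet_single, mul_one] at h3
  rw [fibreDensity, fibreDensity, ← mul_div_assoc]
  congr 1
  simp only [hessDet, hf.hessian_sq_comp L hv]
  rw [h3]
  ring

/-- The determinant by which the contact volume of a Minkowski norm is expressed. -/
theorem det_contact (hf : IsMinkowskiNorm f) {v : Eu (m + 1)} (hv : v ≠ 0)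
    (w : Fin m → Eu (m + 1)) (X : Fin (m + 1) → Eu (m + 1)) :
    Matrix.det (Matrix.of fun i j : Fin (m + 1) => Fin.cases (motive := fun _ => ℝ)
      (fderiv ℝ f v (X j)) (fun i => fderiv ℝ (fderiv ℝ f) v (w i) (X j)) i) =
      fibreDensity f v / 2 ^ (m + 1) * eDet _ (Fin.cons v w : Fin (m + 1) → Eu (m + 1)) *
        eDet _ X := by
  have hfv := hf.pos v hv
  have h1 := det_bilin (fderiv ℝ (fderiv ℝ fun u => f u ^ 2) v)
    (Fin.cons v w : Fin (m + 1) → Eu (m + 1)) X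
  rw [← hessDet] at h1
  set R : Matrix (Fin (m + 1)) (Fin (m + 1)) ℝ :=
    Matrix.of fun i j : Fin (m + 1) => Fin.cases (motive := fun _ => ℝ)
      (fderiv ℝ f v (X j)) (fun i => fderiv ℝ (fderiv ℝ f) v (w i) (X j)) i with hR
  -- By Euler's relations the row of `v` is `2 f f'`. The row of `w i` is `2 f f''(w i, ·)` plus
  -- `f'(w i) / f v` times the row of `v`, so it can be cleared without changing the determinant.
  have h2 : Matrix.det (Matrix.of fun i j : Fin (m + 1) => fderiv ℝ (fderiv ℝ fun u => f u ^ 2) v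
      ((Fin.cons v w : Fin (m + 1) → Eu (m + 1)) i) (X j)) = Matrix.det ((2 * f v) • R) := by
    refine Matrix.det_eq_of_forall_row_eq_smul_add_const
      (Fin.cons 0 fun i => fderiv ℝ f v (w i) / f v) 0 rfl fun i j => ?_
    refine Fin.cases ?_ (fun i => ?_) i
    · simp [hf.hessian_sq hv, hf.fderiv_fderiv_self hv, hf.fderiv_self hv, hR]
    · simp [hf.hessian_sq hv, hR]
      field_simp
  rw [h2, Matrix.det_smul, Fintype.card_fin] at h1
  have h3 : (2 * f v) ^ (m + 1) ≠ 0 := by positivity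
  rw [← mul_right_inj' h3, h1, fibreDensity, mul_pow]
  field_simp

end IsMinkowskiNorm

end Minkowski

/-! ### Integrals over the sphere and orientations -/

section SphereIntegrals

variable {m : ℕ}

/-- A smooth cutoff function on the half line, supported in the interval `(1, 3)`. -/
def radialBump : ContDiffBump (2 : ℝ) := ⟨1 / 2, 1, by norm_num, by norm_num⟩

theorem radialBump_eq_zero {r : ℝ} (hr : r ≤ 1 ∨ 3 ≤ r) : radialBump r = 0 := by
  refine radialBump.zero_of_le_dist ?_
  change 1 ≤ dist r 2
  rw [Real.dist_eq, le_abs]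
  rcases hr with h | h
  · right; linarith
  · left; linarith

/-- The integral of the cutoff function for the measure `dr / r`. -/
def radialMass : ℝ := ∫ r in Ioi (0 : ℝ), radialBump r / r

theorem radialMass_pos : 0 < radialMass := by
  -- Replacing `1 / r` by `1 / max r 1` changes nothing where the cutoff is nonzero, and gives a
  -- continuous integrand on the whole line.
  have hc : Continuous fun r : ℝ => radialBump r / max r 1 :=
    radialBump.continuous.div (by fun_prop) fun r => by positivity
  have he : ∀ r : ℝ, radialBump r / r = radialBump r / max r 1 := by
    intro r
    rcases le_total r 1 with h | h
    · rw [radialBump_eq_zero (Or.inl h)]; simp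
    · rw [max_eq_left h]
  have h0 : radialMass = ∫ r : ℝ, radialBump r / max r 1 := by
    rw [radialMass]
    simp only [he]
    refine setIntegral_eq_integral_of_forall_compl_eq_zero fun r hr => ?_
    rw [radialBump_eq_zero (Or.inl ((not_lt.1 hr).trans zero_le_one)), zero_div]
  rw [h0]
  refine hc.integral_pos_of_hasCompactSupport_nonneg_nonzero ?_ ?_ (x := 2) ?_
  · exact radialBump.hasCompactSupport.mul_right
  · intro r
    exact div_nonneg radialBump.nonneg (by positivity)
  · have : radialBump (2 : ℝ) = 1 := radialBump.one_of_mem_closedBall (by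
      simpa using radialBump.rIn_pos.le)
    rw [this]
    positivity

/-- The measure `dr / r` is invariant under dilations. -/
theorem integral_radialBump_mul {N : ℝ} (hN : 0 < N) :
    ∫ r in Ioi (0 : ℝ), radialBump (r * N) / r = radialMass := by
  have h := integral_comp_mul_right_Ioi (fun r : ℝ => radialBump r / r) 0 hN
  rw [zero_mul, smul_eq_mul, ← radialMass] at h
  have h2 : ∀ r : ℝ, radialBump (r * N) / r = N * (radialBump (r * N) / (r * N)) := by
    intro r
    rcases eq_or_ne r 0 with rfl | hr
    · simp
    · field_simp
  simp only [h2]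
  rw [integral_const_mul, h, mul_inv_cancel_left₀ hN.ne']

/-- Integration in polar coordinates. -/
theorem integral_eq_integral_sphere_Ioi {h : Eu (m + 1) → ℝ} (hh : Integrable h) :
    ∫ v, h v = ∫ u : Metric.sphere (0 : Eu (m + 1)) 1,
      (∫ r in Ioi (0 : ℝ), r ^ m * h (r • (u : Eu (m + 1)))) ∂surfaceMeasure m := by
  have hmp := (volume : Measure (Eu (m + 1))).measurePreserving_homeomorphUnitSphereProd
  let g : Metric.sphere (0 : Eu (m + 1)) 1 × Ioi (0 : ℝ) → ℝ := fun q => h (q.2.1 • q.1.1)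
  have hg : ∀ x : ({0}ᶜ : Set (Eu (m + 1))), g (homeomorphUnitSphereProd _ x) = h x := by
    intro x
    have : (homeomorphUnitSphereProd (Eu (m + 1))).symm (homeomorphUnitSphereProd _ x) = x := by
      simp
    have h2 := congrArg Subtype.val this
    rw [homeomorphUnitSphereProd_symm_apply_coe] at h2
    simp only [g, h2]
  have hint : Integrable g ((volume : Measure (Eu (m + 1))).toSphere.prod
      (.volumeIoiPow (finrank ℝ (Eu (m + 1)) - 1))) := by
    rw [← hmp.integrable_comp_emb (Homeomorph.measurableEmbedding _)]
    have : g ∘ homeomorphUnitSphereProd (Eu (m + 1)) = h ∘ Subtype.val := funext hg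
    rw [this, ← integrableOn_iff_comap_subtypeVal (measurableSet_singleton _).compl]
    exact hh.integrableOn
  have h1 : ∫ v, h v = ∫ q, g q ∂((volume : Measure (Eu (m + 1))).toSphere.prod
      (.volumeIoiPow (finrank ℝ (Eu (m + 1)) - 1))) := by
    rw [← hmp.integral_comp (Homeomorph.measurableEmbedding _)]
    simp only [hg]
    rw [integral_subtype_comap (measurableSet_singleton _).compl, restrict_compl_singleton]
  rw [h1, integral_prod _ hint, surfaceMeasure]
  congr 1
  ext u
  have hd : finrank ℝ (Eu (m + 1)) - 1 = m := by simp
  rw [hd]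
  simp only [Measure.volumeIoiPow, ENNReal.ofReal, g]
  rw [integral_withDensity_eq_integral_smul,
    integral_subtype_comap measurableSet_Ioi
      fun a : ℝ => Real.toNNReal (a ^ m) • h (a • (u : Eu (m + 1))),
    setIntegral_congr_fun measurableSet_Ioi fun x hx ↦ ?_]
  · simp only [NNReal.smul_def, Real.coe_toNNReal _ (pow_nonneg (le_of_lt hx) _), smul_eq_mul]
  · exact (measurable_subtype_coe.pow_const _).real_toNNReal

/-- A function on the complement of the origin times a cutoff function. -/
theorem contDiffOn_radialBump_mul {P : Type*} [NormedAddCommGroup P] [NormedSpace ℝ P] {s : Set P}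
    {D : P × Eu (m + 1) → ℝ} (hs : IsOpen s) (hD : ContDiffOn ℝ ∞ D (s ×ˢ {v | v ≠ 0})) :
    ContDiffOn ℝ ∞ (fun q : P × Eu (m + 1) => radialBump ‖q.2‖ * D q) (s ×ˢ univ) := by
  rintro ⟨a, v⟩ ⟨ha, -⟩
  refine ContDiffAt.contDiffWithinAt ?_
  by_cases hv : v = 0
  · have h : (fun q : P × Eu (m + 1) => radialBump ‖q.2‖ * D q) =ᶠ[𝓝 (a, v)] fun _ => 0 := by
      have : ∀ᶠ q : P × Eu (m + 1) in 𝓝 (a, v), ‖q.2‖ < 1 := by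
        refine (continuous_snd.norm.tendsto (a, v)).eventually (gt_mem_nhds ?_)
        simp [hv]
      filter_upwards [this] with q hq
      rw [radialBump_eq_zero (Or.inl hq.le), zero_mul]
    exact contDiffAt_const.congr_of_eventuallyEq h
  · have h1 : ContDiffAt ℝ ∞ (fun q : P × Eu (m + 1) => radialBump ‖q.2‖) (a, v) :=
      radialBump.contDiff.contDiffAt.comp _ ((contDiffAt_norm ℝ hv).comp (a, v) contDiffAt_snd)
    refine h1.mul (hD.contDiffAt ((hs.prod isOpen_ne).mem_nhds ⟨ha, hv⟩))

theorem integrable_radialBump_mul {D : Eu (m + 1) → ℝ} (hD : ContinuousOn D {v | v ≠ 0}) :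
    Integrable fun v => radialBump ‖v‖ * D v := by
  have hc : Continuous fun v => radialBump ‖v‖ * D v := by
    rw [continuous_iff_continuousAt]
    intro v
    by_cases hv : v = 0
    · have h : (fun v => radialBump ‖v‖ * D v) =ᶠ[𝓝 v] fun _ => 0 := by
        have : ∀ᶠ w : Eu (m + 1) in 𝓝 v, ‖w‖ < 1 :=
          (continuous_norm.tendsto v).eventually (gt_mem_nhds (by simp [hv]))
        filter_upwards [this] with w hw
        rw [radialBump_eq_zero (Or.inl hw.le), zero_mul]
      exact continuousAt_const.congr h.symm
    · exact (radialBump.continuous.comp continuous_norm).continuousAt.mul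
        (hD.continuousAt (isOpen_ne.mem_nhds hv))
  refine hc.integrable_of_hasCompactSupport ?_
  refine HasCompactSupport.intro (isCompact_closedBall (0 : Eu (m + 1)) 3) fun v hv => ?_
  rw [mem_closedBall_zero_iff, not_le] at hv
  rw [radialBump_eq_zero (Or.inr hv.le), zero_mul]

/-- In polar coordinates `r ^ m` times the homogeneity factor `r ^ (-(m + 1))` is `1 / r`. The
radial integral is thus `radialMass` whatever the length of `L u`, and sphere integrals are Lebesgue
integrals up to this factor. -/
theorem integral_radialBump_comp {D : Eu (m + 1) → ℝ} (hD : ContinuousOn D {v | v ≠ 0})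
    (hom : ∀ v (l : ℝ), 0 < l → D (l • v) = (l ^ (m + 1))⁻¹ * D v)
    (L : Eu (m + 1) →L[ℝ] Eu (m + 1)) (hL : L.det ≠ 0) :
    ∫ v, radialBump ‖L v‖ * D (L v) =
      radialMass * ∫ u : Metric.sphere (0 : Eu (m + 1)) 1, D (L u) ∂surfaceMeasure m := by
  let e : Eu (m + 1) ≃L[ℝ] Eu (m + 1) := L.toContinuousLinearEquivOfDetNeZero hL
  have he : ∀ v, e v = L v := fun v => rfl
  have hc : ContinuousOn (fun v => D (L v)) {v | v ≠ 0} :=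
    hD.comp L.continuous.continuousOn fun v hv => by
      rw [mem_ofPred_eq, ← he]; exact e.map_ne_zero_iff.2 hv
  have hint : Integrable fun v => radialBump ‖L v‖ * D (L v) := by
    have h := (integrable_radialBump_mul hD).smul_measure
      (ENNReal.ofReal_ne_top (r := |(LinearMap.det (L : Eu (m + 1) →ₗ[ℝ] Eu (m + 1)))⁻¹|))
    rw [← Measure.map_linearMap_addHaar_eq_smul_addHaar volume hL] at h
    exact (e.toHomeomorph.measurableEmbedding.integrable_map_iff).1 h
  rw [integral_eq_integral_sphere_Ioi hint, ← integral_const_mul]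
  congr 1
  ext u
  have hu : (u : Eu (m + 1)) ≠ 0 := ne_zero_of_mem_unit_sphere u
  have hN : 0 < ‖L u‖ := norm_pos_iff.2 (e.map_ne_zero_iff.2 hu)
  rw [← integral_radialBump_mul hN, ← integral_mul_const]
  refine setIntegral_congr_fun measurableSet_Ioi fun r hr => ?_
  have hr0 : 0 < r := hr
  simp only [map_smul, norm_smul, Real.norm_eq_abs, abs_of_pos hr0, hom _ r hr0]
  rw [pow_succ]
  field_simp

/-- The linear change of variables for Lebesgue measure, transported to the sphere; the factor
`radialMass` cancels. -/
theorem integral_sphere_comp {D : Eu (m + 1) → ℝ} (hD : ContinuousOn D {v | v ≠ 0})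
    (hom : ∀ v (l : ℝ), 0 < l → D (l • v) = (l ^ (m + 1))⁻¹ * D v)
    (L : Eu (m + 1) →L[ℝ] Eu (m + 1)) (hL : L.det ≠ 0) :
    ∫ u : Metric.sphere (0 : Eu (m + 1)) 1, D (L u) ∂surfaceMeasure m =
      |L.det|⁻¹ * ∫ u : Metric.sphere (0 : Eu (m + 1)) 1, D u ∂surfaceMeasure m := by
  let e : Eu (m + 1) ≃L[ℝ] Eu (m + 1) := L.toContinuousLinearEquivOfDetNeZero hL
  have h1 := integral_radialBump_comp hD hom L hL
  have h2 := integral_radialBump_comp hD hom (ContinuousLinearMap.id ℝ _)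
    (by simp [ContinuousLinearMap.det])
  simp only [ContinuousLinearMap.id_apply] at h2
  have h3 : ∫ v, radialBump ‖L v‖ * D (L v) = |L.det|⁻¹ * ∫ v, radialBump ‖v‖ * D v := by
    have h4 := e.toHomeomorph.measurableEmbedding.integral_map (μ := volume)
      fun v => radialBump ‖v‖ * D v
    have h5 := Measure.map_linearMap_addHaar_eq_smul_addHaar
      (volume : Measure (Eu (m + 1))) (f := (L : Eu (m + 1) →ₗ[ℝ] Eu (m + 1))) hL
    have h6 : Measure.map e.toHomeomorph (volume : Measure (Eu (m + 1))) =
      ENNReal.ofReal |(LinearMap.det (L : Eu (m + 1) →ₗ[ℝ] Eu (m + 1)))⁻¹| • volume := h5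
    rw [h6, integral_smul_measure, ENNReal.toReal_ofReal (abs_nonneg _), abs_inv, smul_eq_mul] at h4
    exact h4.symm
  rw [h1, h2, mul_left_comm] at h3
  exact mul_left_cancel₀ radialMass_pos.ne' h3

/-- Integrals over the sphere of a function that depends smoothly on a parameter. -/
theorem contDiffOn_integral_sphere {P : Type*} [NormedAddCommGroup P] [NormedSpace ℝ P] {s : Set P}
    {D : P × Eu (m + 1) → ℝ} (hs : IsOpen s) (hD : ContDiffOn ℝ ∞ D (s ×ˢ {v | v ≠ 0}))
    (hom : ∀ a ∈ s, ∀ v (l : ℝ), 0 < l → D (a, l • v) = (l ^ (m + 1))⁻¹ * D (a, v)) :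
    ContDiffOn ℝ ∞ (fun a => ∫ u : Metric.sphere (0 : Eu (m + 1)) 1, D (a, u) ∂surfaceMeasure m)
      s := by
  have h1 := contDiffOn_radialBump_mul hs hD
  have hneg : ContDiffOn ℝ ∞
      (fun q : P × Eu (m + 1) => radialBump ‖-q.2‖ * D (q.1, -q.2)) (s ×ˢ univ) :=
    h1.comp (f := fun q : P × Eu (m + 1) => (q.1, -q.2))
      (contDiff_fst.prodMk contDiff_snd.neg).contDiffOn
      fun q hq => Set.mk_mem_prod (Set.mem_prod.1 hq).1 (mem_univ _)
  -- The Lebesgue integral is the convolution with the constant `1`, evaluated at `0`. The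
  -- reflection `v ↦ -v` undoes the one in the convolution, and smoothness in the parameter follows
  -- from that of convolutions with uniformly compact support.
  have h2 : ContDiffOn ℝ ∞ (fun a => MeasureTheory.convolution (fun _ => (1 : ℝ))
      (fun v => radialBump ‖-v‖ * D (a, -v)) (ContinuousLinearMap.mul ℝ ℝ) volume
        (0 : Eu (m + 1))) s := by
    refine contDiffOn_convolution_right_with_param_comp (n := ⊤)
      (ContinuousLinearMap.mul ℝ ℝ) (g := fun a v => radialBump ‖-v‖ * D (a, -v))
      (v := fun _ : P => (0 : Eu (m + 1)))
      contDiffOn_const hs (isCompact_closedBall (0 : Eu (m + 1)) 3) ?_ (locallyIntegrable_const 1) hneg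
    intro a v _ hv
    rw [mem_closedBall_zero_iff, not_le] at hv
    simp only [norm_neg]
    rw [radialBump_eq_zero (Or.inr hv.le), zero_mul]
  have h3 : ContDiffOn ℝ ∞ (fun a => radialMass⁻¹ * (MeasureTheory.convolution (fun _ => (1 : ℝ))
      (fun v => radialBump ‖-v‖ * D (a, -v)) (ContinuousLinearMap.mul ℝ ℝ) volume
        (0 : Eu (m + 1)))) s := contDiffOn_const.mul h2
  refine h3.congr fun a ha => ?_
  have hc : ContinuousOn (fun v => D (a, v)) {v | v ≠ 0} :=
    hD.continuousOn.comp (by fun_prop) fun v hv => ⟨ha, hv⟩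
  have h4 := integral_radialBump_comp hc (hom a ha) (ContinuousLinearMap.id ℝ _)
    (by simp [ContinuousLinearMap.det])
  simp only [ContinuousLinearMap.id_apply] at h4
  rw [convolution_def]
  simp only [ContinuousLinearMap.mul_apply', one_mul, zero_sub, neg_neg]
  rw [h4, inv_mul_cancel_left₀ radialMass_pos.ne']

theorem integral_sphere_pos {D : Eu (m + 1) → ℝ} (hD : ContinuousOn D {v | v ≠ 0})
    (hpos : ∀ v, v ≠ 0 → 0 < D v) :
    0 < ∫ u : Metric.sphere (0 : Eu (m + 1)) 1, D u ∂surfaceMeasure m := by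
  have hp : ∀ u : Metric.sphere (0 : Eu (m + 1)) 1, 0 < D u :=
    fun u => hpos _ (ne_zero_of_mem_unit_sphere u)
  have hc : Continuous fun u : Metric.sphere (0 : Eu (m + 1)) 1 => D u :=
    hD.comp_continuous continuous_subtype_val fun u => ne_zero_of_mem_unit_sphere u
  have : IsFiniteMeasure (surfaceMeasure m) := by unfold surfaceMeasure; infer_instance
  have hi : Integrable (fun u : Metric.sphere (0 : Eu (m + 1)) 1 => D u) (surfaceMeasure m) :=
    hc.integrable_of_hasCompactSupport (HasCompactSupport.of_compactSpace _)
  rw [integral_pos_iff_support_of_nonneg (fun u => (hp u).le) hi]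
  have : Function.support (fun u : Metric.sphere (0 : Eu (m + 1)) 1 => D u) = univ :=
    eq_univ_of_forall fun u => (hp u).ne'
  rw [this, pos_iff_ne_zero, Measure.measure_univ_ne_zero]
  exact Measure.toSphere_ne_zero _

theorem sphereVolume_pos (m : ℕ) : 0 < sphereVolume m := by
  have h := integral_sphere_pos (m := m) (D := fun _ => 1) continuousOn_const fun _ _ => one_pos
  simpa [sphereVolume] using h

/-- The volume form of `ℝ ^ (m + 1)` with an orientation: the determinant in a positive
orthonormal basis. -/
def orientDet (o : Orientation ℝ (Eu (m + 1)) (Fin (m + 1))) :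
    Eu (m + 1) [⋀^Fin (m + 1)]→ₗ[ℝ] ℝ :=
  (o.finOrthonormalBasis (Nat.succ_pos m) (by simp)).toBasis.det

/-- The sign by which the volume form of an oriented `ℝ ^ (m + 1)` differs from the determinant. -/
def orientSign (o : Orientation ℝ (Eu (m + 1)) (Fin (m + 1))) : ℝ :=
  orientDet o fun i => EuclideanSpace.single i 1

theorem orientDet_eq (o : Orientation ℝ (Eu (m + 1)) (Fin (m + 1))) :
    orientDet o = orientSign o • eDet (m + 1) := eq_smul_eDet _

/-- The change of basis between two orthonormal bases has determinant `1` or `-1`. -/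
theorem orientSign_mul_self (o : Orientation ℝ (Eu (m + 1)) (Fin (m + 1))) :
    orientSign o * orientSign o = 1 := by
  have h2 : ⇑(EuclideanSpace.basisFun (Fin (m + 1)) ℝ) = fun i => EuclideanSpace.single i 1 := by
    ext i; simp
  have h : orientSign o = 1 ∨ orientSign o = -1 := by
    have h1 := OrthonormalBasis.det_to_matrix_orthonormalBasis_real
      (o.finOrthonormalBasis (Nat.succ_pos m) (by simp)) (EuclideanSpace.basisFun (Fin (m + 1)) ℝ)
    rw [h2] at h1
    exact h1
  rcases h with h | h <;> rw [h] <;> norm_num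

/-- If two orientations correspond under a linear map, its determinant has the expected sign. -/
theorem orientSign_map (o o' : Orientation ℝ (Eu (m + 1)) (Fin (m + 1)))
    (e : Eu (m + 1) ≃ₗ[ℝ] Eu (m + 1)) (h : Orientation.map (Fin (m + 1)) e o = o') :
    0 < LinearMap.det (e : Eu (m + 1) →ₗ[ℝ] Eu (m + 1)) * orientSign o * orientSign o' := by
  let b : OrthonormalBasis (Fin (m + 1)) ℝ (Eu (m + 1)) :=
    o.finOrthonormalBasis (Nat.succ_pos m) (by simp)
  let b' : OrthonormalBasis (Fin (m + 1)) ℝ (Eu (m + 1)) :=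
    o'.finOrthonormalBasis (Nat.succ_pos m) (by simp)
  have h1 : b.toBasis.orientation = o := o.finOrthonormalBasis_orientation _ _
  have h2 : b'.toBasis.orientation = o' := o'.finOrthonormalBasis_orientation _ _
  -- The image under `e` of a positive basis for `o` is positive for `o'`; the rest measures both
  -- bases against `eDet`.
  have h3 : (b.toBasis.map e).orientation = b'.toBasis.orientation := by
    rw [h2, ← h, ← h1, Basis.orientation_map]
  have h4 := (Basis.orientation_eq_iff_det_pos _ _).1 h3.symm
  have h5 : b'.toBasis.det = orientSign o' • eDet (m + 1) := orientDet_eq o'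
  have h6 : orientSign o * eDet (m + 1) b = 1 := by
    have h7 := DFunLike.congr_fun (orientDet_eq o) ⇑b
    have h8 : orientDet o b = 1 := by
      have := b.toBasis.det_self
      simpa [orientDet, b] using this
    rw [h8] at h7
    exact h7.symm
  have h7 : eDet (m + 1) (b.toBasis.map e) =
      LinearMap.det (e : Eu (m + 1) →ₗ[ℝ] Eu (m + 1)) * eDet (m + 1) b := by
    rw [← LinearMap.det_toContinuousLinearMap, ← eDet_map]
    congr 1
  have h8 : eDet (m + 1) b = orientSign o := by
    have := orientSign_mul_self o
    calc eDet (m + 1) b = (orientSign o * orientSign o) * eDet (m + 1) b := by rw [this, one_mul]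
      _ = orientSign o := by rw [mul_assoc, h6, mul_one]
  rw [h5, AlternatingMap.smul_apply, h7, h8, smul_eq_mul] at h4
  linarith

/-- The integrand of a sphere integral is the coefficient of the form relative to the volume form
of the sphere. -/
theorem wedge_inner_finOrthonormalBasis (o : Orientation ℝ (Eu (m + 1)) (Fin (m + 1)))
    {u : Eu (m + 1)} (hu : ‖u‖ = 1) (β : Eu (m + 1) [⋀^Fin m]→ₗ[ℝ] ℝ) (κ : ℝ)
    (hβ : ∀ w : Fin m → Eu (m + 1), β w = κ * orientDet o (Fin.cons u w)) :
    wedge (AlternatingMap.ofSubsingleton ℝ (Eu (m + 1)) ℝ (0 : Fin 1)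
      (innerSL ℝ u).toLinearMap) β
        (fun i => o.finOrthonormalBasis (Nat.succ_pos m) (by simp) (Fin.cast (Nat.add_comm 1 m) i))
      = κ := by
  set T := wedge (AlternatingMap.ofSubsingleton ℝ (Eu (m + 1)) ℝ (0 : Fin 1)
      (innerSL ℝ u).toLinearMap) β with hT
  -- In an orthonormal basis starting with `u` the wedge product has a single term, since `β`
  -- vanishes when an argument equals `u`. Its orientation is irrelevant: two top forms that agree
  -- on one basis agree on all, in particular on the given positive one.
  obtain ⟨b, hb⟩ := Orthonormal.exists_orthonormalBasis_extension_of_card_eq (𝕜 := ℝ)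
    (E := Eu (m + 1)) (ι := Fin (m + 1)) (by simp) (v := fun _ => u) (s := {0})
    (by
      rw [orthonormal_iff_ite]
      rintro ⟨i, rfl⟩ ⟨j, rfl⟩
      simp [hu])
  have hb0 : b 0 = u := hb 0 rfl
  have key : T.domDomCongr (finCongr (Nat.add_comm 1 m)) = κ • orientDet o := by
    have h1 : T.domDomCongr (finCongr (Nat.add_comm 1 m)) b = (κ • orientDet o) b := by
      have h2 : (fun i => b (finCongr (Nat.add_comm 1 m) i)) =
          Fin.append (fun _ : Fin 1 => u) fun j => b j.succ := by
        ext1 i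
        refine Fin.addCases (fun i => ?_) (fun i => ?_) i
        · rw [Fin.append_left, ← hb0]
          congr 1
          ext; simp
        · rw [Fin.append_right]
          congr 1
          ext; simp
      have h3 : (Fin.cons u fun j => b j.succ : Fin (m + 1) → Eu (m + 1)) = b := by
        rw [← hb0]
        exact Fin.cons_self_tail _
      rw [AlternatingMap.domDomCongr_apply]
      change T (fun i => b (finCongr (Nat.add_comm 1 m) i)) = _
      rw [h2, hT, wedge_append, hβ, h3]
      · simp [hu]
      · intro z i _ hz
        rw [hβ]
        have : orientDet o (Fin.cons u z) = 0 :=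
          (orientDet o).map_eq_zero_of_eq (i := 0) (j := i.succ) _ (by simp [hz])
            (Fin.succ_ne_zero i).symm
        rw [this, mul_zero]
    rw [AlternatingMap.eq_smul_basis_det b.toBasis (T.domDomCongr _),
      AlternatingMap.eq_smul_basis_det b.toBasis (κ • orientDet o)]
    congr 1
  let b' : OrthonormalBasis (Fin (m + 1)) ℝ (Eu (m + 1)) :=
    o.finOrthonormalBasis (Nat.succ_pos m) (by simp)
  have h4 := DFunLike.congr_fun key ⇑b'
  have h5 : orientDet o b' = 1 := by
    have := b'.toBasis.det_self
    simpa [orientDet, b'] using this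
  rw [AlternatingMap.smul_apply, h5, smul_eq_mul, mul_one] at h4
  exact h4

end SphereIntegrals

/-! ### Smoothness of maps into spaces of forms -/

section SmoothForms

/-- A form is determined by its values on basis vectors, and an injective linear map has a linear
left inverse, continuous in finite dimension. Smoothness of form-valued maps thus reduces to that of
scalar functions. -/
theorem exists_leftInverse_evaluation (V : Type*) [NormedAddCommGroup V] [NormedSpace ℝ V]
    [FiniteDimensional ℝ V] (k : ℕ) :
    ∃ (d : ℕ) (b : Fin d → V) (Φ : ((Fin k → Fin d) → ℝ) →L[ℝ] V [⋀^Fin k]→L[ℝ] ℝ),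
      ∀ θ : V [⋀^Fin k]→L[ℝ] ℝ, Φ (fun s => θ fun i => b (s i)) = θ := by
  let b := finBasis ℝ V
  let ev : (V [⋀^Fin k]→L[ℝ] ℝ) →ₗ[ℝ] ((Fin k → Fin (finrank ℝ V)) → ℝ) :=
    { toFun := fun θ s => θ fun i => b (s i)
      map_add' := fun _ _ => rfl
      map_smul' := fun _ _ => rfl }
  have hinj : LinearMap.ker ev = ⊥ := by
    rw [LinearMap.ker_eq_bot]
    intro θ θ' h
    apply ContinuousAlternatingMap.toAlternatingMap_injective
    apply AlternatingMap.coe_multilinearMap_injective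
    refine Basis.ext_multilinear (fun _ => b) fun s => ?_
    exact congrFun h s
  obtain ⟨g, hg⟩ := ev.exists_leftInverse_of_injective hinj
  exact ⟨_, b, LinearMap.toContinuousLinearMap g, fun θ => DFunLike.congr_fun hg θ⟩

/-- A map to a space of alternating forms is smooth if its evaluations are. -/
theorem contDiffAt_of_forall_apply {V P : Type*} [NormedAddCommGroup V] [NormedSpace ℝ V]
    [FiniteDimensional ℝ V] [NormedAddCommGroup P] [NormedSpace ℝ P] {k : ℕ} {n : WithTop ℕ∞}
    {g : P → V [⋀^Fin k]→L[ℝ] ℝ} {p : P} (h : ∀ v, ContDiffAt ℝ n (fun q => g q v) p) :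
    ContDiffAt ℝ n g p := by
  obtain ⟨d, b, Φ, hΦ⟩ := exists_leftInverse_evaluation V k
  have h1 : g = fun q => Φ fun s => g q fun i => b (s i) := funext fun q => (hΦ (g q)).symm
  rw [h1]
  exact Φ.contDiff.contDiffAt.comp p (contDiffAt_pi.2 fun s => h _)

/-- The determinant as a continuous alternating form. -/
def eDetL (k : ℕ) : Eu k [⋀^Fin k]→L[ℝ] ℝ :=
  { eDet k with
    cont := by
      change Continuous fun v : Fin k → Eu k => eDet k v
      simp only [eDet_apply]
      refine Continuous.matrix_det ?_
      refine continuous_matrix fun i j => ?_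
      simp only [Matrix.of_apply]
      fun_prop }

theorem contDiff_eDet {k : ℕ} : ContDiff ℝ ∞ fun v : Fin k → Eu k => eDet k v :=
  (eDetL k).toContinuousMultilinearMap.contDiff

variable {m : ℕ}

/-- The angular form: the determinant with a fixed first argument. -/
def angularForm (v : Eu (m + 1)) : Eu (m + 1) [⋀^Fin m]→L[ℝ] ℝ :=
  { toFun := fun w => eDetL (m + 1) (Fin.cons v w)
    map_update_add' := by
      intro inst w i x y
      obtain rfl : inst = instDecidableEqFin m := Subsingleton.elim _ _
      have h := (eDetL (m + 1)).map_update_add (Fin.cons v w) i.succ x y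
      simpa only [← Fin.cons_update] using h
    map_update_smul' := by
      intro inst w i c x
      obtain rfl : inst = instDecidableEqFin m := Subsingleton.elim _ _
      have h := (eDetL (m + 1)).map_update_smul (Fin.cons v w) i.succ c x
      simpa only [← Fin.cons_update] using h
    map_eq_zero_of_eq' := fun w i j h hij =>
      (eDetL (m + 1)).map_eq_zero_of_eq (i := i.succ) (j := j.succ) _ (by simpa using h)
        (by simpa using hij)
    cont := (eDetL (m + 1)).coe_continuous.comp (by fun_prop) }

/-- The partial derivative is the total derivative restricted to the second factor; it is therefore
smooth jointly in the base point and the vector. -/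
theorem contDiffOn_partial_fderiv {P W G : Type*} [NormedAddCommGroup P] [NormedSpace ℝ P]
    [NormedAddCommGroup W] [NormedSpace ℝ W] [NormedAddCommGroup G] [NormedSpace ℝ G]
    {U : Set (P × W)} (hU : IsOpen U) {h : P × W → G} (hh : ContDiffOn ℝ ∞ h U) :
    ContDiffOn ℝ ∞ (fun q => fderiv ℝ (fun u => h (q.1, u)) q.2) U := by
  have h1 : ContDiffOn ℝ ∞ (fun q => (fderiv ℝ h q).comp (ContinuousLinearMap.inr ℝ P W)) U :=
    (hh.fderiv_of_isOpen hU le_rfl).clm_comp contDiffOn_const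
  refine h1.congr fun q hq => ?_
  have h2 : HasFDerivAt h (fderiv ℝ h q) (q.1, q.2) :=
    ((hh.contDiffAt (hU.mem_nhds hq)).differentiableAt (by simp)).hasFDerivAt
  have h3 : HasFDerivAt (fun u : W => (q.1, u)) (ContinuousLinearMap.inr ℝ P W) q.2 :=
    hasFDerivAt_prodMk_right q.1 q.2
  exact (h2.comp q.2 h3).fderiv

theorem contDiffOn_fibreDensity {P : Type*} [NormedAddCommGroup P] [NormedSpace ℝ P] {s : Set P}
    (hs : IsOpen s) {h : P × Eu (m + 1) → ℝ} (hh : ContDiffOn ℝ ∞ h (s ×ˢ {v | v ≠ 0}))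
    (hpos : ∀ a ∈ s, ∀ v, v ≠ 0 → h (a, v) ≠ 0) :
    ContDiffOn ℝ ∞ (fun q : P × Eu (m + 1) => fibreDensity (fun u => h (q.1, u)) q.2)
      (s ×ˢ {v | v ≠ 0}) := by
  have hU : IsOpen (s ×ˢ {v : Eu (m + 1) | v ≠ 0}) := hs.prod isOpen_ne
  have h1 := contDiffOn_partial_fderiv hU (contDiffOn_partial_fderiv hU (hh.pow 2))
  have h2 : ContDiffOn ℝ ∞ (fun q : P × Eu (m + 1) => hessDet (fun u => h (q.1, u)) q.2)
      (s ×ˢ {v | v ≠ 0}) := by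
    simp only [hessDet, Matrix.det_apply]
    refine ContDiffOn.sum fun σ _ => ContDiffOn.const_smul _ (contDiffOn_prod fun i _ => ?_)
    exact (h1.clm_apply contDiffOn_const).clm_apply contDiffOn_const
  exact h2.div (hh.pow _) fun q hq =>
    pow_ne_zero _ (hpos _ (Set.mem_prod.1 hq).1 _ (Set.mem_prod.1 hq).2)

end SmoothForms

/-! ### The metric, the fibre volume and the orientation in charts of the base -/

section BaseManifold

variable {m : ℕ} {M : Type*} [TopologicalSpace M] [ChartedSpace (Eu (m + 1)) M]
  [IsManifold 𝓘(ℝ, Eu (m + 1)) ∞ M]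

/-- The passage from the coordinates of the chart at `x₀` to those of the chart at `x`, for tangent
vectors at `x`. -/
def ofChartL (x₀ x : M) : Eu (m + 1) →L[ℝ] Eu (m + 1) :=
  (tangentBundleCore 𝓘(ℝ, Eu (m + 1)) M).coordChange (achart _ x₀) (achart _ x) x

/-- The passage from the coordinates of the chart at `x` to those of the chart at `x₀`, for tangent
vectors at `x`. -/
def toChartL (x₀ x : M) : Eu (m + 1) →L[ℝ] Eu (m + 1) :=
  (tangentBundleCore 𝓘(ℝ, Eu (m + 1)) M).coordChange (achart _ x) (achart _ x₀) x

theorem toChartL_ofChartL {x₀ x : M} (hx : x ∈ (chartAt (Eu (m + 1)) x₀).source) (v : Eu (m + 1)) :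
    toChartL x₀ x (ofChartL x₀ x v) = v :=
  HomBundle.toChart_ofChart_self (achart _ x₀) x hx v

theorem ofChartL_toChartL {x₀ x : M} (hx : x ∈ (chartAt (Eu (m + 1)) x₀).source) (v : Eu (m + 1)) :
    ofChartL x₀ x (toChartL x₀ x v) = v :=
  HomBundle.ofChart_toChart (achart _ x₀) x hx v

theorem ofChartL_self (x : M) : ofChartL x x = ContinuousLinearMap.id ℝ (Eu (m + 1)) := by
  ext1 v
  exact (tangentBundleCore 𝓘(ℝ, Eu (m + 1)) M).coordChange_self _ x (mem_chart_source _ x) v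

theorem det_toChartL_mul_det_ofChartL {x₀ x : M} (hx : x ∈ (chartAt (Eu (m + 1)) x₀).source) :
    (toChartL (m := m) x₀ x).det * (ofChartL (m := m) x₀ x).det = 1 := by
  have h : (toChartL (m := m) x₀ x : Eu (m + 1) →ₗ[ℝ] Eu (m + 1)) ∘ₗ
      (ofChartL (m := m) x₀ x : Eu (m + 1) →ₗ[ℝ] Eu (m + 1)) = LinearMap.id :=
    LinearMap.ext fun v => toChartL_ofChartL hx v
  rw [ContinuousLinearMap.det, ContinuousLinearMap.det, ← LinearMap.det_comp, h, LinearMap.det_id]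

theorem det_ofChartL_ne_zero {x₀ x : M} (hx : x ∈ (chartAt (Eu (m + 1)) x₀).source) :
    (ofChartL (m := m) x₀ x).det ≠ 0 := right_ne_zero_of_mul (by
      rw [det_toChartL_mul_det_ofChartL hx]; exact one_ne_zero)

theorem ofChartL_injective {x₀ x : M} (hx : x ∈ (chartAt (Eu (m + 1)) x₀).source) :
    Function.Injective (ofChartL (m := m) x₀ x) :=
  Function.LeftInverse.injective (toChartL_ofChartL hx)

theorem toChartL_injective {x₀ x : M} (hx : x ∈ (chartAt (Eu (m + 1)) x₀).source) :
    Function.Injective (toChartL (m := m) x₀ x) :=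
  Function.LeftInverse.injective (ofChartL_toChartL hx)

/-- The tangent space at a point is the model space read in the preferred chart there, so this
derivative is that of a transition map. -/
theorem mfderiv_chartAt_symm (x₀ : M) {a : Eu (m + 1)} (ha : a ∈ (chartAt (Eu (m + 1)) x₀).target) :
    mfderiv 𝓘(ℝ, Eu (m + 1)) 𝓘(ℝ, Eu (m + 1)) (chartAt (Eu (m + 1)) x₀).symm a =
      ofChartL x₀ ((chartAt (Eu (m + 1)) x₀).symm a) := by
  have h := mdifferentiableAt_atlas_symm (I := 𝓘(ℝ, Eu (m + 1))) (chart_mem_atlas _ x₀) ha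
  have h2 := HomBundle.coordChange_eq (m := m) (achart (Eu (m + 1)) x₀)
    (achart (Eu (m + 1)) ((chartAt (Eu (m + 1)) x₀).symm a)) ((chartAt (Eu (m + 1)) x₀).symm a)
  rw [ofChartL, h2, h.mfderiv]
  have h3 : (achart (Eu (m + 1)) x₀).1 ((chartAt (Eu (m + 1)) x₀).symm a) = a :=
    (chartAt (Eu (m + 1)) x₀).right_inv ha
  rw [h3, HomBundle.transD]
  simp [writtenInExtChartAt]
  rfl

/-- This is the inverse of the trivialization of `TM` over the chart at `x₀`; it carries the
smoothness of `F` to coordinates. -/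
theorem contMDiffOn_tangent_symm (x₀ : M) :
    ContMDiffOn 𝓘(ℝ, Eu (m + 1) × Eu (m + 1)) 𝓘(ℝ, Eu (m + 1)).tangent ∞
      (fun q : Eu (m + 1) × Eu (m + 1) => (⟨(chartAt (Eu (m + 1)) x₀).symm q.1,
        ofChartL x₀ ((chartAt (Eu (m + 1)) x₀).symm q.1) q.2⟩ :
          TangentBundle 𝓘(ℝ, Eu (m + 1)) M)) ((chartAt (Eu (m + 1)) x₀).target ×ˢ univ) := by
  have h1 := (trivializationAt (Eu (m + 1))
    (TangentSpace 𝓘(ℝ, Eu (m + 1)) (M := M)) x₀).contMDiffOn_symm (IB := 𝓘(ℝ, Eu (m + 1))) (n := ∞)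
  have h2 : ContMDiffOn 𝓘(ℝ, Eu (m + 1) × Eu (m + 1)) (𝓘(ℝ, Eu (m + 1)).prod 𝓘(ℝ, Eu (m + 1))) ∞
      (fun q : Eu (m + 1) × Eu (m + 1) => ((chartAt (Eu (m + 1)) x₀).symm q.1, q.2))
      ((chartAt (Eu (m + 1)) x₀).target ×ˢ univ) := by
    refine ContMDiffOn.prodMk ?_ contDiff_snd.contMDiff.contMDiffOn
    exact (contMDiffOn_chart_symm (I := 𝓘(ℝ, Eu (m + 1))) (x := x₀)).comp
      contDiff_fst.contMDiff.contMDiffOn fun q hq => hq.1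
  refine h1.comp h2 fun q hq => ?_
  rw [TangentBundle.trivializationAt_target]
  exact ⟨(chartAt (Eu (m + 1)) x₀).map_target hq.1, mem_univ _⟩

namespace FinslerMetric

variable (F : FinslerMetric m M)

/-- The restriction of a Finsler metric to the tangent space at `x`. -/
def fibre (x : M) : Eu (m + 1) → ℝ := fun v => F.toFun ⟨x, v⟩

/-- The expression of a Finsler metric in the chart at `x₀`. -/
def inChart (x₀ : M) : Eu (m + 1) × Eu (m + 1) → ℝ := fun q =>
  F.fibre ((chartAt (Eu (m + 1)) x₀).symm q.1)
    (ofChartL x₀ ((chartAt (Eu (m + 1)) x₀).symm q.1) q.2)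

theorem contDiffOn_inChart (x₀ : M) :
    ContDiffOn ℝ ∞ (F.inChart x₀) ((chartAt (Eu (m + 1)) x₀).target ×ˢ {v | v ≠ 0}) := by
  rw [← contMDiffOn_iff_contDiffOn]
  refine F.smooth.comp ((contMDiffOn_tangent_symm x₀).mono (prod_mono le_rfl (subset_univ _)))
    fun q hq => ?_
  exact (map_ne_zero_iff _ (ofChartL_injective ((chartAt (Eu (m + 1)) x₀).map_target hq.1))).2 hq.2

theorem inChart_eq (x₀ : M) (a : Eu (m + 1)) : (fun v => F.inChart x₀ (a, v)) =
    fun v => F.fibre ((chartAt (Eu (m + 1)) x₀).symm a)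
      (ofChartL x₀ ((chartAt (Eu (m + 1)) x₀).symm a) v) := rfl

theorem inChart_self (x : M) :
    (fun v => F.inChart x (chartAt (Eu (m + 1)) x x, v)) = F.fibre x := by
  rw [inChart_eq, (chartAt (Eu (m + 1)) x).left_inv (mem_chart_source _ x), ofChartL_self]
  rfl

theorem isMinkowskiNorm_fibre (x : M) : IsMinkowskiNorm (F.fibre x) := by
  refine ⟨?_, fun v l hl => F.homogeneous x v l hl, fun v hv => ?_, fun v w hv hw => ?_⟩
  · rw [← inChart_self]
    exact (F.contDiffOn_inChart x).comp (contDiff_prodMk_right _).contDiffOn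
      fun v hv => ⟨mem_chart_target _ x, hv⟩
  · refine lt_of_le_of_ne (F.nonneg _) fun h => hv ?_
    exact (F.eq_zero_iff ⟨x, v⟩).1 h.symm
  · have h := F.strongly_convex x v w hv hw
    rw [iteratedFDeriv_two_apply] at h
    exact h

theorem isMinkowskiNorm_inChart (x₀ : M) {a : Eu (m + 1)}
    (ha : a ∈ (chartAt (Eu (m + 1)) x₀).target) :
    IsMinkowskiNorm fun v => F.inChart x₀ (a, v) :=
  (F.isMinkowskiNorm_fibre ((chartAt (Eu (m + 1)) x₀).symm a)).comp _
    (ofChartL_injective ((chartAt (Eu (m + 1)) x₀).map_target ha))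

end FinslerMetric

theorem IsMinkowskiNorm.continuousOn_fibreDensity {f : Eu (m + 1) → ℝ} (hf : IsMinkowskiNorm f) :
    ContinuousOn (fibreDensity f) {v | v ≠ 0} := by
  -- The smooth dependence on parameters is used here with a dummy real parameter.
  have h := contDiffOn_fibreDensity (m := m) (P := ℝ) isOpen_univ (h := fun q => f q.2)
    (hf.smooth.comp contDiff_snd.contDiffOn fun q hq => hq.2) fun a _ v hv => (hf.pos v hv).ne'
  have h2 := h.continuousOn.comp (f := fun v : Eu (m + 1) => ((0 : ℝ), v))
    (s := {v | v ≠ 0}) (by fun_prop) fun v hv => ⟨mem_univ _, hv⟩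
  exact h2

/-- The integral over the unit sphere of the density of a Minkowski norm. -/
def fibreVolume (f : Eu (m + 1) → ℝ) : ℝ :=
  ∫ u : Metric.sphere (0 : Eu (m + 1)) 1, fibreDensity f u ∂surfaceMeasure m

theorem IsMinkowskiNorm.fibreVolume_pos {f : Eu (m + 1) → ℝ} (hf : IsMinkowskiNorm f) :
    0 < fibreVolume f :=
  integral_sphere_pos hf.continuousOn_fibreDensity fun _ hv => hf.fibreDensity_pos hv

/-- The square of the determinant from the Hessian, against the inverse of its absolute value from
the sphere integral: the fibre volume transforms as a density. -/
theorem IsMinkowskiNorm.fibreVolume_comp {f : Eu (m + 1) → ℝ} (hf : IsMinkowskiNorm f)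
    (L : Eu (m + 1) →L[ℝ] Eu (m + 1)) (hL : Function.Injective L) (hdet : L.det ≠ 0) :
    fibreVolume (fun v => f (L v)) = |L.det| * fibreVolume f := by
  have h : fibreVolume (fun v => f (L v)) = ∫ u : Metric.sphere (0 : Eu (m + 1)) 1,
      L.det ^ 2 * fibreDensity f (L u) ∂surfaceMeasure m := by
    refine integral_congr_ae (Eventually.of_forall fun u => ?_)
    exact hf.fibreDensity_comp L ((map_ne_zero_iff L hL).2 (ne_zero_of_mem_unit_sphere u))
  rw [h, integral_const_mul, integral_sphere_comp hf.continuousOn_fibreDensity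
    (fun v l hl => hf.fibreDensity_smul v hl) L hdet, ← fibreVolume, ← mul_assoc, ← sq_abs, sq,
    mul_assoc |L.det|, mul_inv_cancel₀ (abs_ne_zero.2 hdet), mul_one]

theorem FinslerMetric.contDiffOn_fibreDensity_inChart (F : FinslerMetric m M) (x₀ : M) :
    ContDiffOn ℝ ∞ (fun q : Eu (m + 1) × Eu (m + 1) =>
      fibreDensity (fun v => F.inChart x₀ (q.1, v)) q.2)
      ((chartAt (Eu (m + 1)) x₀).target ×ˢ {v | v ≠ 0}) :=
  contDiffOn_fibreDensity (chartAt (Eu (m + 1)) x₀).open_target (F.contDiffOn_inChart x₀)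
    fun _ ha v hv => ((F.isMinkowskiNorm_inChart x₀ ha).pos v hv).ne'

theorem FinslerMetric.contDiffOn_fibreVolume_inChart (F : FinslerMetric m M) (x₀ : M) :
    ContDiffOn ℝ ∞ (fun a => fibreVolume fun v => F.inChart x₀ (a, v))
      (chartAt (Eu (m + 1)) x₀).target :=
  contDiffOn_integral_sphere (chartAt (Eu (m + 1)) x₀).open_target
    (F.contDiffOn_fibreDensity_inChart x₀)
    fun _ ha v _ hl => (F.isMinkowskiNorm_inChart x₀ ha).fibreDensity_smul v hl

/-- The sign of the coordinates of the chart at `x₀` relative to the orientation at `x`. -/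
def ManifoldOrientation.chartSign (o : ManifoldOrientation m M) (x₀ x : M) : ℝ :=
  Real.sign (orientSign (o.orient x) * (ofChartL (m := m) x₀ x).det)

theorem ManifoldOrientation.chartSign_mul_abs (o : ManifoldOrientation m M) (x₀ x : M) :
    o.chartSign x₀ x * |(ofChartL (m := m) x₀ x).det| =
      orientSign (o.orient x) * (ofChartL (m := m) x₀ x).det := by
  have h := orientSign_mul_self (o.orient x)
  have h2 : |orientSign (o.orient x)| = 1 := by
    rcases mul_self_eq_one_iff.1 h with h | h <;> simp [h]
  have h3 : |(ofChartL (m := m) x₀ x).det| =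
      |orientSign (o.orient x) * (ofChartL (m := m) x₀ x).det| := by rw [abs_mul, h2, one_mul]
  rw [ManifoldOrientation.chartSign, h3]
  rcases lt_trichotomy (orientSign (o.orient x) * (ofChartL (m := m) x₀ x).det) 0 with h | h | h
  · rw [Real.sign_of_neg h, abs_of_neg h]; ring
  · rw [h]; simp
  · rw [Real.sign_of_pos h, abs_of_pos h, one_mul]

/-- The preferred chart at `x` may jump with `x`, so neither `orientSign` nor the determinant in
`chartSign` need be locally constant by itself. Their product is compared with the fixed chart at
`x₁`, in which the orientation is constant. -/
theorem ManifoldOrientation.eventually_chartSign_eq (o : ManifoldOrientation m M) {x₀ x₁ : M}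
    (hx : x₁ ∈ (chartAt (Eu (m + 1)) x₀).source) :
    ∀ᶠ x in 𝓝 x₁, o.chartSign x₀ x = o.chartSign x₀ x₁ := by
  obtain ⟨o₁, ho⟩ := o.locally_constant x₁
  -- The same sign computed in the chart at `x₁`: a constant times the determinant of a transition
  -- map, hence continuous.
  let B : M → ℝ := fun x => orientSign o₁ *
    (HomBundle.transD (achart (Eu (m + 1)) x₀) (achart _ x₁) (chartAt (Eu (m + 1)) x₀ x)).det
  have hsrc : ∀ᶠ x in 𝓝 x₁, x ∈ (chartAt (Eu (m + 1)) x₀).source ∧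
      x ∈ (chartAt (Eu (m + 1)) x₁).source :=
    Filter.inter_mem ((chartAt (Eu (m + 1)) x₀).open_source.mem_nhds hx)
      ((chartAt (Eu (m + 1)) x₁).open_source.mem_nhds (mem_chart_source _ x₁))
  have hB : ContinuousAt B x₁ := by
    have hmem : chartAt (Eu (m + 1)) x₀ x₁ ∈
        ((achart (Eu (m + 1)) x₀).1.symm.trans (achart (Eu (m + 1)) x₁).1).source := by
      have h1 : chartAt (Eu (m + 1)) x₀ x₁ ∈ (chartAt (Eu (m + 1)) x₀).target :=
        (chartAt (Eu (m + 1)) x₀).map_source hx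
      have h2 : (chartAt (Eu (m + 1)) x₀).symm (chartAt (Eu (m + 1)) x₀ x₁) ∈
          (chartAt (Eu (m + 1)) x₁).source := by
        rw [(chartAt (Eu (m + 1)) x₀).left_inv hx]; exact mem_chart_source _ x₁
      simpa using ⟨h1, h2⟩
    have h1 : ContinuousAt (HomBundle.transD (achart (Eu (m + 1)) x₀) (achart _ x₁))
        (chartAt (Eu (m + 1)) x₀ x₁) :=
      (HomBundle.contDiffOn_transD _ _).continuousOn.continuousAt
        (((achart (Eu (m + 1)) x₀).1.symm.trans (achart (Eu (m + 1)) x₁).1).open_source.mem_nhds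
          hmem)
    have h2 : ContinuousAt (fun x => HomBundle.transD (achart (Eu (m + 1)) x₀) (achart _ x₁)
        (chartAt (Eu (m + 1)) x₀ x)) x₁ :=
      ContinuousAt.comp (f := chartAt (Eu (m + 1)) x₀) h1
        ((chartAt (Eu (m + 1)) x₀).continuousAt hx)
    exact continuousAt_const.mul (ContinuousLinearMap.continuous_det.continuousAt.comp h2)
  -- Compatibility of orientations gives the sign of the determinant of `toChartL x₁ x`; multiplying
  -- by the square of that of `ofChartL x₀ x` produces `B x`.
  have hpos : ∀ᶠ x in 𝓝 x₁,
      0 < orientSign (o.orient x) * (ofChartL (m := m) x₀ x).det * B x := by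
    filter_upwards [ho, hsrc] with x hox hxs
    have h1 := orientSign_map (o.orient x) o₁ _ (hox hxs.2)
    have h4 : (HomBundle.transD (achart (Eu (m + 1)) x₀) (achart _ x₁)
        (chartAt (Eu (m + 1)) x₀ x)).det =
        (toChartL (m := m) x₁ x).det * (ofChartL (m := m) x₀ x).det := by
      rw [ContinuousLinearMap.det, ContinuousLinearMap.det, ContinuousLinearMap.det,
        ← LinearMap.det_comp]
      congr 1
      ext1 v
      have h5 := HomBundle.toChart_ofChart (achart (Eu (m + 1)) x₀) (achart _ x₁) x hxs.1 hxs.2 v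
      rw [HomBundle.coordChange_eq] at h5
      exact h5.symm
    have h1' : 0 < (toChartL (m := m) x₁ x).det * orientSign (o.orient x) * orientSign o₁ := h1
    have h7 : 0 < (ofChartL (m := m) x₀ x).det ^ 2 := by
      have := det_ofChartL_ne_zero hxs.1
      positivity
    simp only [B]
    rw [h4]
    have := mul_pos h1' h7
    linarith
  have hsign : ∀ {a b c : ℝ}, 0 < a * b → 0 < b * c → Real.sign a = Real.sign c := by
    intro a b c hab hbc
    rcases pos_and_pos_or_neg_and_neg_of_mul_pos hab with ⟨ha, hb⟩ | ⟨ha, hb⟩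
    · rw [Real.sign_of_pos ha, Real.sign_of_pos ((pos_iff_pos_of_mul_pos hbc).1 hb)]
    · rw [Real.sign_of_neg ha, Real.sign_of_neg (by nlinarith)]
  have hB1 : B x₁ ≠ 0 := right_ne_zero_of_mul hpos.self_of_nhds.ne'
  have hBpos : ∀ᶠ x in 𝓝 x₁, 0 < B x * B x₁ :=
    (hB.mul continuousAt_const).eventually (lt_mem_nhds (mul_self_pos.2 hB1))
  filter_upwards [hpos, hBpos] with x h1 h2
  have h3 := hpos.self_of_nhds
  rw [mul_comm] at h3
  exact (hsign h1 h2).trans (hsign (mul_self_pos.2 hB1) h3)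

end BaseManifold

/-! ### Derivatives of preferred charts -/

section ChartDerivatives

variable {V : Type*} [NormedAddCommGroup V] [NormedSpace ℝ V]
  {N : Type*} [TopologicalSpace N] [ChartedSpace V N] [IsManifold 𝓘(ℝ, V) ∞ N]

/-- The tangent space at `p` is identified with the model space through this very chart. -/
theorem mfderiv_chartAt_eq_id (p : N) :
    mfderiv 𝓘(ℝ, V) 𝓘(ℝ, V) (chartAt V p) p = ContinuousLinearMap.id ℝ V := by
  rw [mfderiv_chartAt_eq_tangentCoordChange (mem_chart_source _ p)]
  ext1 v
  exact tangentCoordChange_self (mem_extChartAt_source p)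

theorem mfderiv_chartAt_symm_eq_id (p : N) :
    mfderiv 𝓘(ℝ, V) 𝓘(ℝ, V) (chartAt V p).symm (chartAt V p p) = ContinuousLinearMap.id ℝ V := by
  have h := (mdifferentiable_chart (I := 𝓘(ℝ, V)) p).symm_comp_deriv (mem_chart_source V p)
  rw [mfderiv_chartAt_eq_id] at h
  exact h

end ChartDerivatives

/-! ### Affine coordinates on rays -/

section AffineCoordinates

variable {m : ℕ}

/-- The linear part of the affine map `affVec i s`. -/
def affLin (i : Fin (m + 1)) : Eu m →L[ℝ] Eu (m + 1) :=
  LinearMap.toContinuousLinearMap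
    { toFun := fun y => WithLp.toLp 2 (i.insertNth (α := fun _ => ℝ) 0 y)
      map_add' := fun y z => by
        ext k
        refine Fin.succAboveCases i ?_ (fun j => ?_) k <;> simp
      map_smul' := fun c y => by
        ext k
        refine Fin.succAboveCases i ?_ (fun j => ?_) k <;> simp }

theorem affVec_eq_add (i : Fin (m + 1)) (s : ℤˣ) (y : Eu m) :
    affVec i s y = affVec i s 0 + affLin i y := by
  ext k
  refine Fin.succAboveCases i ?_ (fun j => ?_) k <;> simp [affVec, affLin]

theorem hasFDerivAt_affVec (i : Fin (m + 1)) (s : ℤˣ) (y : Eu m) :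
    HasFDerivAt (affVec i s) (affLin i) y := by
  have h : affVec i s = fun y => affVec i s 0 + affLin i y := funext (affVec_eq_add i s)
  rw [h]
  exact (affLin i).hasFDerivAt.const_add _

theorem differentiableAt_affCoord {i : Fin (m + 1)} {s : ℤˣ} {u : Eu (m + 1)}
    (hu : 0 < ((s : ℤ) : ℝ) * u i) : DifferentiableAt ℝ (affCoord i s) u := by
  have ho : IsOpen {v : Eu (m + 1) | 0 < ((s : ℤ) : ℝ) * v i} :=
    isOpen_lt continuous_const (by fun_prop)
  exact ((contDiffOn_affCoord i s).contDiffAt (ho.mem_nhds hu)).differentiableAt (by simp)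

/-- Differentiate `v = (s v_i) • affVec i s (affCoord i s v)` at `u`. This splits `w` into a part
along the affine slice and a radial part. -/
theorem eq_smul_affLin_add {i : Fin (m + 1)} {s : ℤˣ} {u : Eu (m + 1)}
    (hu : 0 < ((s : ℤ) : ℝ) * u i) (w : Eu (m + 1)) :
    w = (((s : ℤ) : ℝ) * u i) • affLin i (fderiv ℝ (affCoord i s) u w) +
      (((s : ℤ) : ℝ) * w i) • affVec i s (affCoord i s u) := by
  have ho : IsOpen {v : Eu (m + 1) | 0 < ((s : ℤ) : ℝ) * v i} :=
    isOpen_lt continuous_const (by fun_prop)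
  let l : Eu (m + 1) →L[ℝ] ℝ := ((s : ℤ) : ℝ) • EuclideanSpace.proj i
  have h1 : HasFDerivAt (fun v : Eu (m + 1) => l v • affVec i s (affCoord i s v)) _ u :=
    l.hasFDerivAt.smul ((hasFDerivAt_affVec i s (affCoord i s u)).comp u
      (differentiableAt_affCoord hu).hasFDerivAt)
  have h2 : (fun v : Eu (m + 1) => l v • affVec i s (affCoord i s v)) =ᶠ[𝓝 u] fun v => v := by
    filter_upwards [ho.mem_nhds hu] with v hv
    have hv' : 0 < ((s : ℤ) : ℝ) * v i := hv
    rw [affVec_affCoord i s v hv]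
    change (((s : ℤ) : ℝ) * v i) • (((s : ℤ) : ℝ) * v i)⁻¹ • v = v
    rw [smul_smul, mul_inv_cancel₀ hv'.ne', one_smul]
  have h3 := h1.unique ((hasFDerivAt_id u).congr_of_eventuallyEq h2)
  have h4 := DFunLike.congr_fun h3 w
  exact h4.symm

/-- A vector in a half space and the affine coordinate directions form a basis. -/
theorem eDet_affVec_affLin_ne_zero (i : Fin (m + 1)) (s : ℤˣ) (y : Eu m) :
    eDet (m + 1) (Fin.cons (affVec i s y) fun j => affLin i (EuclideanSpace.single j 1)) ≠ 0 := by
  set B : Fin (m + 1) → Eu (m + 1) :=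
    Fin.cons (affVec i s y) fun j => affLin i (EuclideanSpace.single j 1) with hB
  have hspan : (⊤ : Submodule ℝ (Eu (m + 1))) ≤ Submodule.span ℝ (range B) := by
    intro w _
    have hu : 0 < ((s : ℤ) : ℝ) * affVec i s y i := by
      rw [affVec_same, unitSign_mul_self]; exact one_pos
    rw [eq_smul_affLin_add hu w]
    refine Submodule.add_mem _ (Submodule.smul_mem _ _ ?_) (Submodule.smul_mem _ _ ?_)
    · set η := fderiv ℝ (affCoord i s) (affVec i s y) w
      have h : η = ∑ a, η a • EuclideanSpace.single a (1 : ℝ) := by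
        have := (EuclideanSpace.basisFun (Fin m) ℝ).sum_repr η
        simpa using this.symm
      rw [h, map_sum]
      refine Submodule.sum_mem _ fun a _ => ?_
      rw [map_smul]
      exact Submodule.smul_mem _ _ (Submodule.subset_span ⟨a.succ, rfl⟩)
    · rw [affCoord_affVec]
      exact Submodule.subset_span ⟨0, rfl⟩
  have hli : LinearIndependent ℝ B :=
    linearIndependent_of_top_le_span_of_card_eq_finrank hspan (by simp)
  have h := ((EuclideanSpace.basisFun (Fin (m + 1)) ℝ).toBasis.is_basis_iff_det).1
    ⟨hli, top_le_iff.1 hspan⟩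
  exact h.ne_zero

end AffineCoordinates

/-! ### The projection and the fibres of `HM` in preferred charts -/

section HomBundleCharts

variable {m : ℕ} {M : Type*} [TopologicalSpace M] [ChartedSpace (Eu (m + 1)) M]
  [IsManifold 𝓘(ℝ, Eu (m + 1)) ∞ M]

namespace HomBundle

/-- The index of the half space of the preferred chart at `p`. -/
def chartIndex (p : HomBundle m M) : Fin (m + 1) := p.exists_half_space_rep.choose.1

/-- The sign of the half space of the preferred chart at `p`. -/
def chartUnit (p : HomBundle m M) : ℤˣ := p.exists_half_space_rep.choose.2

theorem chartAt_apply (p q : HomBundle m M) : chartAt (Eu (m + 1) × Eu m) p q =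
    (chartAt (Eu (m + 1)) p.proj q.proj,
      affCoord p.chartIndex p.chartUnit (toChartL p.proj q.proj q.rep)) := rfl

theorem chartAt_symm_apply (p : HomBundle m M) (q : Eu (m + 1) × Eu m) :
    (chartAt (Eu (m + 1) × Eu m) p).symm q = cls ((chartAt (Eu (m + 1)) p.proj).symm q.1)
      (ofChartL p.proj ((chartAt (Eu (m + 1)) p.proj).symm q.1)
        (affVec p.chartIndex p.chartUnit q.2)) := rfl

theorem mem_chartAt_source (p q : HomBundle m M) : q ∈ (chartAt (Eu (m + 1) × Eu m) p).source ↔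
    q.proj ∈ (chartAt (Eu (m + 1)) p.proj).source ∧
      0 < ((p.chartUnit : ℤ) : ℝ) * (toChartL p.proj q.proj q.rep) p.chartIndex := Iff.rfl

theorem proj_eventuallyEq (p : HomBundle m M) : (proj : HomBundle m M → M) =ᶠ[𝓝 p]
    fun q => (chartAt (Eu (m + 1)) p.proj).symm (chartAt (Eu (m + 1) × Eu m) p q).1 := by
  filter_upwards [(chartAt (Eu (m + 1) × Eu m) p).open_source.mem_nhds (mem_chart_source _ p)]
    with q hq
  rw [chartAt_apply, (chartAt (Eu (m + 1)) p.proj).left_inv ((mem_chartAt_source p q).1 hq).1]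

/-- Near `p` the projection is the first factor between the preferred charts, whose derivatives at
`p` and `p.proj` are identities. The vertical vectors at `p` are therefore the pairs `(0, η)`. -/
theorem hasMFDerivAt_proj (p : HomBundle m M) :
    HasMFDerivAt 𝓘(ℝ, Eu (m + 1) × Eu m) 𝓘(ℝ, Eu (m + 1)) (proj : HomBundle m M → M) p
      (ContinuousLinearMap.fst ℝ (Eu (m + 1)) (Eu m)) := by
  have h1 : HasMFDerivAt 𝓘(ℝ, Eu (m + 1) × Eu m) 𝓘(ℝ, Eu (m + 1) × Eu m)
      (chartAt (Eu (m + 1) × Eu m) p) p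
      (ContinuousLinearMap.id ℝ (Eu (m + 1) × Eu m)) := by
    rw [← mfderiv_chartAt_eq_id p]
    exact (mdifferentiableAt_atlas (chart_mem_atlas _ p) (mem_chart_source _ p)).hasMFDerivAt
  have h2 : HasMFDerivAt 𝓘(ℝ, Eu (m + 1) × Eu m) 𝓘(ℝ, Eu (m + 1))
      (Prod.fst : Eu (m + 1) × Eu m → Eu (m + 1)) (chartAt (Eu (m + 1) × Eu m) p p)
      (ContinuousLinearMap.fst ℝ (Eu (m + 1)) (Eu m)) := hasFDerivAt_fst.hasMFDerivAt
  have h3 : HasMFDerivAt 𝓘(ℝ, Eu (m + 1)) 𝓘(ℝ, Eu (m + 1)) (chartAt (Eu (m + 1)) p.proj).symm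
      (chartAt (Eu (m + 1) × Eu m) p p).1 (ContinuousLinearMap.id ℝ (Eu (m + 1))) := by
    rw [← mfderiv_chartAt_symm_eq_id p.proj]
    exact (mdifferentiableAt_atlas_symm (chart_mem_atlas _ p.proj)
      (mem_chart_target _ p.proj)).hasMFDerivAt
  have h5 := HasMFDerivAt.comp (chartAt (Eu (m + 1) × Eu m) p p) h3 h2
  have h4 := HasMFDerivAt.comp p h5 h1
  exact h4.congr_of_eventuallyEq (proj_eventuallyEq p)

theorem mfderiv_proj (p : HomBundle m M) :
    mfderiv 𝓘(ℝ, Eu (m + 1) × Eu m) 𝓘(ℝ, Eu (m + 1)) (proj : HomBundle m M → M) p =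
      ContinuousLinearMap.fst ℝ (Eu (m + 1)) (Eu m) := (hasMFDerivAt_proj p).mfderiv

theorem chartAt_cls (x : M) {u : Eu (m + 1)} (hu : u ≠ 0) {p : HomBundle m M} (hp : p.proj = x) :
    chartAt (Eu (m + 1) × Eu m) p (cls x u) =
      (chartAt (Eu (m + 1)) x x, affCoord p.chartIndex p.chartUnit u) := by
  subst hp
  rw [chartAt_apply]
  refine Prod.ext rfl ?_
  have h := affCoord_toChart_rep_cls p.chartIndex p.chartUnit (achart _ p.proj) p.proj hu
  refine h.trans ?_
  congr 1
  exact (tangentBundleCore 𝓘(ℝ, Eu (m + 1)) M).coordChange_self _ _ (mem_chart_source _ p.proj) u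

theorem cls_mem_chartAt_source (x : M) {u : Eu (m + 1)} (hu : u ≠ 0) {p : HomBundle m M}
    (hp : p.proj = x) : cls x u ∈ (chartAt (Eu (m + 1) × Eu m) p).source ↔
      0 < ((p.chartUnit : ℤ) : ℝ) * u p.chartIndex := by
  subst hp
  rw [mem_chartAt_source]
  have h := pos_toChart_rep_cls p.chartIndex p.chartUnit (achart _ p.proj) p.proj hu
  have h2 : toChart (achart _ p.proj) p.proj u = u :=
    (tangentBundleCore 𝓘(ℝ, Eu (m + 1)) M).coordChange_self _ _ (mem_chart_source _ p.proj) u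
  rw [h2] at h
  exact ⟨fun h1 => h.1 h1.2, fun h1 => ⟨mem_chart_source _ p.proj, h.2 h1⟩⟩

theorem pos_of_cls (x : M) {u : Eu (m + 1)} (hu : u ≠ 0) :
    0 < (((cls x u).chartUnit : ℤ) : ℝ) * u (cls x u).chartIndex :=
  (cls_mem_chartAt_source x hu rfl).1 (mem_chart_source _ _)

/-- Along the fibre only the affine coordinates vary. The chart at `[x, u]` uses the preferred chart
at `x`, so they are those of the vector itself, without a transition map. -/
theorem hasMFDerivAt_cls (x : M) {u : Eu (m + 1)} (hu : u ≠ 0) :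
    HasMFDerivAt 𝓘(ℝ, Eu (m + 1)) 𝓘(ℝ, Eu (m + 1) × Eu m)
      (fun v : Eu (m + 1) => (cls x v : HomBundle m M)) u
      ((ContinuousLinearMap.inr ℝ (Eu (m + 1)) (Eu m)).comp
        (fderiv ℝ (affCoord (cls x u).chartIndex (cls x u).chartUnit) u)) := by
  set p : HomBundle m M := cls x u with hp
  have hpos := pos_of_cls x hu
  rw [← hp] at hpos
  have h1 : HasFDerivAt (fun v : Eu (m + 1) => (chartAt (Eu (m + 1)) x x,
      affCoord p.chartIndex p.chartUnit v))
      ((ContinuousLinearMap.inr ℝ (Eu (m + 1)) (Eu m)).comp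
        (fderiv ℝ (affCoord p.chartIndex p.chartUnit) u)) u :=
    (hasFDerivAt_prodMk_right _ _).comp u (differentiableAt_affCoord hpos).hasFDerivAt
  have hφ : (chartAt (Eu (m + 1)) x x, affCoord p.chartIndex p.chartUnit u) =
      chartAt (Eu (m + 1) × Eu m) p p := (chartAt_cls x hu rfl).symm
  have h2 : HasMFDerivAt 𝓘(ℝ, Eu (m + 1) × Eu m) 𝓘(ℝ, Eu (m + 1) × Eu m)
      (chartAt (Eu (m + 1) × Eu m) p).symm
      (chartAt (Eu (m + 1)) x x, affCoord p.chartIndex p.chartUnit u)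
      (ContinuousLinearMap.id ℝ (Eu (m + 1) × Eu m)) := by
    rw [hφ, ← mfderiv_chartAt_symm_eq_id p]
    exact (mdifferentiableAt_atlas_symm (chart_mem_atlas _ p)
      (mem_chart_target _ p)).hasMFDerivAt
  have h3 := h2.comp u h1.hasMFDerivAt
  refine h3.congr_of_eventuallyEq ?_
  have ho : IsOpen {v : Eu (m + 1) | 0 < ((p.chartUnit : ℤ) : ℝ) * v p.chartIndex} :=
    isOpen_lt continuous_const (by fun_prop)
  filter_upwards [ho.mem_nhds hpos, isOpen_ne.mem_nhds hu] with v hv hv0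
  have h4 := (chartAt (Eu (m + 1) × Eu m) p).left_inv ((cls_mem_chartAt_source x hv0 rfl).2 hv)
  rw [chartAt_cls x hv0 rfl] at h4
  exact h4.symm

theorem proj_mfderiv_cls (x : M) {u : Eu (m + 1)} (hu : u ≠ 0) (w : Eu (m + 1)) :
    mfderiv 𝓘(ℝ, Eu (m + 1)) 𝓘(ℝ, Eu (m + 1) × Eu m)
      (fun v : Eu (m + 1) => (cls x v : HomBundle m M)) u w =
        ((0, fderiv ℝ (affCoord (cls x u).chartIndex (cls x u).chartUnit) u w) :
          Eu (m + 1) × Eu m) := by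
  rw [(hasMFDerivAt_cls x hu).mfderiv]
  rfl

/-- The affine representative of a ray in its preferred chart. -/
def affRep (p : HomBundle m M) : Eu (m + 1) :=
  affVec p.chartIndex p.chartUnit (chartAt (Eu (m + 1) × Eu m) p p).2

theorem affRep_ne_zero (p : HomBundle m M) : p.affRep ≠ 0 := affVec_ne_zero _ _ _

/-- At points other than `p` the chart at `p` is not the preferred one. The two factorizations of
the projection composed with the inverse chart are compared by the chain rule. -/
theorem mfderiv_proj_chartAt_symm (p : HomBundle m M) {q : Eu (m + 1) × Eu m}
    (hq : q.1 ∈ (chartAt (Eu (m + 1)) p.proj).target) (Z : Eu (m + 1) × Eu m) :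
    mfderiv 𝓘(ℝ, Eu (m + 1) × Eu m) 𝓘(ℝ, Eu (m + 1)) (proj : HomBundle m M → M)
      ((chartAt (Eu (m + 1) × Eu m) p).symm q)
      (mfderiv 𝓘(ℝ, Eu (m + 1) × Eu m) 𝓘(ℝ, Eu (m + 1) × Eu m)
        (chartAt (Eu (m + 1) × Eu m) p).symm q Z) =
      ofChartL p.proj ((chartAt (Eu (m + 1)) p.proj).symm q.1) Z.1 := by
  have hq' : q ∈ (chartAt (Eu (m + 1) × Eu m) p).target := ⟨hq, mem_univ _⟩
  have h1 := mdifferentiableAt_atlas_symm (I := 𝓘(ℝ, Eu (m + 1) × Eu m)) (chart_mem_atlas _ p) hq'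
  have h2 := HasMFDerivAt.comp q
    (hasMFDerivAt_proj ((chartAt (Eu (m + 1) × Eu m) p).symm q)) h1.hasMFDerivAt
  have h3 : HasMFDerivAt 𝓘(ℝ, Eu (m + 1) × Eu m) 𝓘(ℝ, Eu (m + 1))
      (Prod.fst : Eu (m + 1) × Eu m → Eu (m + 1)) q
      (ContinuousLinearMap.fst ℝ (Eu (m + 1)) (Eu m)) := hasFDerivAt_fst.hasMFDerivAt
  have h4 : HasMFDerivAt 𝓘(ℝ, Eu (m + 1)) 𝓘(ℝ, Eu (m + 1)) (chartAt (Eu (m + 1)) p.proj).symm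
      q.1 (ofChartL p.proj ((chartAt (Eu (m + 1)) p.proj).symm q.1)) := by
    rw [← mfderiv_chartAt_symm p.proj hq]
    exact (mdifferentiableAt_atlas_symm (chart_mem_atlas _ p.proj) hq).hasMFDerivAt
  have h5 := h4.comp q h3
  have h6 := hasMFDerivAt_unique h2 h5
  have h7 := DFunLike.congr_fun h6 Z
  rw [mfderiv_proj]
  exact h7

end HomBundle

end HomBundleCharts

/-! ### The Hilbert form, its derivative and the contact volume -/

section HilbertForm

variable {m : ℕ} {M : Type*} [TopologicalSpace M] [ChartedSpace (Eu (m + 1)) M]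
  [IsManifold 𝓘(ℝ, Eu (m + 1)) ∞ M]

theorem HomBundle.cls_affRep (p : HomBundle m M) : HomBundle.cls p.proj p.affRep = p := by
  have h := (chartAt (Eu (m + 1) × Eu m) p).left_inv (mem_chart_source _ p)
  rw [HomBundle.chartAt_symm_apply, HomBundle.chartAt_apply,
    (chartAt (Eu (m + 1)) p.proj).left_inv (mem_chart_source _ p.proj), ofChartL_self] at h
  exact h

namespace FinslerMetric

variable (F : FinslerMetric m M)

/-- Homogeneity of degree `0` removes the arbitrary choice of a representative, which need not vary
smoothly. -/
theorem fderiv_fibre_rep_cls (x : M) {v : Eu (m + 1)} (hv : v ≠ 0) :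
    fderiv ℝ (F.fibre x) (HomBundle.cls x v).rep = fderiv ℝ (F.fibre x) v := by
  obtain ⟨l, hl, h⟩ := HomBundle.rep_cls x v hv
  rw [h]
  exact (F.isMinkowskiNorm_fibre x).fderiv_smul v hl

theorem hilbertForm_apply (p : HomBundle m M) (Z : Fin 1 → Eu (m + 1) × Eu m) :
    F.hilbertForm p Z = fderiv ℝ (F.fibre p.proj) p.affRep (Z 0).1 := by
  have h := F.fderiv_fibre_rep_cls p.proj p.affRep_ne_zero
  rw [HomBundle.cls_affRep] at h
  rw [← h, hilbertForm, HomBundle.mfderiv_proj]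
  rfl

/-- The Hilbert form in the preferred chart at `p`. -/
theorem hilbertForm_inChart (p : HomBundle m M) {q : Eu (m + 1) × Eu m}
    (hq : q.1 ∈ (chartAt (Eu (m + 1)) p.proj).target) (Z : Fin 1 → Eu (m + 1) × Eu m) :
    F.hilbertForm.inChart p q Z = fderiv ℝ (fun v => F.inChart p.proj (q.1, v))
      (affVec p.chartIndex p.chartUnit q.2) (Z 0).1 := by
  set x := (chartAt (Eu (m + 1)) p.proj).symm q.1 with hx
  set v := affVec p.chartIndex p.chartUnit q.2 with hv
  have hv0 : ofChartL p.proj x v ≠ 0 :=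
    (map_ne_zero_iff _ (ofChartL_injective ((chartAt (Eu (m + 1)) p.proj).map_target hq))).2
      (affVec_ne_zero _ _ _)
  have h1 : F.hilbertForm.inChart p q Z =
      fderiv ℝ (F.fibre x) (HomBundle.cls x (ofChartL p.proj x v)).rep
        (ofChartL p.proj x (Z 0).1) := by
    rw [← HomBundle.mfderiv_proj_chartAt_symm p hq]
    rfl
  have h2 : HasFDerivAt (fun v => F.inChart p.proj (q.1, v))
      ((fderiv ℝ (F.fibre x) (ofChartL p.proj x v)).comp (ofChartL p.proj x)) v :=
    ((F.isMinkowskiNorm_fibre x).differentiableAt hv0).hasFDerivAt.comp v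
      (ofChartL p.proj x).hasFDerivAt
  rw [h1, h2.fderiv, F.fderiv_fibre_rep_cls x hv0]
  rfl

/-- The form only has components along the base, so contracting its derivative with a vertical
vector differentiates the coefficients along the fibre and leaves nothing else. -/
theorem hilbertForm_d_apply (p : HomBundle m M) (η : Eu m) (Z : Eu (m + 1) × Eu m) :
    F.hilbertForm.d p ![((0, η) : Eu (m + 1) × Eu m), Z] =
      fderiv ℝ (fderiv ℝ (F.fibre p.proj)) p.affRep (affLin p.chartIndex η) Z.1 := by
  set q₀ : Eu (m + 1) × Eu m := chartAt (Eu (m + 1) × Eu m) p p with hq₀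
  have hT : IsOpen (chartAt (Eu (m + 1) × Eu m) p).target := (chartAt _ p).open_target
  have hq₀T : q₀ ∈ (chartAt (Eu (m + 1) × Eu m) p).target := mem_chart_target _ p
  have hU : IsOpen ((chartAt (Eu (m + 1)) p.proj).target ×ˢ {v : Eu (m + 1) | v ≠ 0}) :=
    (chartAt (Eu (m + 1)) p.proj).open_target.prod isOpen_ne
  let G : Eu (m + 1) × Eu m → Eu (m + 1) →L[ℝ] ℝ := fun q =>
    fderiv ℝ (fun v => F.inChart p.proj (q.1, v)) (affVec p.chartIndex p.chartUnit q.2)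
  have hG : ContDiffAt ℝ ∞ G q₀ := by
    have h1 := contDiffOn_partial_fderiv hU (F.contDiffOn_inChart p.proj)
    have h2 : ContDiffOn ℝ ∞ G (chartAt (Eu (m + 1) × Eu m) p).target :=
      h1.comp (f := fun q : Eu (m + 1) × Eu m => (q.1, affVec p.chartIndex p.chartUnit q.2))
        (contDiff_fst.prodMk ((contDiff_affVec _ _).comp contDiff_snd)).contDiffOn
        fun q hq => ⟨hq.1, affVec_ne_zero _ _ _⟩
    exact h2.contDiffAt (hT.mem_nhds hq₀T)
  have hω : ∀ᶠ q in 𝓝 q₀, ∀ Z : Fin 1 → Eu (m + 1) × Eu m,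
      F.hilbertForm.inChart p q Z = G q (Z 0).1 := by
    filter_upwards [hT.mem_nhds hq₀T] with q hq Z using F.hilbertForm_inChart p hq.1 Z
  have hdiff : DifferentiableAt ℝ (F.hilbertForm.inChart p) q₀ := by
    refine ContDiffAt.differentiableAt (n := ∞) (contDiffAt_of_forall_apply fun Z => ?_) (by simp)
    exact (hG.clm_apply contDiffAt_const).congr_of_eventuallyEq (hω.mono fun q hq => hq Z)
  have h1 : F.hilbertForm.d p ![((0, η) : Eu (m + 1) × Eu m), Z] =
      extDeriv (F.hilbertForm.inChart p) q₀ ![((0, η) : Eu (m + 1) × Eu m), Z] := by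
    rw [DiffForm.d, mfderiv_chartAt_eq_id]
    rfl
  rw [h1, extDeriv_apply hdiff, Fin.sum_univ_two]
  have h2 : ∀ W : Fin 1 → Eu (m + 1) × Eu m,
      (fun q => F.hilbertForm.inChart p q W) =ᶠ[𝓝 q₀] fun q => G q (W 0).1 :=
    fun W => hω.mono fun q hq => hq W
  rw [(h2 _).fderiv_eq, (h2 _).fderiv_eq]
  have h3 : HasFDerivAt (fun q => G q Z.1) (fderiv ℝ (fun q => G q Z.1) q₀) (q₀.1, q₀.2) :=
    ((hG.clm_apply contDiffAt_const).differentiableAt (by simp)).hasFDerivAt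
  have h4 := h3.comp q₀.2 (hasFDerivAt_prodMk_right q₀.1 q₀.2)
  have h5 : HasFDerivAt (fun y : Eu m => fderiv ℝ (F.fibre p.proj)
      (affVec p.chartIndex p.chartUnit y) Z.1)
      ((fderiv ℝ (fderiv ℝ (F.fibre p.proj)) p.affRep).comp
        (affLin p.chartIndex) |>.flip Z.1) q₀.2 :=
    (ContinuousLinearMap.apply ℝ ℝ Z.1).hasFDerivAt.comp q₀.2
      (((F.isMinkowskiNorm_fibre p.proj).differentiableAt_fderiv
        p.affRep_ne_zero).hasFDerivAt.comp q₀.2 (hasFDerivAt_affVec _ _ _))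
  have h6 : ((fun q => G q Z.1) ∘ fun y : Eu m => (q₀.1, y)) = fun y : Eu m =>
      fderiv ℝ (F.fibre p.proj) (affVec p.chartIndex p.chartUnit y) Z.1 := by
    ext y
    have h7 : (fun v => F.inChart p.proj (q₀.1, v)) = F.fibre p.proj := F.inChart_self p.proj
    change fderiv ℝ (fun v => F.inChart p.proj (q₀.1, v)) _ _ = _
    rw [h7]
  rw [h6] at h4
  have h8 := DFunLike.congr_fun (h4.unique h5) η
  -- The other term of the exterior derivative differentiates the value of the form on the vertical
  -- vector `(0, η)`, which is identically zero.
  have h9 : (fun q => G q (Fin.removeNth 1 ![((0, η) : Eu (m + 1) × Eu m), Z] 0).1) =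
      fun _ => 0 := by
    ext q
    exact map_zero (G q)
  rw [h9]
  simp only [fderiv_fun_const]
  have h10 : (fun q => G q (Fin.removeNth 0 ![((0, η) : Eu (m + 1) × Eu m), Z] 0).1) =
      fun q => G q Z.1 := rfl
  rw [h10]
  simpa using h8

end FinslerMetric

/-- The constant by which the contact volume is expressed in terms of the density of the metric. -/
theorem exists_contactVolume_eq (m : ℕ) (M : Type*) [TopologicalSpace M]
    [ChartedSpace (Eu (m + 1)) M] [IsManifold 𝓘(ℝ, Eu (m + 1)) ∞ M] :
    ∃ C : ℝ, C ≠ 0 ∧ ∀ (F : FinslerMetric m M) (p : HomBundle m M),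
      ∃ ξ : Fin (m + 1) → Eu (m + 1),
        fibreDensity (F.fibre p.proj) p.affRep / 2 ^ (m + 1) *
          eDet (m + 1) (Fin.cons p.affRep fun j =>
            affLin p.chartIndex (EuclideanSpace.single j 1)) * eDet (m + 1) ξ = 1 ∧
        F.contactVolume p (Fin.append
          (fun j => ((0, EuclideanSpace.single j 1) : Eu (m + 1) × Eu m))
          (fun j => ((ξ j, 0) : Eu (m + 1) × Eu m))) = C := by
  obtain ⟨C, hC, h⟩ := exists_wedge_wedgePow_darboux (Eu (m + 1) × Eu m) m
  refine ⟨C, hC, fun F p => ?_⟩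
  have hf := F.isMinkowskiNorm_fibre p.proj
  -- The covectors `f'(v)` and `f''(v)(Yᵢ, ·)`, with `Yᵢ` the coordinate directions of the affine
  -- chart.
  let row : Fin (m + 1) → Eu (m + 1) →L[ℝ] ℝ := Fin.cons (fderiv ℝ (F.fibre p.proj) p.affRep)
    fun i => fderiv ℝ (fderiv ℝ (F.fibre p.proj)) p.affRep
      (affLin p.chartIndex (EuclideanSpace.single i 1))
  have hdet : ∀ X : Fin (m + 1) → Eu (m + 1), Matrix.det (Matrix.of fun i j => row i (X j)) =
      fibreDensity (F.fibre p.proj) p.affRep / 2 ^ (m + 1) *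
          eDet (m + 1) (Fin.cons p.affRep fun j =>
            affLin p.chartIndex (EuclideanSpace.single j 1)) * eDet (m + 1) X := by
    intro X
    rw [← hf.det_contact p.affRep_ne_zero]
    congr 1
    ext i j
    refine Fin.cases ?_ (fun i => ?_) i <;> rfl
  let R : Matrix (Fin (m + 1)) (Fin (m + 1)) ℝ :=
    Matrix.of fun i j => row i (EuclideanSpace.single j 1)
  have hR : IsUnit R.det := by
    rw [isUnit_iff_ne_zero, hdet, eDet_single, mul_one]
    exact mul_ne_zero (div_ne_zero (hf.fibreDensity_pos p.affRep_ne_zero).ne' (by positivity))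
      (eDet_affVec_affLin_ne_zero _ _ _)
  -- The columns of the inverse matrix: the basis dual to the rows, which makes the family a Darboux
  -- one.
  let ξ : Fin (m + 1) → Eu (m + 1) := fun j => WithLp.toLp 2 fun k => R⁻¹ k j
  have hξ : ∀ i j, row i (ξ j) = if i = j then 1 else 0 := by
    intro i j
    have h1 : ξ j = ∑ k, R⁻¹ k j • EuclideanSpace.single k (1 : ℝ) := by
      have := (EuclideanSpace.basisFun (Fin (m + 1)) ℝ).sum_repr (ξ j)
      simpa [ξ] using this.symm
    have h2 := congrFun (congrFun (Matrix.mul_nonsing_inv R hR) i) j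
    rw [Matrix.mul_apply, Matrix.one_apply] at h2
    rw [h1, map_sum, ← h2]
    refine Finset.sum_congr rfl fun k _ => ?_
    rw [map_smul, smul_eq_mul, mul_comm]
    rfl
  refine ⟨ξ, ?_, ?_⟩
  · rw [← hdet]
    have h1 : (Matrix.of fun i j => row i (ξ j)) = (1 : Matrix (Fin (m + 1)) (Fin (m + 1)) ℝ) := by
      ext i j
      rw [Matrix.one_apply]
      exact hξ i j
    rw [h1, Matrix.det_one]
  · refine h (F.hilbertForm p).toAlternatingMap (F.hilbertForm.d p).toAlternatingMap _ _
      ?_ ?_ ?_ ?_ ?_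
    · intro i
      exact (F.hilbertForm_apply p _).trans (map_zero _)
    · refine (F.hilbertForm_apply p _).trans ((hξ 0 0).trans (if_pos rfl))
    · intro j
      refine (F.hilbertForm_apply p _).trans ((hξ 0 j.succ).trans (if_neg ?_))
      exact (Fin.succ_ne_zero j).symm
    · intro i j
      exact (F.hilbertForm_d_apply p _ _).trans (map_zero _)
    · intro i j
      refine (F.hilbertForm_d_apply p _ _).trans ((hξ i.succ j.succ).trans ?_)
      simp

end HilbertForm

/-! ### The angular form and the projection to the sphere -/

section AngularCoordinates

variable {m : ℕ}

theorem eDet_cons_smul_add (v : Eu (m + 1)) (w : Fin m → Eu (m + 1)) (l : ℝ) (c : Fin m → ℝ) :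
    eDet (m + 1) (Fin.cons v fun j => l • w j + c j • v) =
      l ^ m * eDet (m + 1) (Fin.cons v w) := by
  have h1 : eDet (m + 1) (Fin.cons v fun j => l • w j + c j • v) =
      eDet (m + 1) (Fin.cons v fun j => l • w j) := by
    rw [eDet_apply, eDet_apply]
    refine Matrix.det_eq_of_forall_row_eq_smul_add_const (Fin.cons 0 c) 0 rfl fun i j => ?_
    refine Fin.cases ?_ (fun i => ?_) i <;> simp
  have h2 : (Fin.cons v fun j => l • w j : Fin (m + 1) → Eu (m + 1)) =
      fun i => (Fin.cons 1 (fun _ => l) : Fin (m + 1) → ℝ) i •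
        (Fin.cons v w : Fin (m + 1) → Eu (m + 1)) i := by
    ext1 i
    refine Fin.cases ?_ (fun i => ?_) i <;> simp
  rw [h1, h2, AlternatingMap.map_smul_univ, Fin.prod_univ_succ]
  simp

/-- The projection to the unit sphere along rays. -/
def toSphere (z : Eu (m + 1)) : Eu (m + 1) := ‖z‖⁻¹ • z

theorem toSphere_smul (z : Eu (m + 1)) {l : ℝ} (hl : 0 < l) : toSphere (l • z) = toSphere z := by
  rw [toSphere, toSphere, norm_smul, Real.norm_of_nonneg hl.le, smul_smul, mul_inv_rev,
    inv_mul_cancel_right₀ hl.ne']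

theorem toSphere_ne_zero {z : Eu (m + 1)} (hz : z ≠ 0) : toSphere z ≠ 0 :=
  smul_ne_zero (inv_ne_zero (norm_ne_zero_iff.2 hz)) hz

theorem contDiffAt_toSphere {z : Eu (m + 1)} (hz : z ≠ 0) :
    ContDiffAt ℝ ∞ (toSphere : Eu (m + 1) → Eu (m + 1)) z :=
  ((contDiffAt_norm ℝ hz).inv (norm_ne_zero_iff.2 hz)).smul contDiffAt_id

/-- Differentiating the norm only adds a radial vector, invisible to a determinant that already
contains `z`. -/
theorem exists_fderiv_toSphere {z : Eu (m + 1)} (hz : z ≠ 0) :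
    ∃ c : Eu (m + 1) →L[ℝ] ℝ, ∀ w, fderiv ℝ toSphere z w = ‖z‖⁻¹ • w + c w • z := by
  have h1 : HasFDerivAt (fun z : Eu (m + 1) => ‖z‖⁻¹) (fderiv ℝ (fun z : Eu (m + 1) => ‖z‖⁻¹) z) z :=
    (((contDiffAt_norm ℝ (n := 1) hz).inv (norm_ne_zero_iff.2 hz)).differentiableAt
      (by simp)).hasFDerivAt
  refine ⟨fderiv ℝ (fun z : Eu (m + 1) => ‖z‖⁻¹) z, fun w => ?_⟩
  have h2 : HasFDerivAt (toSphere : Eu (m + 1) → Eu (m + 1)) _ z := h1.smul (hasFDerivAt_id z)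
  rw [h2.fderiv]
  rfl

/-- The angular form is homogeneous, and invariant under the projection to the sphere. -/
theorem eDet_toSphere {z : Eu (m + 1)} (hz : z ≠ 0) (w : Fin m → Eu (m + 1)) :
    eDet (m + 1) (Fin.cons (toSphere z) fun j => fderiv ℝ toSphere z (w j)) =
      ‖z‖⁻¹ ^ (m + 1) * eDet (m + 1) (Fin.cons z w) := by
  obtain ⟨c, hc⟩ := exists_fderiv_toSphere hz
  have hz' := norm_ne_zero_iff.2 hz
  have h1 : (fun j => fderiv ℝ toSphere z (w j)) =
      fun j => ‖z‖⁻¹ • w j + (c (w j) * ‖z‖) • toSphere z := by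
    ext1 j
    rw [hc, toSphere, smul_smul, mul_assoc, mul_inv_cancel₀ hz', mul_one]
  have h2 : (Fin.cons (toSphere z) w : Fin (m + 1) → Eu (m + 1)) =
      Function.update (Fin.cons z w) 0 (‖z‖⁻¹ • z) := by
    rw [Fin.update_cons_zero]; rfl
  have h3 : Function.update (Fin.cons z w : Fin (m + 1) → Eu (m + 1)) 0 z = Fin.cons z w := by
    rw [Fin.update_cons_zero]
  rw [h1, eDet_cons_smul_add, h2, AlternatingMap.map_update_smul, h3, smul_eq_mul, ← mul_assoc,
    ← pow_succ]

end AngularCoordinates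

/-! ### The volume form on the base -/

section VolumeForm

variable {m : ℕ} {M : Type*} [TopologicalSpace M] [ChartedSpace (Eu (m + 1)) M]
  [IsManifold 𝓘(ℝ, Eu (m + 1)) ∞ M]

/-- The multiple by `K` of the volume form whose density is the fibre volume. -/
def FinslerMetric.volumeForm (F : FinslerMetric m M) (o : ManifoldOrientation m M) (K : ℝ) :
    DiffForm (Eu (m + 1)) (m + 1) M :=
  fun x => ((K * fibreVolume (F.fibre x) * orientSign (o.orient x)) • eDetL (m + 1) :
    Eu (m + 1) [⋀^Fin (m + 1)]→L[ℝ] ℝ)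

theorem FinslerMetric.volumeForm_apply (F : FinslerMetric m M) (o : ManifoldOrientation m M)
    (K : ℝ) (x : M) (v : Fin (m + 1) → Eu (m + 1)) : F.volumeForm o K x v =
      K * fibreVolume (F.fibre x) * orientSign (o.orient x) * eDet (m + 1) v := rfl

theorem FinslerMetric.fibreVolume_inChart (F : FinslerMetric m M) {x₀ x : M}
    (hx : x ∈ (chartAt (Eu (m + 1)) x₀).source) :
    fibreVolume (fun v => F.inChart x₀ (chartAt (Eu (m + 1)) x₀ x, v)) =
      |(ofChartL (m := m) x₀ x).det| * fibreVolume (F.fibre x) := by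
  rw [F.inChart_eq, (chartAt (Eu (m + 1)) x₀).left_inv hx]
  exact (F.isMinkowskiNorm_fibre x).fibreVolume_comp _ (ofChartL_injective hx)
    (det_ofChartL_ne_zero hx)

theorem FinslerMetric.fibreDensity_inChart (F : FinslerMetric m M) {x₀ x : M}
    (hx : x ∈ (chartAt (Eu (m + 1)) x₀).source) {v : Eu (m + 1)} (hv : v ≠ 0) :
    fibreDensity (fun v => F.inChart x₀ (chartAt (Eu (m + 1)) x₀ x, v)) (toChartL x₀ x v) =
      (ofChartL (m := m) x₀ x).det ^ 2 * fibreDensity (F.fibre x) v := by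
  rw [F.inChart_eq, (chartAt (Eu (m + 1)) x₀).left_inv hx]
  have h := ofChartL_toChartL hx v
  rw [(F.isMinkowskiNorm_fibre x).fibreDensity_comp (ofChartL x₀ x) (by rw [h]; exact hv), h]

/-- The determinant brought by the pullback, times the orientation sign, is `chartSign` times its
absolute value, which the fibre volume absorbs. What remains is a smooth function times a locally
constant sign. -/
theorem FinslerMetric.volumeForm_inChart (F : FinslerMetric m M) (o : ManifoldOrientation m M)
    (K : ℝ) (x₀ : M) {a : Eu (m + 1)} (ha : a ∈ (chartAt (Eu (m + 1)) x₀).target)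
    (v : Fin (m + 1) → Eu (m + 1)) : (F.volumeForm o K).inChart x₀ a v =
      K * fibreVolume (fun v => F.inChart x₀ (a, v)) *
        o.chartSign x₀ ((chartAt (Eu (m + 1)) x₀).symm a) * eDet (m + 1) v := by
  have h1 : (F.volumeForm o K).inChart x₀ a v = F.volumeForm o K ((chartAt (Eu (m + 1)) x₀).symm a)
      fun i => ofChartL x₀ ((chartAt (Eu (m + 1)) x₀).symm a) (v i) := by
    rw [← mfderiv_chartAt_symm x₀ ha]
    rfl
  have h2 := F.fibreVolume_inChart ((chartAt (Eu (m + 1)) x₀).map_target ha)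
  rw [(chartAt (Eu (m + 1)) x₀).right_inv ha] at h2
  rw [h1, volumeForm_apply, eDet_map, h2]
  linear_combination (-K * fibreVolume (F.fibre ((chartAt (Eu (m + 1)) x₀).symm a)) *
    eDet (m + 1) v) * o.chartSign_mul_abs x₀ ((chartAt (Eu (m + 1)) x₀).symm a)

theorem ManifoldOrientation.contDiffAt_chartSign (o : ManifoldOrientation m M) (x₀ x₁ : M)
    {a : Eu (m + 1)} (ha : a ∈ (chartAt (Eu (m + 1)) x₁).target)
    (ha' : (chartAt (Eu (m + 1)) x₁).symm a ∈ (chartAt (Eu (m + 1)) x₀).source) :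
    ContDiffAt ℝ ∞ (fun a => o.chartSign x₀ ((chartAt (Eu (m + 1)) x₁).symm a)) a := by
  have h := ((chartAt (Eu (m + 1)) x₁).continuousAt_symm ha).eventually
    (o.eventually_chartSign_eq ha')
  exact contDiffAt_const.congr_of_eventuallyEq h

theorem FinslerMetric.isVolumeForm_volumeForm (F : FinslerMetric m M)
    (o : ManifoldOrientation m M) {K : ℝ} (hK : K ≠ 0) : IsVolumeForm (F.volumeForm o K) := by
  refine ⟨fun x₀ a ha => ContDiffAt.contDiffWithinAt (contDiffAt_of_forall_apply fun v => ?_),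
    fun x h => ?_⟩
  · have hT := (chartAt (Eu (m + 1)) x₀).open_target.mem_nhds ha
    refine ContDiffAt.congr_of_eventuallyEq (f := fun a => K *
      fibreVolume (fun v => F.inChart x₀ (a, v)) *
        o.chartSign x₀ ((chartAt (Eu (m + 1)) x₀).symm a) * eDet (m + 1) v) ?_ ?_
    · exact ((contDiffAt_const.mul ((F.contDiffOn_fibreVolume_inChart x₀).contDiffAt hT)).mul
        (o.contDiffAt_chartSign x₀ x₀ ha ((chartAt (Eu (m + 1)) x₀).map_target ha))).mul
          contDiffAt_const
    · filter_upwards [hT] with b hb using F.volumeForm_inChart o K x₀ hb v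
  · have h1 := F.volumeForm_apply o K x fun i => EuclideanSpace.single i 1
    rw [h, eDet_single, mul_one] at h1
    refine mul_ne_zero (mul_ne_zero hK (F.isMinkowskiNorm_fibre x).fibreVolume_pos.ne') ?_ h1.symm
    exact left_ne_zero_of_mul_eq_one (orientSign_mul_self (o.orient x))

end VolumeForm

/-! ### Local extensions of the fibre form to `HM` -/

section FibreForm

variable {m : ℕ}

theorem orientDet_apply (o : Orientation ℝ (Eu (m + 1)) (Fin (m + 1)))
    (v : Fin (m + 1) → Eu (m + 1)) : orientDet o v = orientSign o * eDet (m + 1) v := by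
  rw [orientDet_eq]
  rfl

section TransSet

variable {M : Type*} [TopologicalSpace M] [ChartedSpace (Eu (m + 1)) M]

namespace HomBundle

/-- The part of the model space in which the chart at `p` and the one at `x₀` can be compared. -/
def transSet (x₀ : M) (p : HomBundle m M) : Set (Eu (m + 1) × Eu m) :=
  {q | q.1 ∈ ((chartAt (Eu (m + 1)) p.proj).symm.trans (chartAt (Eu (m + 1)) x₀)).source}

theorem mem_transSet {x₀ : M} {p : HomBundle m M} {q : Eu (m + 1) × Eu m} : q ∈ transSet x₀ p ↔
    q.1 ∈ (chartAt (Eu (m + 1)) p.proj).target ∧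
      (chartAt (Eu (m + 1)) p.proj).symm q.1 ∈ (chartAt (Eu (m + 1)) x₀).source := by
  simp [transSet]

theorem isOpen_transSet (x₀ : M) (p : HomBundle m M) : IsOpen (transSet x₀ p) :=
  ((chartAt (Eu (m + 1)) p.proj).symm.trans (chartAt (Eu (m + 1)) x₀)).open_source.preimage
    continuous_fst

end HomBundle

end TransSet

variable {M : Type*} [TopologicalSpace M] [ChartedSpace (Eu (m + 1)) M]
  [IsManifold 𝓘(ℝ, Eu (m + 1)) ∞ M]

namespace HomBundle

/-- The unit vector, in the coordinates of the chart at `x₀`, on a ray. -/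
def unitRep (x₀ : M) (p : HomBundle m M) : Eu (m + 1) := toSphere (toChartL x₀ p.proj p.rep)

/-- The affine representative of a ray in the chart at `p`, in the coordinates of the chart
at `x₀`. -/
def transRep (x₀ : M) (p : HomBundle m M) (q : Eu (m + 1) × Eu m) : Eu (m + 1) :=
  transD (achart (Eu (m + 1)) p.proj) (achart (Eu (m + 1)) x₀) q.1
    (affVec p.chartIndex p.chartUnit q.2)

theorem contDiffOn_transRep (x₀ : M) (p : HomBundle m M) :
    ContDiffOn ℝ ∞ (transRep x₀ p) (transSet x₀ p) :=
  ((contDiffOn_transD (achart (Eu (m + 1)) p.proj) (achart (Eu (m + 1)) x₀)).comp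
    contDiff_fst.contDiffOn fun _ hq => hq).clm_apply
      ((contDiff_affVec _ _).comp contDiff_snd).contDiffOn

theorem transRep_eq {x₀ : M} {p : HomBundle m M} {q : Eu (m + 1) × Eu m}
    (hq : q ∈ transSet x₀ p) : transRep x₀ p q =
      toChartL x₀ ((chartAt (Eu (m + 1)) p.proj).symm q.1)
        (ofChartL p.proj ((chartAt (Eu (m + 1)) p.proj).symm q.1)
          (affVec p.chartIndex p.chartUnit q.2)) :=
  (toChart_ofChart_symm (achart (Eu (m + 1)) p.proj) (achart (Eu (m + 1)) x₀) q.1 hq _).symm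

theorem transRep_ne_zero {x₀ : M} {p : HomBundle m M} {q : Eu (m + 1) × Eu m}
    (hq : q ∈ transSet x₀ p) : transRep x₀ p q ≠ 0 := by
  have h := mem_transSet.1 hq
  rw [transRep_eq hq]
  exact (map_ne_zero_iff _ (toChartL_injective h.2)).2 ((map_ne_zero_iff _
    (ofChartL_injective ((chartAt (Eu (m + 1)) p.proj).map_target h.1))).2 (affVec_ne_zero _ _ _))

theorem contDiffOn_toSphere_transRep (x₀ : M) (p : HomBundle m M) :
    ContDiffOn ℝ ∞ (fun q => toSphere (transRep x₀ p q)) (transSet x₀ p) := fun q hq =>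
  ((contDiffAt_toSphere (transRep_ne_zero hq)).comp q
    ((contDiffOn_transRep x₀ p).contDiffAt ((isOpen_transSet x₀ p).mem_nhds hq))).contDiffWithinAt

/-- Normalizing cancels the unknown positive factor in the chosen representative, so `unitRep` is
smooth although `rep` need not be. -/
theorem unitRep_chartAt_symm {x₀ : M} {p : HomBundle m M} {q : Eu (m + 1) × Eu m}
    (hq : q ∈ transSet x₀ p) :
    unitRep x₀ ((chartAt (Eu (m + 1) × Eu m) p).symm q) = toSphere (transRep x₀ p q) := by
  have h := mem_transSet.1 hq
  rw [transRep_eq hq, chartAt_symm_apply]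
  obtain ⟨l, hl, hr⟩ := rep_cls ((chartAt (Eu (m + 1)) p.proj).symm q.1)
    (ofChartL p.proj ((chartAt (Eu (m + 1)) p.proj).symm q.1)
      (affVec p.chartIndex p.chartUnit q.2))
    ((map_ne_zero_iff _ (ofChartL_injective
      ((chartAt (Eu (m + 1)) p.proj).map_target h.1))).2 (affVec_ne_zero _ _ _))
  rw [unitRep, hr]
  exact (congrArg toSphere (map_smul (toChartL x₀ ((chartAt (Eu (m + 1)) p.proj).symm q.1)) l
    _)).trans (toSphere_smul _ hl)

theorem mfderiv_unitRep {x₀ : M} {p : HomBundle m M} {q : Eu (m + 1) × Eu m}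
    (hq : q ∈ transSet x₀ p) (Z : Eu (m + 1) × Eu m) :
    mfderiv 𝓘(ℝ, Eu (m + 1) × Eu m) 𝓘(ℝ, Eu (m + 1)) (unitRep x₀ : HomBundle m M → Eu (m + 1))
      ((chartAt (Eu (m + 1) × Eu m) p).symm q)
      (mfderiv 𝓘(ℝ, Eu (m + 1) × Eu m) 𝓘(ℝ, Eu (m + 1) × Eu m)
        (chartAt (Eu (m + 1) × Eu m) p).symm q Z) =
      fderiv ℝ (fun q => toSphere (transRep x₀ p q)) q Z := by
  have hT : q ∈ (chartAt (Eu (m + 1) × Eu m) p).target := ⟨(mem_transSet.1 hq).1, mem_univ _⟩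
  have hS := (isOpen_transSet x₀ p).mem_nhds hq
  have h1 : HasMFDerivAt 𝓘(ℝ, Eu (m + 1) × Eu m) 𝓘(ℝ, Eu (m + 1))
      (fun q => toSphere (transRep x₀ p q)) q
      (fderiv ℝ (fun q => toSphere (transRep x₀ p q)) q) :=
    (((contDiffOn_toSphere_transRep x₀ p).contDiffAt hS).differentiableAt
      (by simp)).hasFDerivAt.hasMFDerivAt
  have hr := (chartAt (Eu (m + 1) × Eu m) p).right_inv hT
  have hsrc := (chartAt (Eu (m + 1) × Eu m) p).map_target hT
  have h2 := (mdifferentiableAt_atlas (I := 𝓘(ℝ, Eu (m + 1) × Eu m)) (chart_mem_atlas _ p)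
    hsrc).hasMFDerivAt
  have h1' := h1
  rw [← hr] at h1'
  have h3 := HasMFDerivAt.comp _ h1' h2
  have h4 : (unitRep x₀ : HomBundle m M → Eu (m + 1)) =ᶠ[𝓝 ((chartAt (Eu (m + 1) × Eu m) p).symm q)]
      (fun q => toSphere (transRep x₀ p q)) ∘ chartAt (Eu (m + 1) × Eu m) p := by
    have hc := (chartAt (Eu (m + 1) × Eu m) p).continuousAt hsrc
    have hS' := hS
    rw [← hr] at hS'
    filter_upwards [(chartAt (Eu (m + 1) × Eu m) p).open_source.mem_nhds hsrc, hc hS'] with p' hp' hq'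
    have h := unitRep_chartAt_symm (x₀ := x₀) hq'
    rw [(chartAt (Eu (m + 1) × Eu m) p).left_inv hp'] at h
    exact h
  have h5 := (h3.congr_of_eventuallyEq h4).mdifferentiableAt.hasMFDerivAt
  have h6 := (mdifferentiableAt_atlas_symm (I := 𝓘(ℝ, Eu (m + 1) × Eu m))
    (chart_mem_atlas _ p) hT).hasMFDerivAt
  have h7 := HasMFDerivAt.comp q h5 h6
  have h8 : (unitRep x₀ : HomBundle m M → Eu (m + 1)) ∘ (chartAt (Eu (m + 1) × Eu m) p).symm
      =ᶠ[𝓝 q] fun q => toSphere (transRep x₀ p q) := by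
    filter_upwards [hS] with q' hq' using unitRep_chartAt_symm hq'
  have h9 := hasMFDerivAt_unique h7 (h1.congr_of_eventuallyEq h8)
  exact DFunLike.congr_fun h9 Z

end HomBundle

namespace FinslerMetric

variable (F : FinslerMetric m M) (o : ManifoldOrientation m M)

/-- The coefficient of the angular form in the chart at `x₀`. -/
def angularCoeff (x₀ x : M) (z : Eu (m + 1)) : ℝ :=
  sphereVolume m * o.chartSign x₀ x *
    fibreDensity (fun v => F.inChart x₀ (chartAt (Eu (m + 1)) x₀ x, v)) z /
      fibreVolume (fun v => F.inChart x₀ (chartAt (Eu (m + 1)) x₀ x, v))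

/-- The normalized angular form of the metric extended to `HM` by means of the chart at `x₀`. -/
def localFibreForm (x₀ : M) : DiffForm (Eu (m + 1) × Eu m) m (HomBundle m M) := fun p =>
  F.angularCoeff o x₀ p.proj (p.unitRep x₀) •
    (angularForm (p.unitRep x₀)).compContinuousLinearMap
      (mfderiv 𝓘(ℝ, Eu (m + 1) × Eu m) 𝓘(ℝ, Eu (m + 1)) (HomBundle.unitRep x₀) p)

open HomBundle in
theorem localFibreForm_inChart {x₀ : M} {p : HomBundle m M} {q : Eu (m + 1) × Eu m}
    (hq : q ∈ transSet x₀ p) (Z : Fin m → Eu (m + 1) × Eu m) :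
    (F.localFibreForm o x₀).inChart p q Z =
      F.angularCoeff o x₀ ((chartAt (Eu (m + 1)) p.proj).symm q.1) (toSphere (transRep x₀ p q)) *
        eDet (m + 1) (Fin.cons (toSphere (transRep x₀ p q)) fun j =>
          fderiv ℝ (fun q => toSphere (transRep x₀ p q)) q (Z j)) := by
  rw [← unitRep_chartAt_symm hq]
  simp only [← mfderiv_unitRep hq]
  rfl

open HomBundle in
theorem contDiffAt_angularCoeff {x₀ : M} {p : HomBundle m M} {q : Eu (m + 1) × Eu m}
    (hq : q ∈ transSet x₀ p) :
    ContDiffAt ℝ ∞ (fun q => F.angularCoeff o x₀ ((chartAt (Eu (m + 1)) p.proj).symm q.1)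
      (toSphere (transRep x₀ p q))) q := by
  have h := mem_transSet.1 hq
  have hS := (isOpen_transSet x₀ p).mem_nhds hq
  have hc : ContDiffAt ℝ ∞ (fun q : Eu (m + 1) × Eu m =>
      chartAt (Eu (m + 1)) x₀ ((chartAt (Eu (m + 1)) p.proj).symm q.1)) q :=
    ContDiffAt.comp (f := Prod.fst) (g := chartAt (Eu (m + 1)) x₀ ∘
      (chartAt (Eu (m + 1)) p.proj).symm) q (((contDiffOn_trans (achart (Eu (m + 1)) p.proj)
      (achart (Eu (m + 1)) x₀)).contDiffAt
        (((chartAt (Eu (m + 1)) p.proj).symm.trans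
          (chartAt (Eu (m + 1)) x₀)).open_source.mem_nhds hq))) contDiffAt_fst
  have ht : chartAt (Eu (m + 1)) x₀ ((chartAt (Eu (m + 1)) p.proj).symm q.1) ∈
      (chartAt (Eu (m + 1)) x₀).target := (chartAt (Eu (m + 1)) x₀).map_source h.2
  have hs := (contDiffOn_toSphere_transRep x₀ p).contDiffAt hS
  have h1 : ContDiffAt ℝ ∞ (fun q : Eu (m + 1) × Eu m =>
      o.chartSign x₀ ((chartAt (Eu (m + 1)) p.proj).symm q.1)) q :=
    ContDiffAt.comp (f := Prod.fst) q (o.contDiffAt_chartSign x₀ p.proj h.1 h.2) contDiffAt_fst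
  have hD : IsOpen ((chartAt (Eu (m + 1)) x₀).target ×ˢ {v : Eu (m + 1) | v ≠ 0}) :=
    (chartAt (Eu (m + 1)) x₀).open_target.prod isOpen_ne
  have h2 := ContDiffAt.comp q ((F.contDiffOn_fibreDensity_inChart x₀).contDiffAt
    (hD.mem_nhds (Set.mk_mem_prod ht (toSphere_ne_zero (transRep_ne_zero hq))))) (hc.prodMk hs)
  have h3 := ContDiffAt.comp q ((F.contDiffOn_fibreVolume_inChart x₀).contDiffAt
    ((chartAt (Eu (m + 1)) x₀).open_target.mem_nhds ht)) hc
  exact ((contDiffAt_const.mul h1).mul h2).div h3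
    (F.isMinkowskiNorm_inChart x₀ ht).fibreVolume_pos.ne'

open HomBundle in
theorem contDiffAt_localFibreForm {x₀ : M} {p : HomBundle m M} {q : Eu (m + 1) × Eu m}
    (hq : q ∈ transSet x₀ p) : ContDiffAt ℝ ∞ ((F.localFibreForm o x₀).inChart p) q := by
  have hS := (isOpen_transSet x₀ p).mem_nhds hq
  have hs := contDiffOn_toSphere_transRep x₀ p
  refine contDiffAt_of_forall_apply fun Z => ContDiffAt.congr_of_eventuallyEq
    (f := fun q => F.angularCoeff o x₀ ((chartAt (Eu (m + 1)) p.proj).symm q.1)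
      (toSphere (transRep x₀ p q)) * eDet (m + 1) (Fin.cons (toSphere (transRep x₀ p q)) fun j =>
          fderiv ℝ (fun q => toSphere (transRep x₀ p q)) q (Z j))) ?_ ?_
  · refine (F.contDiffAt_angularCoeff o hq).mul (ContDiffAt.comp q contDiff_eDet.contDiffAt ?_)
    refine contDiffAt_pi.2 fun i => Fin.cases ?_ (fun j => ?_) i
    · exact hs.contDiffAt hS
    · exact ((hs.fderiv_of_isOpen (isOpen_transSet x₀ p) le_rfl).contDiffAt hS).clm_apply
        contDiffAt_const
  · filter_upwards [hS] with q' hq' using F.localFibreForm_inChart o hq' Z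

open HomBundle in
/-- On vertical vectors, the local forms do not depend on the chart. -/
theorem localFibreForm_vertical {x₀ : M} {p : HomBundle m M}
    (hp : p.proj ∈ (chartAt (Eu (m + 1)) x₀).source) (η : Fin m → Eu m) :
    F.localFibreForm o x₀ p (fun j => ((0, η j) : Eu (m + 1) × Eu m)) =
      sphereVolume m * fibreDensity (F.fibre p.proj) p.affRep / fibreVolume (F.fibre p.proj) *
        orientDet (o.orient p.proj) (Fin.cons p.affRep fun j => affLin p.chartIndex (η j)) := by
  set q : Eu (m + 1) × Eu m := chartAt (Eu (m + 1) × Eu m) p p with hq0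
  have hqs : (chartAt (Eu (m + 1)) p.proj).symm q.1 = p.proj :=
    (chartAt (Eu (m + 1)) p.proj).left_inv (mem_chart_source _ _)
  have hq : q ∈ transSet x₀ p :=
    mem_transSet.2 ⟨mem_chart_target _ p.proj, by rw [hqs]; exact hp⟩
  have h1 : F.localFibreForm o x₀ p (fun j => ((0, η j) : Eu (m + 1) × Eu m)) =
      (F.localFibreForm o x₀).inChart p q fun j => ((0, η j) : Eu (m + 1) × Eu m) := by
    rw [DiffForm.inChart, DiffForm.pullback, hq0, mfderiv_chartAt_symm_eq_id,
      (chartAt (Eu (m + 1) × Eu m) p).left_inv (mem_chart_source _ p)]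
    rfl
  have hz : transRep x₀ p q = toChartL x₀ p.proj p.affRep := by
    rw [transRep_eq hq, hqs, ofChartL_self]
    rfl
  have hz0 := transRep_ne_zero hq
  -- With the base point fixed, `transRep` is a linear map applied to an affine one; the chain rule
  -- does the rest.
  have hf : ∀ w : Eu m, fderiv ℝ (fun q => toSphere (transRep x₀ p q)) q (0, w) =
      fderiv ℝ toSphere (transRep x₀ p q) (toChartL x₀ p.proj (affLin p.chartIndex w)) := by
    intro w
    have h2 : HasFDerivAt toSphere (fderiv ℝ toSphere (transRep x₀ p q)) (transRep x₀ p q) :=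
      ((contDiffAt_toSphere hz0).differentiableAt (by simp)).hasFDerivAt
    have h3 : HasFDerivAt (transRep x₀ p) (fderiv ℝ (transRep x₀ p) q) q :=
      (((contDiffOn_transRep x₀ p).contDiffAt ((isOpen_transSet x₀ p).mem_nhds
        hq)).differentiableAt (by simp)).hasFDerivAt
    have h4 : HasFDerivAt (fun y : Eu m => transRep x₀ p (q.1, y))
        ((fderiv ℝ (transRep x₀ p) q).comp (ContinuousLinearMap.inr ℝ _ _)) q.2 :=
      HasFDerivAt.comp q.2 h3 (hasFDerivAt_prodMk_right q.1 q.2)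
    have h5 : HasFDerivAt (fun y : Eu m => transRep x₀ p (q.1, y))
        ((transD (achart (Eu (m + 1)) p.proj) (achart (Eu (m + 1)) x₀) q.1).comp
          (affLin p.chartIndex)) q.2 :=
      HasFDerivAt.comp (g := transD (achart (Eu (m + 1)) p.proj) (achart (Eu (m + 1)) x₀) q.1) q.2
        (ContinuousLinearMap.hasFDerivAt _) (hasFDerivAt_affVec _ _ _)
    have h6 := DFunLike.congr_fun (h4.unique h5) w
    have h7 : transD (achart (Eu (m + 1)) p.proj) (achart (Eu (m + 1)) x₀) q.1 =
        toChartL x₀ p.proj := (coordChange_eq _ _ _).symm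
    rw [h7] at h6
    have h8 : HasFDerivAt (fun q => toSphere (transRep x₀ p q)) _ q := h2.comp q h3
    rw [h8.fderiv]
    exact congrArg (fderiv ℝ toSphere (transRep x₀ p q)) h6
  have h9 : (Fin.cons (toChartL x₀ p.proj p.affRep) fun j =>
      toChartL x₀ p.proj (affLin p.chartIndex (η j)) : Fin (m + 1) → Eu (m + 1)) =
      fun i => toChartL x₀ p.proj ((Fin.cons p.affRep fun j => affLin p.chartIndex (η j) :
        Fin (m + 1) → Eu (m + 1)) i) := by
    ext1 i
    refine Fin.cases rfl (fun i => rfl) i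
  rw [h1, F.localFibreForm_inChart o hq, hqs]
  simp only [hf]
  rw [eDet_toSphere hz0, hz, h9, eDet_map, angularCoeff,
    orientDet_apply (o.orient p.proj) (Fin.cons p.affRep fun j => affLin p.chartIndex (η j))]
  rw [hz] at hz0
  have hn : 0 < ‖toChartL x₀ p.proj p.affRep‖ := norm_pos_iff.2 hz0
  have hM : IsMinkowskiNorm fun v => F.inChart x₀ (chartAt (Eu (m + 1)) x₀ p.proj, v) :=
    F.isMinkowskiNorm_inChart x₀ ((chartAt (Eu (m + 1)) x₀).map_source hp)
  -- The powers of the norm from the density and from the angular form cancel. With `D` the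
  -- determinant of `ofChartL` and `D'` its inverse, what is left is `chartSign * D ^ 2 * D' / |D|`,
  -- which is the orientation sign at the point.
  rw [toSphere, hM.fibreDensity_smul _ (inv_pos.2 hn), F.fibreDensity_inChart hp p.affRep_ne_zero,
    F.fibreVolume_inChart hp]
  have hJ := (F.isMinkowskiNorm_fibre p.proj).fibreVolume_pos.ne'
  have hs := o.chartSign_mul_abs x₀ p.proj
  have hd := det_toChartL_mul_det_ofChartL hp
  have hd0 := abs_ne_zero.2 (det_ofChartL_ne_zero hp)
  have hsq := sq_abs (ofChartL (m := m) x₀ p.proj).det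
  set D := (ofChartL (m := m) x₀ p.proj).det
  set D' := (toChartL (m := m) x₀ p.proj).det
  rw [← hsq]
  field_simp
  linear_combination (sphereVolume m * fibreDensity (F.fibre p.proj) p.affRep *
    eDet (m + 1) (Fin.cons p.affRep fun j => affLin p.chartIndex (η j))) *
      (D' * hs + orientSign (o.orient p.proj) * hd)

end FinslerMetric

end FibreForm

/-! ### Gluing the fibre form and integrating it -/

section GlobalFibreForm

variable {m : ℕ} {M : Type*} [TopologicalSpace M] [ChartedSpace (Eu (m + 1)) M]
  [IsManifold 𝓘(ℝ, Eu (m + 1)) ∞ M]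

namespace FinslerMetric

variable (F : FinslerMetric m M) (o : ManifoldOrientation m M)
  (ρ : SmoothPartitionOfUnity M 𝓘(ℝ, Eu (m + 1)) M univ)

/-- The local fibre forms glued by a partition of unity. -/
def fibreForm : DiffForm (Eu (m + 1) × Eu m) m (HomBundle m M) := fun p =>
  ∑ x₀ ∈ ρ.finsupport p.proj, ρ x₀ p.proj • F.localFibreForm o x₀ p

theorem fibreForm_apply (p : HomBundle m M) {I : Finset M} (hI : ρ.finsupport p.proj ⊆ I)
    (Z : Fin m → TangentSpace 𝓘(ℝ, Eu (m + 1) × Eu m) p) : F.fibreForm o ρ p Z =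
      ∑ x₀ ∈ I, ρ x₀ p.proj * F.localFibreForm o x₀ p Z := by
  rw [fibreForm, ContinuousAlternatingMap.sum_apply]
  refine Finset.sum_subset hI fun x₀ _ hx => ?_
  have h : ρ x₀ p.proj = 0 := by
    by_contra hne
    exact hx ((ρ.mem_finsupport p.proj).2 hne)
  rw [h, zero_smul]
  rfl

theorem isSmooth_fibreForm
    (hρ : ρ.IsSubordinate fun x => (chartAt (Eu (m + 1)) x).source) :
    (F.fibreForm o ρ).IsSmooth := by
  intro p q hq
  refine ContDiffAt.contDiffWithinAt (contDiffAt_of_forall_apply fun Z => ?_)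
  have hq1 : q.1 ∈ (chartAt (Eu (m + 1)) p.proj).target := hq.1
  have hc : ContinuousAt (fun q : Eu (m + 1) × Eu m => (chartAt (Eu (m + 1)) p.proj).symm q.1) q :=
    ContinuousAt.comp (f := Prod.fst) ((chartAt (Eu (m + 1)) p.proj).continuousAt_symm hq1)
      continuousAt_fst
  set x := (chartAt (Eu (m + 1)) p.proj).symm q.1 with hx
  -- Near `x` the varying index set of the sum can be replaced by the fixed finite set of those `x₀`
  -- whose weight has `x` in its closed support. Subordination puts `x` in the chart domains of all
  -- of them.
  have h1 : (fun q => (F.fibreForm o ρ).inChart p q Z) =ᶠ[𝓝 q] fun q => ∑ x₀ ∈ ρ.fintsupport x,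
      ρ x₀ ((chartAt (Eu (m + 1)) p.proj).symm q.1) * (F.localFibreForm o x₀).inChart p q Z := by
    filter_upwards [hc.eventually (ρ.eventually_finsupport_subset x)] with q' hq'
    exact F.fibreForm_apply o ρ ((chartAt (Eu (m + 1) × Eu m) p).symm q') hq' _
  refine ContDiffAt.congr_of_eventuallyEq (ContDiffAt.sum fun x₀ hx₀ => ?_) h1
  have hx₀' : x ∈ (chartAt (Eu (m + 1)) x₀).source := hρ x₀ ((ρ.mem_fintsupport_iff x x₀).1 hx₀)
  have h2 : ContDiffAt ℝ ∞ (fun a => ρ x₀ ((chartAt (Eu (m + 1)) p.proj).symm a)) q.1 := by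
    have h3 := (ρ x₀).contMDiff.comp_contMDiffOn
      (contMDiffOn_chart_symm (I := 𝓘(ℝ, Eu (m + 1))) (x := p.proj))
    exact (contMDiffOn_iff_contDiffOn.1 h3).contDiffAt
      ((chartAt (Eu (m + 1)) p.proj).open_target.mem_nhds hq1)
  refine (ContDiffAt.comp (f := Prod.fst) q h2 contDiffAt_fst).mul ?_
  have h4 := F.contDiffAt_localFibreForm o (HomBundle.mem_transSet.2 ⟨hq1, hx₀'⟩)
  exact (ContinuousAlternatingMap.apply ℝ (Eu (m + 1) × Eu m) ℝ Z).contDiff.contDiffAt.comp q h4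

/-- The local forms with nonzero weight have the same vertical values, and the weights add up to
`1`; gluing only mixes the other components. -/
theorem fibreForm_vertical
    (hρ : ρ.IsSubordinate fun x => (chartAt (Eu (m + 1)) x).source)
    (p : HomBundle m M) (η : Fin m → Eu m) :
    F.fibreForm o ρ p (fun j => ((0, η j) : Eu (m + 1) × Eu m)) =
      sphereVolume m / fibreVolume (F.fibre p.proj) * fibreDensity (F.fibre p.proj) p.affRep *
        orientDet (o.orient p.proj) (Fin.cons p.affRep fun j => affLin p.chartIndex (η j)) := by
  have h1 : ∀ x₀ ∈ ρ.finsupport p.proj,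
      ρ x₀ p.proj * F.localFibreForm o x₀ p (fun j => ((0, η j) : Eu (m + 1) × Eu m)) =
      ρ x₀ p.proj * (sphereVolume m * fibreDensity (F.fibre p.proj) p.affRep /
        fibreVolume (F.fibre p.proj) *
        orientDet (o.orient p.proj) (Fin.cons p.affRep fun j => affLin p.chartIndex (η j))) := by
    intro x₀ hx₀
    have hmem : p.proj ∈ (chartAt (Eu (m + 1)) x₀).source :=
      hρ x₀ (subset_tsupport _ ((ρ.mem_finsupport p.proj).1 hx₀))
    exact congrArg _ (F.localFibreForm_vertical o hmem η)
  refine (F.fibreForm_apply o ρ p subset_rfl _).trans ((Finset.sum_congr rfl h1).trans ?_)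
  rw [← Finset.sum_mul, ρ.sum_finsupport p.proj (mem_univ _), one_mul, mul_div_right_comm]

/-- Passing from the affine representative to `u = l • affRep` multiplies the angular form by `l ^
(m + 1)` and the density by its inverse, while the radial parts of the `w j` drop out of the
determinant. -/
theorem pullback_cls_apply {α : DiffForm (Eu (m + 1) × Eu m) m (HomBundle m M)} {x : M} {κ : ℝ}
    (h : ∀ (p : HomBundle m M), p.proj = x → ∀ η : Fin m → Eu m,
      α p (fun j => ((0, η j) : Eu (m + 1) × Eu m)) = κ * fibreDensity (F.fibre x) p.affRep *
        orientDet (o.orient x) (Fin.cons p.affRep fun j => affLin p.chartIndex (η j)))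
    {u : Eu (m + 1)} (hu : u ≠ 0) (w : Fin m → Eu (m + 1)) :
    DiffForm.pullback (W := Eu (m + 1)) (N' := Eu (m + 1)) (fun v => HomBundle.cls x v) α u w =
      κ * fibreDensity (F.fibre x) u * orientDet (o.orient x) (Fin.cons u w) := by
  set p : HomBundle m M := HomBundle.cls x u with hp
  have hpos : 0 < ((p.chartUnit : ℤ) : ℝ) * u p.chartIndex := HomBundle.pos_of_cls x hu
  have hr : p.affRep = affVec p.chartIndex p.chartUnit (affCoord p.chartIndex p.chartUnit u) := by
    rw [HomBundle.affRep]
    congr 1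
    exact congrArg Prod.snd (HomBundle.chartAt_cls x hu (p := p) rfl)
  set l := ((p.chartUnit : ℤ) : ℝ) * u p.chartIndex with hl
  have hur : u = l • p.affRep := by
    rw [hr, affVec_affCoord _ _ _ hpos, smul_smul, mul_inv_cancel₀ hpos.ne', one_smul]
  let η : Fin m → Eu m := fun j => fderiv ℝ (affCoord p.chartIndex p.chartUnit) u (w j)
  have h1 : DiffForm.pullback (W := Eu (m + 1)) (N' := Eu (m + 1)) (fun v => HomBundle.cls x v) α
      u w = α p (fun j => ((0, η j) : Eu (m + 1) × Eu m)) := by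
    have h2 : (fun j => ((0, η j) : Eu (m + 1) × Eu m)) = fun j =>
      mfderiv 𝓘(ℝ, Eu (m + 1)) 𝓘(ℝ, Eu (m + 1) × Eu m)
        (fun v : Eu (m + 1) => (HomBundle.cls x v : HomBundle m M)) u (w j) :=
      funext fun j => (HomBundle.proj_mfderiv_cls x hu (w j)).symm
    rw [h2]
    rfl
  have h3 : ∀ j, w j = l • affLin p.chartIndex (η j) +
      (((p.chartUnit : ℤ) : ℝ) * w j p.chartIndex) • p.affRep := by
    intro j
    rw [hr]
    exact eq_smul_affLin_add hpos (w j)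
  have h4 : eDet (m + 1) (Fin.cons u w) =
      l ^ (m + 1) * eDet (m + 1) (Fin.cons p.affRep fun j => affLin p.chartIndex (η j)) := by
    have h5 : (Fin.cons u w : Fin (m + 1) → Eu (m + 1)) =
        Function.update (Fin.cons p.affRep w) 0 (l • p.affRep) := by
      rw [Fin.update_cons_zero, ← hur]
    rw [h5, AlternatingMap.map_update_smul, Fin.update_cons_zero, funext h3, eDet_cons_smul_add,
      smul_eq_mul, ← mul_assoc, ← pow_succ']
  have h6 := (F.isMinkowskiNorm_fibre x).fibreDensity_smul p.affRep hpos
  rw [← hur] at h6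
  rw [h1, h p rfl, orientDet_apply (o.orient x) (Fin.cons u w), h4, h6,
    orientDet_apply (o.orient x) (Fin.cons p.affRep fun j => affLin p.chartIndex (η j))]
  have := pow_pos hpos (m + 1)
  field_simp

/-- The vertical values fix the pullback to the sphere, whose coefficient relative to the volume
form of the sphere is `κ` times the density. -/
theorem fibreIntegral_eq {α : DiffForm (Eu (m + 1) × Eu m) m (HomBundle m M)} {x : M} {κ : ℝ}
    (h : ∀ (p : HomBundle m M), p.proj = x → ∀ η : Fin m → Eu m,
      α p (fun j => ((0, η j) : Eu (m + 1) × Eu m)) = κ * fibreDensity (F.fibre x) p.affRep *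
        orientDet (o.orient x) (Fin.cons p.affRep fun j => affLin p.chartIndex (η j))) :
    fibreIntegral o α x = κ * fibreVolume (F.fibre x) := by
  rw [fibreVolume, ← integral_const_mul]
  refine integral_congr_ae (Eventually.of_forall fun u => ?_)
  exact wedge_inner_finOrthonormalBasis (o.orient x) (norm_eq_of_mem_sphere u) _ _
    fun w => F.pullback_cls_apply o h (ne_zero_of_mem_unit_sphere u) w

end FinslerMetric

/-- A form pulled back from the base vanishes when one argument is vertical, so only one shuffle
survives. This is why the equation sees `α` through its vertical values alone. -/
theorem wedge_pullback_proj {α : DiffForm (Eu (m + 1) × Eu m) m (HomBundle m M)}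
    (Ω : DiffForm (Eu (m + 1)) (m + 1) M) (p : HomBundle m M) (η : Fin m → Eu m)
    (ξ : Fin (m + 1) → Eu (m + 1)) :
    wedge (α p).toAlternatingMap (Ω.pullback HomBundle.proj p).toAlternatingMap
      (Fin.append (fun j => ((0, η j) : Eu (m + 1) × Eu m))
        (fun j => ((ξ j, 0) : Eu (m + 1) × Eu m))) =
      α p (fun j => ((0, η j) : Eu (m + 1) × Eu m)) * Ω p.proj ξ := by
  have hb : ∀ z : Fin (m + 1) → Eu (m + 1) × Eu m,
      (Ω.pullback HomBundle.proj p).toAlternatingMap z = Ω p.proj fun i => (z i).1 := by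
    intro z
    change Ω p.proj (fun i => mfderiv 𝓘(ℝ, Eu (m + 1) × Eu m) 𝓘(ℝ, Eu (m + 1))
      (HomBundle.proj : HomBundle m M → M) p (z i)) = _
    rw [HomBundle.mfderiv_proj]
    rfl
  refine (wedge_append (V := Eu (m + 1) × Eu m) (α p).toAlternatingMap
    (Ω.pullback HomBundle.proj p).toAlternatingMap _ _ fun z i j hz => ?_).trans
      (congrArg _ (hb _))
  refine (hb z).trans ((Ω p.proj).map_coord_zero i ?_)
  rw [hz]
  rfl

/-- Two forms of top degree which agree, and do not vanish, on some family are equal. -/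
theorem alternatingMap_eq_of_apply_eq {V : Type*} [AddCommGroup V] [Module ℝ V] {k : ℕ}
    (hk : k = finrank ℝ V) {f g : V [⋀^Fin k]→ₗ[ℝ] ℝ} {v : Fin k → V} (h : f v = g v)
    (h0 : g v ≠ 0) : f = g := by
  have hli : LinearIndependent ℝ v := by
    by_contra hn
    exact h0 (g.map_linearDependent v hn)
  rcases Nat.eq_zero_or_pos k with rfl | hpos
  · ext w
    rw [Subsingleton.elim w v, h]
  have : Nonempty (Fin k) := ⟨⟨0, hpos⟩⟩
  let b := basisOfLinearIndependentOfCardEqFinrank hli (by simpa using hk)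
  have hb : ⇑b = v := coe_basisOfLinearIndependentOfCardEqFinrank _ _
  rw [f.eq_smul_basis_det b, g.eq_smul_basis_det b, hb, h]

end GlobalFibreForm

end

/-! ### Uniqueness and existence of the volume form -/

/-- The vertical part of a form which solves the equation `α ∧ π^* Ω = A ∧ (dA) ^ (n - 1)`. -/
theorem FinslerMetric.vertical_eq_of_wedge_eq {m : ℕ} {M : Type*} [TopologicalSpace M]
    [ChartedSpace (Eu (m + 1)) M] [IsManifold 𝓘(ℝ, Eu (m + 1)) ∞ M] (F : FinslerMetric m M)
    {α : DiffForm (Eu (m + 1) × Eu m) m (HomBundle m M)} {Ω : DiffForm (Eu (m + 1)) (m + 1) M}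
    {C : ℝ} {p : HomBundle m M} {ξ : Fin (m + 1) → Eu (m + 1)}
    (hξ : fibreDensity (F.fibre p.proj) p.affRep / 2 ^ (m + 1) *
      eDet (m + 1) (Fin.cons p.affRep fun j =>
        affLin p.chartIndex (EuclideanSpace.single j 1)) * eDet (m + 1) ξ = 1)
    (hC : F.contactVolume p (Fin.append
      (fun j => ((0, EuclideanSpace.single j 1) : Eu (m + 1) × Eu m))
      (fun j => ((ξ j, 0) : Eu (m + 1) × Eu m))) = C)
    (h : wedge (α p).toAlternatingMap (Ω.pullback HomBundle.proj p).toAlternatingMap =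
      F.contactVolume p) {g : ℝ} (hg : ∀ v : Fin (m + 1) → Eu (m + 1),
        Ω p.proj v = g * eDet (m + 1) v) (η : Fin m → Eu m) :
    α p (fun j => ((0, η j) : Eu (m + 1) × Eu m)) * g =
      C / 2 ^ (m + 1) * fibreDensity (F.fibre p.proj) p.affRep *
        eDet (m + 1) (Fin.cons p.affRep fun j => affLin p.chartIndex (η j)) := by
  rw [← h] at hC
  have h1 := (wedge_pullback_proj Ω p (fun j => EuclideanSpace.single j 1) ξ).symm.trans hC
  rw [hg] at h1
  let αp : (Eu (m + 1) × Eu m) [⋀^Fin m]→ₗ[ℝ] ℝ := (α p).toAlternatingMap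
  -- Both sides are top forms in `η`, hence multiples of the determinant; it suffices to compare
  -- them on the standard basis, where `hξ` and `hC` apply.
  let a : Eu m [⋀^Fin m]→ₗ[ℝ] ℝ := αp.compLinearMap (LinearMap.inr ℝ (Eu (m + 1)) (Eu m))
  let b : Eu m [⋀^Fin m]→ₗ[ℝ] ℝ :=
    (angularForm p.affRep).toAlternatingMap.compLinearMap (affLin p.chartIndex).toLinearMap
  have ha : a η = a (fun j => EuclideanSpace.single j 1) * eDet m η :=
    DFunLike.congr_fun (eq_smul_eDet a) η
  have hb : b η = b (fun j => EuclideanSpace.single j 1) * eDet m η :=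
    DFunLike.congr_fun (eq_smul_eDet b) η
  have h2 : a (fun j => EuclideanSpace.single j 1) * (g * eDet (m + 1) ξ) = C := h1
  have h3 : fibreDensity (F.fibre p.proj) p.affRep / 2 ^ (m + 1) *
    b (fun j => EuclideanSpace.single j 1) * eDet (m + 1) ξ = 1 := hξ
  change a η * g = C / 2 ^ (m + 1) * fibreDensity (F.fibre p.proj) p.affRep * b η
  rw [ha, hb]
  linear_combination (-g * a (fun j => EuclideanSpace.single j 1) * eDet m η) * h3 +
    (fibreDensity (F.fibre p.proj) p.affRep / 2 ^ (m + 1) *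
      b (fun j => EuclideanSpace.single j 1) * eDet m η) * h2

theorem mainTheorem9 {m : ℕ} {M : Type*} [TopologicalSpace M] [ChartedSpace (Eu (m + 1)) M]
    [IsManifold 𝓘(ℝ, Eu (m + 1)) ∞ M] [T2Space M] [SigmaCompactSpace M]
    (o : ManifoldOrientation m M) (F : FinslerMetric m M) :
    ∃! Ω : DiffForm (Eu (m + 1)) (m + 1) M, IsVolumeForm Ω ∧
      ∃ α : DiffForm (Eu (m + 1) × Eu m) m (HomBundle m M),
        α.IsSmooth ∧ NowhereZeroOnVertical α ∧
        (∀ p : HomBundle m M,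
          wedge (α p).toAlternatingMap (Ω.pullback HomBundle.proj p).toAlternatingMap =
            F.contactVolume p) ∧
        ∀ x : M, fibreIntegral o α x = sphereVolume m := by
  obtain ⟨C, hC, hcontact⟩ := exists_contactVolume_eq m M
  have hvol := (sphereVolume_pos m).ne'
  have hJ : ∀ x, fibreVolume (F.fibre x) ≠ 0 := fun x =>
    (F.isMinkowskiNorm_fibre x).fibreVolume_pos.ne'
  have hos : ∀ x, orientSign (o.orient x) * orientSign (o.orient x) = 1 := fun x =>
    orientSign_mul_self (o.orient x)
  have hos0 : ∀ x, orientSign (o.orient x) ≠ 0 := fun x => left_ne_zero_of_mul_eq_one (hos x)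
  -- The only possible constant: the fibre integral of the forced vertical part must be
  -- `sphereVolume m`.
  set K := C / 2 ^ (m + 1) / sphereVolume m with hKdef
  have hK : K ≠ 0 := div_ne_zero (div_ne_zero hC (by positivity)) hvol
  refine ⟨F.volumeForm o K, ⟨F.isVolumeForm_volumeForm o hK, ?_⟩, ?_⟩
  · obtain ⟨ρ, hρ⟩ := SmoothPartitionOfUnity.exists_isSubordinate_chartAt_source
      𝓘(ℝ, Eu (m + 1)) M
    have hv := F.fibreForm_vertical o ρ hρ
    refine ⟨F.fibreForm o ρ, F.isSmooth_fibreForm o ρ hρ, fun p => ?_, fun p => ?_, fun x => ?_⟩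
    · refine ⟨fun j => ((0, EuclideanSpace.single j 1) : Eu (m + 1) × Eu m), fun j => ?_, ?_⟩
      · rw [HomBundle.mfderiv_proj]
        rfl
      · rw [hv, orientDet_apply (o.orient p.proj)
          (Fin.cons p.affRep fun j => affLin p.chartIndex (EuclideanSpace.single j 1))]
        exact mul_ne_zero (mul_ne_zero (div_ne_zero hvol (hJ _))
          ((F.isMinkowskiNorm_fibre p.proj).fibreDensity_pos p.affRep_ne_zero).ne')
          (mul_ne_zero (hos0 _) (eDet_affVec_affLin_ne_zero _ _ _))
    · obtain ⟨ξ, hξ, hc⟩ := hcontact F p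
      -- Both sides have the top degree `2 m + 1`, so it is enough to compare them on the Darboux
      -- family, where the contact volume is `C ≠ 0`.
      refine alternatingMap_eq_of_apply_eq (V := Eu (m + 1) × Eu m) (by simp [add_comm])
        (v := Fin.append (fun j => ((0, EuclideanSpace.single j 1) : Eu (m + 1) × Eu m))
          (fun j => ((ξ j, 0) : Eu (m + 1) × Eu m))) ?_ (hc.trans_ne hC)
      refine (wedge_pullback_proj _ p _ ξ).trans (Eq.trans ?_ hc.symm)
      rw [hv, F.volumeForm_apply, orientDet_apply (o.orient p.proj)
        (Fin.cons p.affRep fun j => affLin p.chartIndex (EuclideanSpace.single j 1)), hKdef]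
      have hJp := hJ p.proj
      have hop := hos p.proj
      field_simp at hξ ⊢
      linear_combination (orientSign (o.orient p.proj) * orientSign (o.orient p.proj)) * hξ +
        2 ^ (m + 1) * hop
    · rw [F.fibreIntegral_eq o (κ := sphereVolume m / fibreVolume (F.fibre x)) ?_,
        div_mul_cancel₀ _ (hJ x)]
      rintro p rfl η
      exact hv p η
  · rintro Ω ⟨-, α, -, -, hwedge, hint⟩
    ext1 x
    set g : ℝ := Ω x (fun i => EuclideanSpace.single (𝕜 := ℝ) i 1) with hgdef
    have hg : ∀ v : Fin (m + 1) → Eu (m + 1), Ω x v = g * eDet (m + 1) v := fun v =>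
      DFunLike.congr_fun (eq_smul_eDet (k := m + 1) (Ω x).toAlternatingMap) v
    -- If the coefficient of `Ω` vanished at `x`, the equation would make the contact volume vanish
    -- at points above `x`.
    have hg0 : g ≠ 0 := by
      intro h0
      let p : HomBundle m M := HomBundle.cls x (EuclideanSpace.single (𝕜 := ℝ) (0 : Fin (m + 1)) 1)
      obtain ⟨ξ, hξ, hc⟩ := hcontact F p
      have h1 := F.vertical_eq_of_wedge_eq hξ hc (hwedge p) (g := g) hg
        fun j => EuclideanSpace.single j 1
      rw [h0, mul_zero] at h1
      refine mul_ne_zero (mul_ne_zero (div_ne_zero hC (by positivity)) ?_)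
        (eDet_affVec_affLin_ne_zero _ _ _) h1.symm
      exact ((F.isMinkowskiNorm_fibre p.proj).fibreDensity_pos p.affRep_ne_zero).ne'
    -- The equation prescribes the vertical part of `α`; the orientation sign enters `κ` because the
    -- fibre is integrated with `orientDet` in place of `eDet`.
    have hfib := F.fibreIntegral_eq o (α := α) (x := x)
      (κ := C / 2 ^ (m + 1) / (g * orientSign (o.orient x))) ?_
    · rw [hint x] at hfib
      have hgK : g = K * fibreVolume (F.fibre x) * orientSign (o.orient x) := by
        have ho := hos0 x
        have hJx := hJ x
        rw [hKdef]
        field_simp at hfib ⊢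
        linear_combination orientSign (o.orient x) * hfib - g * sphereVolume m * 2 ^ (m + 1) * hos x
      refine ContinuousAlternatingMap.ext fun v => ?_
      exact (hg v).trans (congrArg (· * eDet (m + 1) v) hgK)
    · rintro p rfl η
      obtain ⟨ξ, hξ, hc⟩ := hcontact F p
      have h1 := F.vertical_eq_of_wedge_eq hξ hc (hwedge p) (g := g) hg η
      rw [orientDet_apply (o.orient p.proj)
        (Fin.cons p.affRep fun j => affLin p.chartIndex (η j))]
      have ho := hos0 p.proj
      field_simp at h1 ⊢
      linear_combination h1
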